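/- Call a polynomial $p\in\mathbb R[x,y]$ real stable if $p$ is identically zero or $p(z,w)\neq 0$ for all $z,w\in\mathbb C$ with $\operatorname{Im} z>0$ and $\operatorname{Im} w>0$. For $n\ge 0$ let $\mathbb R_n[x,y]$ be the space of real polynomials of degree at most $n$ in each of the two variables. There is a deterministic algorithm which, given $n$ and the $(n+1)^2$ coefficients of any $p\in\mathbb R_n[x,y]$, decides whether or not $p$ is real stable, using $O(n^5)$ operations in exact real arithmetic. Precisely, there are a single program for the real random access machine (independent of $n$ and $p$; real operations $+,-,\times,\div$ by nonzero numbers and comparisons; integer constants only; index registers with addition, truncated subtraction and comparison for addressing and loop control) and a constant $C$ such that for all $n\ge 0$ and all $p\in\mathbb R_n[x,y]$ the program, started on $n$ and the coefficients of $p$, halts without dividing by zero, answers $1$ if $p$ is real stable and $0$ if it is not, and uses in total at most $C\,(n+1)^5$ operations, where every operation on reals or indices, memory access, test and instruction counts as one. -/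

import Mathlib

/-- A real polynomial is real stable if it is identically zero or has no zero
all of whose coordinates lie in the open upper half-plane. -/
def RealStable {σ : Type*} (p : MvPolynomial σ ℝ) : Prop :=
  p = 0 ∨ ∀ z : σ → ℂ, (∀ i, 0 < (z i).im) → MvPolynomial.aeval z p ≠ 0

/-!
The algebraic model of computation (exact arithmetic): a real random access machine, programmed
by while-programs. A program is a finite object and does not depend on the input.
The machine has
* index registers holding natural numbers, used for addressing and loop control,
  with addition and truncated subtraction only;
* two-dimensional arrays of real cells, on which `+`, `-`, `*`, `/` and comparisons are exact.
The only real constants are integers. There is no rounding, and the only way a real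
number can influence the index registers is the outcome of a comparison.
Every operation, memory access, constant, test and instruction has unit cost.
-/

namespace RealRAM

/-- `idx r` is the content of index register `r`; `mem a i j` is the cell `(i, j)` of array `a`. -/
structure State where
  idx : ℕ → ℕ
  mem : ℕ → ℕ → ℕ → ℝ

/-- Write `v` to index register `r`. -/
def State.setIdx (s : State) (r v : ℕ) : State :=
  { s with idx := Function.update s.idx r v }

/-- Write `v` to the cell `(i, j)` of array `a`. -/
def State.setMem (s : State) (a i j : ℕ) (v : ℝ) : State :=
  { s with mem := fun a' i' j' => if a' = a ∧ i' = i ∧ j' = j then v else s.mem a' i' j' }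

/-- Index expressions. -/
inductive IExp where
  | const (k : ℕ)
  | reg (r : ℕ)
  | add (e f : IExp)
  | sub (e f : IExp)

/-- The value of an index expression; subtraction is truncated at zero. -/
def IExp.eval (s : State) : IExp → ℕ
  | const k => k
  | reg r => s.idx r
  | add e f => e.eval s + f.eval s
  | sub e f => e.eval s - f.eval s

/-- The number of nodes of an index expression. -/
def IExp.cost : IExp → ℕ
  | const _ => 1
  | reg _ => 1
  | add e f => e.cost + f.cost + 1
  | sub e f => e.cost + f.cost + 1

/-- Real expressions; division is a separate instruction. -/
inductive RExp where
  | const (k : ℤ)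
  | load (a : ℕ) (i j : IExp)
  | add (e f : RExp)
  | sub (e f : RExp)
  | mul (e f : RExp)

/-- The value of a real expression. -/
def RExp.eval (s : State) : RExp → ℝ
  | const k => (k : ℝ)
  | load a i j => s.mem a (i.eval s) (j.eval s)
  | add e f => e.eval s + f.eval s
  | sub e f => e.eval s - f.eval s
  | mul e f => e.eval s * f.eval s

/-- The number of nodes of a real expression, including those of its addresses. -/
def RExp.cost : RExp → ℕ
  | const _ => 1
  | load _ i j => i.cost + j.cost + 1
  | add e f => e.cost + f.cost + 1
  | sub e f => e.cost + f.cost + 1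
  | mul e f => e.cost + f.cost + 1

/-- Tests: comparisons of indices, comparisons of reals, and their Boolean combinations. -/
inductive Test where
  | ile (e f : IExp)
  | rle (e f : RExp)
  | neg (b : Test)
  | conj (b c : Test)

/-- The test `b` succeeds in the state `s`. -/
def Test.Holds (s : State) : Test → Prop
  | ile e f => e.eval s ≤ f.eval s
  | rle e f => e.eval s ≤ f.eval s
  | neg b => ¬ b.Holds s
  | conj b c => b.Holds s ∧ c.Holds s

/-- The number of nodes of a test, including those of its expressions. -/
def Test.cost : Test → ℕ
  | ile e f => e.cost + f.cost + 1
  | rle e f => e.cost + f.cost + 1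
  | neg b => b.cost + 1
  | conj b c => b.cost + c.cost + 1

/-- Programs. -/
inductive Program where
  | skip
  | setIdx (r : ℕ) (e : IExp)
  | setMem (a : ℕ) (i j : IExp) (e : RExp)
  | divMem (a : ℕ) (i j : IExp) (e f : RExp)
  | seq (P Q : Program)
  | cond (b : Test) (P Q : Program)
  | loop (b : Test) (P : Program)

/-- `Exec P s t s'`: started in the state `s`, the program `P` halts in the state `s'` after
operations of total cost `t`. A division by zero has no rule, so a program
that attempts one does not halt properly. -/
inductive Exec : Program → State → ℕ → State → Prop
  | skip (s : State) : Exec .skip s 1 s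
  | setIdx (s : State) (r : ℕ) (e : IExp) :
      Exec (.setIdx r e) s (e.cost + 1) (s.setIdx r (e.eval s))
  | setMem (s : State) (a : ℕ) (i j : IExp) (e : RExp) :
      Exec (.setMem a i j e) s (i.cost + j.cost + e.cost + 1)
        (s.setMem a (i.eval s) (j.eval s) (e.eval s))
  | divMem (s : State) (a : ℕ) (i j : IExp) (e f : RExp) (hf : f.eval s ≠ 0) :
      Exec (.divMem a i j e f) s (i.cost + j.cost + e.cost + f.cost + 1)
        (s.setMem a (i.eval s) (j.eval s) (e.eval s / f.eval s))
  | seq {P Q : Program} {s s' s'' : State} {t u : ℕ} (hP : Exec P s t s')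
      (hQ : Exec Q s' u s'') : Exec (.seq P Q) s (t + u) s''
  | condTrue {b : Test} {P Q : Program} {s s' : State} {t : ℕ} (hb : b.Holds s)
      (hP : Exec P s t s') : Exec (.cond b P Q) s (b.cost + 1 + t) s'
  | condFalse {b : Test} {P Q : Program} {s s' : State} {t : ℕ} (hb : ¬ b.Holds s)
      (hQ : Exec Q s t s') : Exec (.cond b P Q) s (b.cost + 1 + t) s'
  | loopDone {b : Test} {P : Program} {s : State} (hb : ¬ b.Holds s) :
      Exec (.loop b P) s (b.cost + 1) s
  | loopStep {b : Test} {P : Program} {s s' s'' : State} {t u : ℕ} (hb : b.Holds s)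
      (hP : Exec P s t s') (hl : Exec (.loop b P) s' u s'') :
      Exec (.loop b P) s (b.cost + 1 + t + u) s''

/-- The machine is deterministic. -/
theorem Exec.deterministic {P : Program} {s s₁ s₂ : State} {t₁ t₂ : ℕ}
    (h₁ : Exec P s t₁ s₁) (h₂ : Exec P s t₂ s₂) : t₁ = t₂ ∧ s₁ = s₂ := by
  induction h₁ generalizing t₂ s₂ with
  | skip => cases h₂; exact ⟨rfl, rfl⟩
  | setIdx => cases h₂; exact ⟨rfl, rfl⟩
  | setMem => cases h₂; exact ⟨rfl, rfl⟩
  | divMem => cases h₂; exact ⟨rfl, rfl⟩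
  | seq _ _ ihP ihQ =>
    cases h₂ with
    | seq hP hQ =>
      obtain ⟨rfl, rfl⟩ := ihP hP
      obtain ⟨rfl, rfl⟩ := ihQ hQ
      exact ⟨rfl, rfl⟩
  | condTrue hb _ ih =>
    cases h₂ with
    | condTrue _ hP => obtain ⟨rfl, rfl⟩ := ih hP; exact ⟨rfl, rfl⟩
    | condFalse hb' _ => exact absurd hb hb'
  | condFalse hb _ ih =>
    cases h₂ with
    | condTrue hb' _ => exact absurd hb' hb
    | condFalse _ hQ => obtain ⟨rfl, rfl⟩ := ih hQ; exact ⟨rfl, rfl⟩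
  | loopDone hb =>
    cases h₂ with
    | loopDone _ => exact ⟨rfl, rfl⟩
    | loopStep hb' _ _ => exact absurd hb' hb
  | loopStep hb _ _ ihP ihl =>
    cases h₂ with
    | loopDone hb' => exact absurd hb hb'
    | loopStep _ hP hl =>
      obtain ⟨rfl, rfl⟩ := ihP hP
      obtain ⟨rfl, rfl⟩ := ihl hl
      exact ⟨rfl, rfl⟩

/-- The initial state on input `(n, p)`: index register `0` holds `n`, the cell `(i, j)` of
array `0` with `i, j ≤ n` holds the coefficient of `x ^ i * y ^ j` in `p`, and every other register
and cell holds `0`. -/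
noncomputable def input (n : ℕ) (p : MvPolynomial (Fin 2) ℝ) : State where
  idx := fun r => if r = 0 then n else 0
  mem := fun a i j =>
    if a = 0 ∧ i ≤ n ∧ j ≤ n then p.coeff (Finsupp.single 0 i + Finsupp.single 1 j) else 0

/-- The answer that a halted machine gives: the content of index register `0`. -/
def State.answer (s : State) : ℕ := s.idx 0

end RealRAM

/-! A nonzero polynomial `p` of total degree `d` is tested on the lines of direction `(1, 1)`. It is
stable if and only if the coefficients of its top form have one sign and every restriction `p (γ +
t, t)`, `γ` real, has only real zeros. For necessity, the top form is a scaling limit of `p`, so it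
has no zeros in the product of half-planes and factors into terms with coefficients of one sign
(`topSameSign_of_stable`). For sufficiency, a line with positive direction through a zero is
deformed to a line of direction `(1, 1)`; zeros in the upper half-plane can neither escape to
infinity, because the top form does not vanish in positive directions, nor reach the real axis
(`stable_of_realRooted`).

Divided by the value of the top form at `(1, 1)`, the restriction is monic of degree `d` in `t`, and
its coefficient at `t ^ (d - k)` has degree at most `k` in `γ`. By Hermite's theorem it is
real-rooted if and only if the Hankel matrix of the power sums of its zeros is positive
semidefinite. The leading minors of this matrix are polynomials in `γ` of degree at most `d ^ 2`.
Their nonnegativity alone does not give semidefiniteness of singular matrices. In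
`forall_realRooted_iff` this is repaired by sampling: at more than `d ^ 2` integers `γ`, elimination
without pivoting has to meet positive pivots until the rest of the matrix is zero. Then no minor
vanishes identically before one that does not, so for all but finitely many `γ` the minors are
positive up to some order and zero beyond it; the exceptional `γ` follow by continuity. Together
these facts form `stable_iff`.

Each minor is recovered from its sample values by Newton interpolation. Its nonnegativity is a
statement about its signs at the critical points, namely the equality of two Cauchy indices
(`forall_eval_nonneg_iff`), and Euclid's algorithm computes Cauchy indices in quadratic time.

With `N = 3 * d ^ 2 + 1` samples and `d ≤ 2 * n`, the `N` eliminations cost `O(N * d ^ 3)`, and the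
interpolations and nonnegativity tests of `d` minors cost `O(d * N ^ 2)`; both are `O(n ^ 5)`. The
programs are verified with the predicate `Reach`, which bounds cost and describes the final state,
and with `Frame`, which says what a program leaves alone. -/

section

/-! ### Cauchy indices on the real line and nonnegativity of a real polynomial. -/

open Polynomial

theorem Real.sign_mul (x y : ℝ) : Real.sign (x * y) = Real.sign x * Real.sign y := by
  rcases lt_trichotomy x 0 with hx | rfl | hx <;> rcases lt_trichotomy y 0 with hy | rfl | hy
  · rw [Real.sign_of_pos (mul_pos_of_neg_of_neg hx hy), Real.sign_of_neg hx, Real.sign_of_neg hy]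
    norm_num
  · simp
  · rw [Real.sign_of_neg (mul_neg_of_neg_of_pos hx hy), Real.sign_of_neg hx, Real.sign_of_pos hy]
    norm_num
  · simp
  · simp
  · simp
  · rw [Real.sign_of_neg (mul_neg_of_pos_of_neg hx hy), Real.sign_of_pos hx, Real.sign_of_neg hy]
    norm_num
  · simp
  · rw [Real.sign_of_pos (mul_pos hx hy), Real.sign_of_pos hx, Real.sign_of_pos hy]
    norm_num

theorem Real.sign_mul_self_of_ne_zero {x : ℝ} (hx : x ≠ 0) : Real.sign x * Real.sign x = 1 := by
  rcases Real.sign_apply_eq_of_ne_zero x hx with h | h <;> rw [h] <;> norm_num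

namespace Polynomial

/-- Half the difference of the signs of `f` immediately to the right and to the left of `c`. -/
noncomputable def signJump (f : ℝ[X]) (c : ℝ) : ℝ :=
  if Odd (f.rootMultiplicity c) then
    Real.sign ((f /ₘ (X - C c) ^ f.rootMultiplicity c).eval c) else 0

/-- Half the difference of the signs of `f` at `+∞` and at `-∞`. -/
noncomputable def signJumpInfty (f : ℝ[X]) : ℝ :=
  if Odd f.natDegree then Real.sign f.leadingCoeff else 0

/-- The Cauchy index of the rational function `A / B` on the real line. -/
noncomputable def cauchyIndex (A B : ℝ[X]) : ℝ :=
  ∑ c ∈ B.roots.toFinset,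
    if A.rootMultiplicity c < B.rootMultiplicity c then signJump (A * B) c else 0

theorem exists_eq_X_sub_C_pow_mul {f : ℝ[X]} (hf : f ≠ 0) (c : ℝ) :
    ∃ g : ℝ[X], f = (X - C c) ^ f.rootMultiplicity c * g ∧ g.eval c ≠ 0 := by
  obtain ⟨g, h1, h2⟩ := exists_eq_pow_rootMultiplicity_mul_and_not_dvd f hf c
  refine ⟨g, h1, fun h => h2 (dvd_iff_isRoot.2 h)⟩

theorem rootMultiplicity_X_sub_C_pow_mul {g : ℝ[X]} {c : ℝ} (m : ℕ) (hg : g.eval c ≠ 0) :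
    ((X - C c) ^ m * g).rootMultiplicity c = m := by
  have hg0 : g ≠ 0 := by rintro rfl; simp at hg
  rw [mul_comm, rootMultiplicity_mul_X_sub_C_pow hg0, rootMultiplicity_eq_zero hg, zero_add]

/-- The jump can be read off from any factorization whose cofactor does not vanish at the point; all
later computations of jumps go through this form. -/
theorem signJump_X_sub_C_pow_mul {g : ℝ[X]} {c : ℝ} (m : ℕ) (hg : g.eval c ≠ 0) :
    signJump ((X - C c) ^ m * g) c = if Odd m then Real.sign (g.eval c) else 0 := by
  rw [signJump, rootMultiplicity_X_sub_C_pow_mul m hg,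
    mul_divByMonic_cancel_left _ ((monic_X_sub_C c).pow m)]

theorem signJump_mul_of_eval_ne_zero (f : ℝ[X]) {h : ℝ[X]} {c : ℝ} (hh : h.eval c ≠ 0) :
    signJump (f * h) c = signJump f c * Real.sign (h.eval c) := by
  rcases eq_or_ne f 0 with rfl | hf
  · simp [signJump]
  obtain ⟨g, h1, h2⟩ := exists_eq_X_sub_C_pow_mul hf c
  rw [h1, mul_assoc, signJump_X_sub_C_pow_mul _ h2,
    signJump_X_sub_C_pow_mul _ (by rw [eval_mul]; exact mul_ne_zero h2 hh), eval_mul, Real.sign_mul]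
  split_ifs <;> simp

theorem sign_eval_eq_sign_leadingCoeff {g : ℝ[X]} {x : ℝ} (h : ∀ y, g.IsRoot y → y < x) :
    Real.sign (g.eval x) = Real.sign g.leadingCoeff := by
  rcases lt_trichotomy g.leadingCoeff 0 with h0 | h0 | h0
  · rw [Real.sign_of_neg h0, Real.sign_of_neg
      (eval_lt_zero_of_roots_lt_of_leadingCoeff_nonpos h h0.le)]
  · rw [leadingCoeff_eq_zero.1 h0] at h
    exact absurd (h x (by simp)) (lt_irrefl x)
  · rw [Real.sign_of_pos h0, Real.sign_of_pos
      (zero_lt_eval_of_roots_lt_of_leadingCoeff_nonneg h h0.le)]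

/-- The sign at `0` is the sign at both ends of the line. An odd degree would make these opposite,
so that the value at `0` would be zero. -/
theorem even_natDegree_of_forall_not_isRoot {f : ℝ[X]} (h : ∀ y, ¬ f.IsRoot y) :
    Even f.natDegree := by
  by_contra hodd
  have hodd : Odd f.natDegree := Nat.not_even_iff_odd.1 hodd
  have h1 : Real.sign (f.eval 0) = Real.sign f.leadingCoeff :=
    sign_eval_eq_sign_leadingCoeff fun y hy => absurd hy (h y)
  have h2 : Real.sign ((f.comp (-X)).eval 0) = Real.sign (f.comp (-X)).leadingCoeff := by
    refine sign_eval_eq_sign_leadingCoeff fun y hy => absurd ?_ (h (-y))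
    simpa [IsRoot, eval_comp] using hy
  have h3 : (f.comp (-X)).leadingCoeff = - f.leadingCoeff := by
    rw [leadingCoeff_comp (by simp)]; simp [hodd.neg_one_pow]
  rw [h3, Real.sign_neg, ← h1] at h2
  have h4 : Real.sign (f.eval 0) = 0 := by
    have : (f.comp (-X)).eval 0 = f.eval 0 := by simp [eval_comp]
    rw [this] at h2; linarith
  exact h 0 (Real.sign_eq_zero_iff.1 h4)

/-- The sign changes of `f` telescope from `-∞` to `+∞`. The induction splits off the largest root.
-/
theorem sum_signJump_roots (f : ℝ[X]) (hf : f ≠ 0) :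
    ∑ c ∈ f.roots.toFinset, signJump f c = signJumpInfty f := by
  induction hn : f.roots.toFinset.card using Nat.strong_induction_on generalizing f with
  | _ n ih =>
  rcases f.roots.toFinset.eq_empty_or_nonempty with he | hne
  · have hno : ∀ y, ¬ f.IsRoot y := by
      intro y hy
      have : y ∈ f.roots.toFinset := by simp [hf, hy.eq_zero]
      simp [he] at this
    rw [he, Finset.sum_empty, signJumpInfty,
      if_neg (Nat.not_odd_iff_even.2 (even_natDegree_of_forall_not_isRoot hno))]
  · set c := f.roots.toFinset.max' hne with hc
    have hcm : c ∈ f.roots.toFinset := Finset.max'_mem _ _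
    obtain ⟨g, hg, hgc⟩ := exists_eq_X_sub_C_pow_mul hf c
    have hmpos : 0 < f.rootMultiplicity c :=
      (rootMultiplicity_pos hf).2 (by simpa [hf] using hcm)
    set m := f.rootMultiplicity c
    have hg0 : g ≠ 0 := by rintro rfl; simp at hgc
    have hroots : f.roots.toFinset = insert c g.roots.toFinset := by
      ext y
      have hfe : f.eval y = (y - c) ^ m * g.eval y := by
        conv_lhs => rw [hg]
        simp
      simp only [Multiset.mem_toFinset, mem_roots hf, mem_roots hg0, Finset.mem_insert, IsRoot, hfe]
      rw [mul_eq_zero, pow_eq_zero_iff hmpos.ne', sub_eq_zero]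
    have hcg : c ∉ g.roots.toFinset := by simp [hg0, hgc]
    have hlt : ∀ y, g.IsRoot y → y < c := by
      intro y hy
      have hyg : y ∈ g.roots.toFinset := by simpa [hg0] using hy
      have hyf : y ∈ f.roots.toFinset := by rw [hroots]; exact Finset.mem_insert_of_mem hyg
      refine lt_of_le_of_ne (Finset.le_max' _ y hyf) ?_
      rintro rfl; exact hcg hyg
    have ihg := ih g.roots.toFinset.card (by
      rw [← hn, hroots, Finset.card_insert_of_notMem hcg]; omega) g hg0 rfl
    -- All other roots lie to the left of `c`, where the factor split off has the sign `(-1) ^ m`.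
    have hsum : ∑ y ∈ g.roots.toFinset, signJump f y
        = (-1) ^ m * ∑ y ∈ g.roots.toFinset, signJump g y := by
      rw [Finset.mul_sum]
      refine Finset.sum_congr rfl fun y hy => ?_
      have hyc : y < c := hlt y (by simpa [hg0] using hy)
      have hne : ((X - C c) ^ m : ℝ[X]).eval y ≠ 0 := by
        simp only [eval_pow, eval_sub, eval_X, eval_C]
        exact pow_ne_zero _ (by linarith)
      conv_lhs => rw [hg, mul_comm]
      rw [signJump_mul_of_eval_ne_zero g hne, mul_comm]
      congr 1
      simp only [eval_pow, eval_sub, eval_X, eval_C]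
      rcases Nat.even_or_odd m with hm | hm
      · rw [hm.neg_one_pow, Real.sign_of_pos (hm.pow_pos (by linarith))]
      · rw [hm.neg_one_pow, Real.sign_of_neg (hm.pow_neg (by linarith))]
    have hjc : signJump f c = if Odd m then Real.sign g.leadingCoeff else 0 := by
      conv_lhs => rw [hg]
      rw [signJump_X_sub_C_pow_mul m hgc, sign_eval_eq_sign_leadingCoeff hlt]
    have hlead : f.leadingCoeff = g.leadingCoeff := by
      rw [hg, leadingCoeff_mul, leadingCoeff_pow, leadingCoeff_X_sub_C, one_pow, one_mul]
    have hdeg : f.natDegree = m + g.natDegree := by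
      rw [hg, natDegree_mul (pow_ne_zero _ (X_sub_C_ne_zero c)) hg0, natDegree_pow,
        natDegree_X_sub_C, mul_one]
    rw [hroots, Finset.sum_insert hcg, hsum, ihg, hjc, signJumpInfty, signJumpInfty, hlead, hdeg]
    rcases Nat.even_or_odd m with hm | hm
    · have h1 : ¬ Odd m := Nat.not_odd_iff_even.2 hm
      simp [Nat.odd_add, h1, hm.neg_one_pow]
    · by_cases h2 : Odd g.natDegree
      · simp [Nat.odd_add, hm, h2, hm.neg_one_pow]
      · simp [Nat.odd_add, hm, h2, hm.neg_one_pow, Nat.not_odd_iff_even.1 h2]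

theorem cauchyIndex_zero_left (B : ℝ[X]) : cauchyIndex 0 B = 0 := by
  simp [cauchyIndex, signJump]

theorem cauchyIndex_eq_sum_of_subset {A B : ℝ[X]} (hB : B ≠ 0) {s : Finset ℝ}
    (hs : B.roots.toFinset ⊆ s) :
    cauchyIndex A B = ∑ c ∈ s,
      if A.rootMultiplicity c < B.rootMultiplicity c then signJump (A * B) c else 0 := by
  refine Finset.sum_subset hs fun c _ hc => if_neg ?_
  have : B.rootMultiplicity c = 0 :=
    rootMultiplicity_eq_zero fun h => hc (by simpa [hB] using h)
  omega

/-- A root of `A * B` is counted in the first index if it is a pole of `A / B` and in the second if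
it is a pole of `B / A`. If it is neither, its multiplicity in `A * B` is even and `A * B` has no
jump there. -/
theorem cauchyIndex_add_cauchyIndex_swap {A B : ℝ[X]} (hA : A ≠ 0) (hB : B ≠ 0) :
    cauchyIndex A B + cauchyIndex B A = signJumpInfty (A * B) := by
  have hAB := mul_ne_zero hA hB
  have hs : (A * B).roots.toFinset = A.roots.toFinset ∪ B.roots.toFinset := by
    rw [roots_mul hAB, Multiset.toFinset_add]
  rw [cauchyIndex_eq_sum_of_subset hB (s := (A * B).roots.toFinset)
      (hs ▸ Finset.subset_union_right),
    cauchyIndex_eq_sum_of_subset hA (s := (A * B).roots.toFinset)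
      (hs ▸ Finset.subset_union_left), ← Finset.sum_add_distrib, ← sum_signJump_roots _ hAB]
  refine Finset.sum_congr rfl fun c _ => ?_
  rw [mul_comm B A]
  rcases lt_trichotomy (A.rootMultiplicity c) (B.rootMultiplicity c) with h | h | h
  · simp [h, h.not_gt]
  · have : ¬ Odd ((A * B).rootMultiplicity c) := by
      rw [rootMultiplicity_mul hAB, h, Nat.not_odd_iff_even]
      exact ⟨_, rfl⟩
    simp [h, signJump, this]
  · simp [h, h.not_gt]

theorem cauchyIndex_neg_left (A B : ℝ[X]) : cauchyIndex (-A) B = - cauchyIndex A B := by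
  rcases eq_or_ne A 0 with rfl | hA
  · simp [cauchyIndex_zero_left]
  rw [cauchyIndex, cauchyIndex, ← Finset.sum_neg_distrib]
  refine Finset.sum_congr rfl fun c _ => ?_
  have h1 : (-A).rootMultiplicity c = A.rootMultiplicity c := by
    have : -A = A * C (-1) := by simp
    rw [this, rootMultiplicity_mul (mul_ne_zero hA (by simp)), rootMultiplicity_C, add_zero]
  have h2 : -A * B = A * B * C (-1) := by simp
  rw [h1, h2, signJump_mul_of_eval_ne_zero _ (by simp)]
  split_ifs <;> simp [Real.sign_neg]

/-- The exchange step of Euclid's algorithm; the sign in `-B` is that of Sturm's remainder sequence.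
-/
theorem cauchyIndex_swap {A B : ℝ[X]} (hA : A ≠ 0) (hB : B ≠ 0) :
    cauchyIndex A B = signJumpInfty (A * B) + cauchyIndex (-B) A := by
  rw [cauchyIndex_neg_left, ← cauchyIndex_add_cauchyIndex_swap hA hB]; ring

theorem cauchyIndex_summand_eq_zero {A B : ℝ[X]} {c : ℝ}
    (h : (X - C c) ^ B.rootMultiplicity c ∣ A) :
    (if A.rootMultiplicity c < B.rootMultiplicity c then signJump (A * B) c else 0) = 0 := by
  rcases eq_or_ne A 0 with rfl | hA
  · simp [signJump]
  · rw [if_neg (not_lt.2 ((le_rootMultiplicity_iff hA).2 h))]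

/-- Adding a polynomial to `A / B` changes neither its poles nor the leading terms at them. This is
the division step of Euclid's algorithm, and common factors of `A` and `B` do no harm. -/
theorem cauchyIndex_add_mul (A B Q : ℝ[X]) : cauchyIndex (A + Q * B) B = cauchyIndex A B := by
  rcases eq_or_ne B 0 with rfl | hB
  · simp
  refine Finset.sum_congr rfl fun c _ => ?_
  obtain ⟨b, hb, hbc⟩ := exists_eq_X_sub_C_pow_mul hB c
  have hdB : (X - C c) ^ B.rootMultiplicity c ∣ B := pow_rootMultiplicity_dvd B c
  by_cases hd : (X - C c) ^ B.rootMultiplicity c ∣ A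
  · rw [cauchyIndex_summand_eq_zero hd,
      cauchyIndex_summand_eq_zero (hd.add (hdB.mul_left Q))]
  · have hA : A ≠ 0 := by rintro rfl; simp at hd
    have hlt : A.rootMultiplicity c < B.rootMultiplicity c := by
      rw [← not_le, le_rootMultiplicity_iff hA]; exact hd
    obtain ⟨a, ha, hac⟩ := exists_eq_X_sub_C_pow_mul hA c
    generalize hm : A.rootMultiplicity c = m at *
    generalize hk : B.rootMultiplicity c = k at *
    -- With the order of the pole being `r + 1 > 0`, the added term contributes to the cofactor of
    -- `(X - C c) ^ m` only a multiple of `X - C c`.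
    obtain ⟨r, rfl⟩ := Nat.exists_eq_add_of_lt hlt
    have hsum : A + Q * B = (X - C c) ^ m * (a + Q * ((X - C c) ^ (r + 1) * b)) := by
      rw [ha, hb]; ring
    have hev : (a + Q * ((X - C c) ^ (r + 1) * b)).eval c = a.eval c := by simp
    have hev0 : (a + Q * ((X - C c) ^ (r + 1) * b)).eval c ≠ 0 := by rwa [hev]
    have hm' : (A + Q * B).rootMultiplicity c = m := by
      rw [hsum, rootMultiplicity_X_sub_C_pow_mul m hev0]
    rw [hm', if_pos hlt, if_pos hlt]
    have e1 : (A + Q * B) * B = (X - C c) ^ (m + (m + r + 1)) *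
        ((a + Q * ((X - C c) ^ (r + 1) * b)) * b) := by
      rw [hsum, hb]; ring
    have e2 : A * B = (X - C c) ^ (m + (m + r + 1)) * (a * b) := by rw [ha, hb]; ring
    rw [e1, e2, signJump_X_sub_C_pow_mul _ (by rw [eval_mul]; exact mul_ne_zero hev0 hbc),
      signJump_X_sub_C_pow_mul _ (by rw [eval_mul]; exact mul_ne_zero hac hbc), eval_mul, eval_mul,
      hev]

/-- The logarithmic derivative of `h` has at each real root a simple pole whose residue, the
multiplicity, is positive. So `g * h' / h` jumps there with the sign of `g`, and not at all where
`g` cancels the pole. -/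
theorem cauchyIndex_mul_derivative (g : ℝ[X]) {h : ℝ[X]} (hh : h ≠ 0) :
    cauchyIndex (g * derivative h) h = ∑ c ∈ h.roots.toFinset, Real.sign (g.eval c) := by
  refine Finset.sum_congr rfl fun c hc => ?_
  obtain ⟨u, hu, huc⟩ := exists_eq_X_sub_C_pow_mul hh c
  have hpos : 0 < h.rootMultiplicity c := (rootMultiplicity_pos hh).2 (by simpa [hh] using hc)
  obtain ⟨k, hk⟩ := Nat.exists_eq_succ_of_ne_zero hpos.ne'
  have hd : derivative h = (X - C c) ^ k * (C ((k : ℝ) + 1) * u + (X - C c) * derivative u) := by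
    rw [hk] at hu
    conv_lhs => rw [hu]
    rw [derivative_mul, derivative_X_sub_C_pow]
    simp only [Nat.succ_eq_add_one, Nat.add_sub_cancel, Nat.cast_add, Nat.cast_one, map_add,
      map_natCast, map_one, pow_succ]
    ring
  by_cases hg : g.eval c = 0
  · rw [hg, Real.sign_zero]
    refine cauchyIndex_summand_eq_zero ?_
    rw [hk, pow_succ', hd]
    exact mul_dvd_mul (dvd_iff_isRoot.2 hg) (dvd_mul_right _ _)
  · have hev : (g * (C ((k : ℝ) + 1) * u + (X - C c) * derivative u)).eval c
        = ((k : ℝ) + 1) * (g.eval c * u.eval c) := by simp; ring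
    have hk1 : (0 : ℝ) < k + 1 := by positivity
    have hev0 : (g * (C ((k : ℝ) + 1) * u + (X - C c) * derivative u)).eval c ≠ 0 := by
      rw [hev]; exact mul_ne_zero hk1.ne' (mul_ne_zero hg huc)
    have e1 : g * derivative h
        = (X - C c) ^ k * (g * (C ((k : ℝ) + 1) * u + (X - C c) * derivative u)) := by
      rw [hd]; ring
    have e2 : g * derivative h * h = (X - C c) ^ (2 * k + 1) *
        ((g * (C ((k : ℝ) + 1) * u + (X - C c) * derivative u)) * u) := by
      rw [hk] at hu
      rw [e1]
      conv_lhs => rw [hu]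
      rw [Nat.succ_eq_add_one]; ring
    rw [e2, e1, rootMultiplicity_X_sub_C_pow_mul k hev0, hk, if_pos (Nat.lt_succ_self k),
      signJump_X_sub_C_pow_mul _ (by rw [eval_mul]; exact mul_ne_zero hev0 huc),
      if_pos ⟨k, rfl⟩, eval_mul, hev, Real.sign_mul, Real.sign_mul, Real.sign_mul,
      Real.sign_of_pos hk1, one_mul, mul_assoc, Real.sign_mul_self_of_ne_zero huc, mul_one]

/-- A nonconstant real polynomial is nonnegative if and only if it tends to `+∞` at both ends
and is nonnegative at its critical points; the latter is a comparison of two Cauchy indices. -/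
theorem forall_eval_nonneg_iff {f : ℝ[X]} (hf : f.natDegree ≠ 0) :
    (∀ x, 0 ≤ f.eval x) ↔ 0 < f.leadingCoeff ∧ Even f.natDegree ∧
      cauchyIndex (f * derivative (derivative f)) (derivative f)
        = cauchyIndex (f ^ 2 * derivative (derivative f)) (derivative f) := by
  have hd : derivative f ≠ 0 := fun h => hf (derivative_eq_zero.1 h)
  have hf0 : f ≠ 0 := by rintro rfl; simp at hf
  have hdeg : 0 < f.degree := natDegree_pos_iff_degree_pos.1 (Nat.pos_of_ne_zero hf)
  have hdeg' : 0 < (f.comp (-X)).degree := by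
    rw [← natDegree_pos_iff_degree_pos, natDegree_comp]; simpa using Nat.pos_of_ne_zero hf
  rw [cauchyIndex_mul_derivative _ hd, cauchyIndex_mul_derivative _ hd]
  have hlc' : (f.comp (-X)).leadingCoeff = f.leadingCoeff * (-1) ^ f.natDegree := by
    rw [leadingCoeff_comp (by simp)]; simp
  constructor
  · intro h
    have hpos : 0 < f.leadingCoeff := by
      refine lt_of_le_of_ne ?_ (Ne.symm (leadingCoeff_ne_zero.2 hf0))
      by_contra hneg
      have ht := tendsto_atBot_of_leadingCoeff_nonpos f hdeg (not_le.1 hneg).le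
      obtain ⟨x, hx⟩ := (ht.eventually (Filter.eventually_lt_atBot 0)).exists
      exact absurd (h x) (not_le.2 hx)
    refine ⟨hpos, ?_, ?_⟩
    · by_contra hodd
      have ht := tendsto_atBot_of_leadingCoeff_nonpos (f.comp (-X)) hdeg' (by
        rw [hlc', (Nat.not_even_iff_odd.1 hodd).neg_one_pow]; linarith)
      obtain ⟨x, hx⟩ := (ht.eventually (Filter.eventually_lt_atBot 0)).exists
      rw [eval_comp] at hx
      exact absurd (h _) (not_le.2 hx)
    · refine Finset.sum_congr rfl fun c _ => ?_
      rw [eval_pow]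
      rcases (h c).eq_or_lt with h0 | h0
      · rw [← h0]; simp
      · rw [Real.sign_of_pos h0, Real.sign_of_pos (by positivity)]
  · rintro ⟨hpos, heven, hsum⟩ x
    by_contra hneg
    have t1 := tendsto_atTop_of_leadingCoeff_nonneg f hdeg hpos.le
    have t2 := tendsto_atTop_of_leadingCoeff_nonneg (f.comp (-X)) hdeg' (by
        rw [hlc', heven.neg_one_pow]; linarith)
    have t3 : Filter.Tendsto (fun x => f.eval x) Filter.atBot Filter.atTop := by
      have := t2.comp Filter.tendsto_neg_atBot_atTop
      simpa [Function.comp_def, eval_comp] using this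
    -- Since `f` tends to `+∞` at both ends, its minimum is attained; if negative, it is attained at
    -- a critical point where `f` and `f ^ 2` have different signs.
    have t4 : Filter.Tendsto (fun x => f.eval x) (Filter.cocompact ℝ) Filter.atTop := by
      rw [cocompact_eq_atBot_atTop]; exact t3.sup t1
    obtain ⟨c, hc⟩ := f.continuous.exists_forall_le t4
    have hc0 : f.eval c < 0 := lt_of_le_of_lt (hc x) (not_le.1 hneg)
    have hcrit : (derivative f).eval c = 0 := by
      have : IsLocalMin (fun x => f.eval x) c := Filter.Eventually.of_forall hc
      simpa using this.deriv_eq_zero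
    -- The comparison holds term by term, so equality of the sums forces equality at every critical
    -- point, and a negative value of `f` makes it strict.
    have hle : ∀ y ∈ (derivative f).roots.toFinset,
        Real.sign (f.eval y) ≤ Real.sign ((f ^ 2).eval y) := by
      intro y _
      rw [eval_pow, sq, Real.sign_mul]
      rcases Real.sign_apply_eq (f.eval y) with h | h | h <;> rw [h] <;> norm_num
    have hmem : c ∈ (derivative f).roots.toFinset := by simp [hd, hcrit]
    have := (Finset.sum_eq_sum_iff_of_le hle).1 hsum c hmem
    rw [eval_pow, Real.sign_of_neg hc0, Real.sign_of_pos (by nlinarith)] at this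
    norm_num at this

end Polynomial

end

/-! ### Gaussian elimination without pivoting, its pivots and the leading minors. -/

section

open Finset

/-- Gaussian elimination without pivoting on an infinite matrix: the Schur complements
of its leading blocks. -/
noncomputable def schur (M : ℕ → ℕ → ℝ) : ℕ → ℕ → ℕ → ℝ
  | 0, i, j => M i j
  | k + 1, i, j => schur M k i j - schur M k i k / schur M k k k * schur M k k j

/-- The leading principal minor of order `k`. -/
noncomputable def leadingMinor {R : Type*} [CommRing R] (M : ℕ → ℕ → R) (k : ℕ) : R :=
  (Matrix.of fun i j : Fin k => M i j).det

/-- Elimination meets a positive pivot, until all that remains is zero. -/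
def RegularPivots (M : ℕ → ℕ → ℝ) (d : ℕ) : Prop :=
  ∀ k < d, 0 < schur M k k k ∨ ∀ i j, k ≤ i → i < d → k ≤ j → j < d → schur M k i j = 0

/-- Elimination meets a nonzero pivot, until all that remains is zero. -/
def NonsingularPivots (M : ℕ → ℕ → ℝ) (d : ℕ) : Prop :=
  ∀ k < d, schur M k k k ≠ 0 ∨ ∀ i j, k ≤ i → i < d → k ≤ j → j < d → schur M k i j = 0

theorem RegularPivots.nonsingularPivots {M : ℕ → ℕ → ℝ} {d : ℕ} (h : RegularPivots M d) :
    NonsingularPivots M d :=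
  fun k hk => (h k hk).imp_left ne_of_gt

theorem NonsingularPivots.mono {M : ℕ → ℕ → ℝ} {d e : ℕ} (h : NonsingularPivots M d)
    (hed : e ≤ d) : NonsingularPivots M e :=
  fun k hk => (h k (hk.trans_le hed)).imp_right fun h' i j hi hi' hj hj' =>
    h' i j hi (hi'.trans_le hed) hj (hj'.trans_le hed)

/-- A nonzero pivot clears its row and its column. A zero pivot occurs only when the whole remaining
block is zero, and such a block stays zero. -/
theorem NonsingularPivots.schur_eq_zero {M : ℕ → ℕ → ℝ} {d : ℕ} (h : NonsingularPivots M d) :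
    ∀ k ≤ d, ∀ i < d, ∀ j < d, (i < k ∨ j < k) → schur M k i j = 0 := by
  intro k
  induction k with
  | zero => intro _ i _ j _ hij; omega
  | succ k ih =>
    intro hk i hi j hj hij
    have ih := ih (by omega)
    rw [schur]
    by_cases hlt : i < k ∨ j < k
    · rw [ih i hi j hj hlt]
      rcases hlt with h1 | h1
      · rw [ih i hi k hk (Or.inl h1)]; simp
      · rw [ih k hk j hj (Or.inr h1)]; simp
    · rcases h k hk with hp | hz
      · have : i = k ∨ j = k := by omega
        rcases this with rfl | rfl
        · rw [div_self hp]; ring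
        · rw [div_mul_cancel₀ _ hp, sub_self]
      · rw [hz i j (by omega) hi (by omega) hj, hz i k (by omega) hi le_rfl hk]; simp

/-- The recursion telescopes whatever the pivots are. With the remainder gone this is the
factorization of `M` into triangular matrices. -/
theorem eq_sum_schur (M : ℕ → ℕ → ℝ) (k i j : ℕ) :
    M i j = ∑ l ∈ range k, schur M l i l / schur M l l l * schur M l l j + schur M k i j := by
  induction k with
  | zero => simp [schur]
  | succ k ih => rw [sum_range_succ, schur, ih]; ring

theorem NonsingularPivots.leadingMinor_eq_prod {M : ℕ → ℕ → ℝ} {k : ℕ}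
    (h : NonsingularPivots M k) : leadingMinor M k = ∏ l ∈ range k, schur M l l l := by
  have hfac : (Matrix.of fun i j : Fin k => M i j)
      = (Matrix.of fun i l : Fin k => schur M l i l / schur M l l l) *
        (Matrix.of fun l j : Fin k => schur M l l j) := by
    ext i j
    rw [Matrix.mul_apply, Matrix.of_apply, eq_sum_schur M k i j,
      h.schur_eq_zero k le_rfl i i.2 j j.2 (Or.inl i.2), add_zero, sum_range]
    rfl
  rw [leadingMinor, hfac, Matrix.det_mul, Matrix.det_of_isLowerTriangular,
    Matrix.det_of_isUpperTriangular, ← prod_mul_distrib, prod_range]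
  · refine prod_congr rfl fun l _ => ?_
    simp only [Matrix.of_apply]
    -- A zero pivot makes the diagonal entry of the lower factor `0 / 0 = 0` instead of `1`, but the
    -- product of the two entries is still the pivot.
    rcases eq_or_ne (schur M l l l) 0 with h0 | h0
    · simp [h0]
    · rw [div_self h0, one_mul]
  · intro i j hij
    exact h.schur_eq_zero i i.2.le i i.2 j j.2 (Or.inr hij)
  · intro i j hij
    have hij : i < j := hij
    simp only [Matrix.of_apply]
    rw [h.schur_eq_zero j j.2.le i i.2 j j.2 (Or.inl hij), zero_div]

/-- A pivot is the quotient of two consecutive leading minors, as soon as the earlier pivots are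
nonzero. -/
theorem schur_pivot_pos {M : ℕ → ℕ → ℝ} {r : ℕ} (h : ∀ k ≤ r, 0 < leadingMinor M k) :
    ∀ l < r, 0 < schur M l l l := by
  intro l
  induction l using Nat.strong_induction_on with
  | _ l ih =>
  intro hl
  -- The last pivot may be zero here: the remaining block in the window of size `l + 1` consists of
  -- that pivot alone.
  have hns : NonsingularPivots M (l + 1) := by
    intro k hk
    rcases Nat.lt_succ_iff_lt_or_eq.1 hk with h1 | rfl
    · exact Or.inl (ih k h1 (by omega)).ne'
    · by_cases h0 : schur M k k k = 0
      · refine Or.inr fun i j hi hi' hj hj' => ?_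
        obtain rfl : i = k := by omega
        obtain rfl : j = i := by omega
        exact h0
      · exact Or.inl h0
  have h1 := h (l + 1) hl
  rw [hns.leadingMinor_eq_prod, prod_range_succ,
    ← (hns.mono (Nat.le_succ l)).leadingMinor_eq_prod] at h1
  exact (pos_iff_pos_of_mul_pos h1).1 (h l hl.le)

theorem schur_symm {M : ℕ → ℕ → ℝ} (hM : ∀ i j, M i j = M j i) (k i j : ℕ) :
    schur M k i j = schur M k j i := by
  induction k generalizing i j with
  | zero => exact hM i j
  | succ k ih => rw [schur, schur, ih i j, ih i k, ih k j]; ring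

/-- Completing squares: the elimination of a symmetric matrix writes its form as a sum of squares
divided by the pivots. -/
theorem quadratic_form_nonneg_of_schur_pos {M : ℕ → ℕ → ℝ} (hM : ∀ i j, M i j = M j i) {r : ℕ}
    (h : ∀ l < r, 0 < schur M l l l) (x : ℕ → ℝ) :
    0 ≤ ∑ i ∈ range r, ∑ j ∈ range r, x i * x j * M i j := by
  have hns : NonsingularPivots M r := fun k hk => Or.inl (h k hk).ne'
  have : ∑ i ∈ range r, ∑ j ∈ range r, x i * x j * M i j
      = ∑ l ∈ range r, (∑ i ∈ range r, x i * schur M l i l) ^ 2 / schur M l l l := by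
    calc ∑ i ∈ range r, ∑ j ∈ range r, x i * x j * M i j
        = ∑ i ∈ range r, ∑ j ∈ range r, ∑ l ∈ range r,
            (x i * schur M l i l) * (x j * schur M l j l) / schur M l l l := by
          refine sum_congr rfl fun i hi => sum_congr rfl fun j hj => ?_
          rw [eq_sum_schur M r i j, hns.schur_eq_zero r le_rfl i (mem_range.1 hi) j
            (mem_range.1 hj) (Or.inl (mem_range.1 hi)), add_zero, mul_sum]
          refine sum_congr rfl fun l _ => ?_
          rw [schur_symm hM l l j]; ring
      _ = ∑ l ∈ range r, ∑ i ∈ range r, ∑ j ∈ range r,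
            (x i * schur M l i l) * (x j * schur M l j l) / schur M l l l := by
          rw [sum_congr rfl fun i _ => sum_comm, sum_comm]
      _ = _ := by
          refine sum_congr rfl fun l _ => ?_
          rw [sq, sum_mul_sum, sum_div]
          exact sum_congr rfl fun i _ => (sum_div _ _ _).symm
  rw [this]
  exact sum_nonneg fun l hl => div_nonneg (sq_nonneg _) (h l (mem_range.1 hl)).le

theorem schur_eq_zero_of_lt {M : ℕ → ℕ → ℝ} {m : ℕ} (h : ∀ l < m, schur M l l l ≠ 0) :
    ∀ k ≤ m, ∀ a, ∀ l < k, schur M k a l = 0 := by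
  intro k
  induction k with
  | zero => intro _ a l hl; omega
  | succ k ih =>
    intro hk a l hl
    rw [schur]
    rcases Nat.lt_succ_iff_lt_or_eq.1 hl with h1 | rfl
    · rw [ih (by omega) a l h1, ih (by omega) k l h1]; simp
    · rw [div_mul_cancel₀ _ (h l hk), sub_self]

/-- Elimination consists of row operations, and these preserve linear relations between columns. -/
theorem schur_column_relation {M : ℕ → ℕ → ℝ} {m i : ℕ} {c : ℕ → ℝ}
    (hc : ∀ a, M a i = ∑ l ∈ range m, c l * M a l) (k a : ℕ) :
    schur M k a i = ∑ l ∈ range m, c l * schur M k a l := by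
  induction k generalizing a with
  | zero => exact hc a
  | succ k ih =>
    simp only [schur, mul_sub, sum_sub_distrib]
    rw [ih a, ih k, mul_sum]
    exact congrArg _ (sum_congr rfl fun l _ => by ring)

/-- If the first `m` leading minors are positive and every column is a combination of the first
`m` ones, then elimination meets a positive pivot until all that remains is zero. -/
theorem regularPivots_of_column_relations {M : ℕ → ℕ → ℝ} {m : ℕ}
    (hpos : ∀ k ≤ m, 0 < leadingMinor M k)
    (hcol : ∀ i, ∃ c : ℕ → ℝ, ∀ a, M a i = ∑ l ∈ range m, c l * M a l) (d : ℕ) :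
    RegularPivots M d := by
  have hp := schur_pivot_pos hpos
  -- After `m` steps the first `m` columns are cleared, and all the others are combinations of them.
  have hzero : ∀ a i, schur M m a i = 0 := by
    intro a i
    obtain ⟨c, hc⟩ := hcol i
    rw [schur_column_relation hc]
    refine sum_eq_zero fun l hl => ?_
    rw [schur_eq_zero_of_lt (fun l hl => (hp l hl).ne') m le_rfl a l (mem_range.1 hl), mul_zero]
  have hzero' : ∀ k, m ≤ k → ∀ a i, schur M k a i = 0 := by
    intro k hk
    induction k, hk using Nat.le_induction with
    | base => exact hzero
    | succ k _ ih => intro a i; rw [schur, ih a i, ih k i]; simp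
  intro k _
  rcases lt_or_ge k m with h | h
  · exact Or.inl (hp k h)
  · exact Or.inr fun i j _ _ _ _ => hzero' k h i j

end

/-! ### Hermite's theorem on the Hankel form of power sums. -/

section

open Finset Polynomial

section Hermite

variable {ι : Type*} [Fintype ι] {x : ι → ℂ} {s : ℕ → ℝ}

/-- If `u` and `v` are read as coefficients of polynomials, the Hankel form is the sum over the
nodes of the products of their values. Every other fact about the form is a choice of these
polynomials. -/
theorem hankel_bilinear (hs : ∀ k, (s k : ℂ) = ∑ a, x a ^ k) (k l : ℕ) (u v : ℕ → ℂ) :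
    ∑ i ∈ range k, ∑ j ∈ range l, u i * v j * (s (i + j) : ℂ)
      = ∑ a, (∑ i ∈ range k, u i * x a ^ i) * (∑ j ∈ range l, v j * x a ^ j) := by
  simp_rw [hs, sum_mul_sum, mul_sum]
  rw [sum_congr rfl fun i _ => sum_comm, sum_comm]
  refine sum_congr rfl fun a _ => sum_congr rfl fun i _ => sum_congr rfl fun j _ => ?_
  ring

/-- The Hankel form of the power sums is nondegenerate in degrees below the number of
distinct nodes. -/
theorem leadingMinor_hankel_ne_zero (hs : ∀ k, (s k : ℂ) = ∑ a, x a ^ k) :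
    leadingMinor (fun i j => s (i + j)) (univ.image x).card ≠ 0 := by
  set m := (univ.image x).card with hm
  intro h0
  obtain ⟨v, hv, hv0⟩ := Matrix.exists_mulVec_eq_zero_iff.2 h0
  set w : ℕ → ℝ := fun i => if h : i < m then v ⟨i, h⟩ else 0 with hw
  have hrow : ∀ i < m, ∑ j ∈ range m, w j * s (i + j) = 0 := by
    intro i hi
    have := congrFun hv0 ⟨i, hi⟩
    simp only [Matrix.mulVec, dotProduct, Matrix.of_apply, Pi.zero_apply] at this
    rw [sum_range, ← this]
    refine sum_congr rfl fun j _ => ?_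
    simp [hw, mul_comm]
  set G : ℂ[X] := ∑ j ∈ range m, C (w j : ℂ) * X ^ j with hG
  have hGe : ∀ y, G.eval y = ∑ j ∈ range m, (w j : ℂ) * y ^ j := by
    intro y; simp [hG, eval_finsetSum]
  -- Pairing the kernel polynomial `G` with the Lagrange polynomial of the node `y` leaves the
  -- multiplicity of `y` times `G.eval y`. Then `G` has more zeros than its degree allows.
  have hvan : ∀ y ∈ univ.image x, G.eval y = 0 := by
    intro y hy
    set Z := Lagrange.basis (univ.image x) id y with hZ
    have hZd : Z.natDegree < m := by
      rw [hZ, Lagrange.natDegree_basis (Set.injOn_id _) hy]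
      have : 0 < m := by rw [hm]; exact card_pos.2 ⟨y, hy⟩
      omega
    have h1 := hankel_bilinear hs m m (fun i => Z.coeff i) (fun j => (w j : ℂ))
    have h2 : ∑ i ∈ range m, ∑ j ∈ range m, Z.coeff i * (w j : ℂ) * (s (i + j) : ℂ) = 0 := by
      refine sum_eq_zero fun i hi => ?_
      have := hrow i (mem_range.1 hi)
      calc ∑ j ∈ range m, Z.coeff i * (w j : ℂ) * (s (i + j) : ℂ)
          = Z.coeff i * ((∑ j ∈ range m, w j * s (i + j) : ℝ) : ℂ) := by
            push_cast; rw [mul_sum]; exact sum_congr rfl fun j _ => by ring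
        _ = 0 := by rw [this]; simp
    rw [h2] at h1
    have h3 : ∑ a, (∑ i ∈ range m, Z.coeff i * x a ^ i) * (∑ j ∈ range m, (w j : ℂ) * x a ^ j)
        = (univ.filter fun a => x a = y).card * G.eval y := by
      rw [card_eq_sum_ones, Nat.cast_sum, sum_mul, sum_filter]
      refine sum_congr rfl fun a _ => ?_
      rw [← eval_eq_sum_range' hZd, ← hGe]
      split_ifs with h
      · rw [h, hZ]
        have := Lagrange.eval_basis_self (v := id) (Set.injOn_id _) hy
        simp only [id] at this; simp [this]
      · have := Lagrange.eval_basis_of_ne (s := univ.image x) (v := id) (Ne.symm h)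
          (mem_image_of_mem x (mem_univ a))
        simp only [id] at this
        rw [hZ, this, zero_mul]
    rw [h3] at h1
    rcases mul_eq_zero.1 h1.symm with h4 | h4
    · obtain ⟨a, -, ha⟩ := mem_image.1 hy
      have h5 : (univ.filter fun a => x a = y).card = 0 := by exact_mod_cast h4
      rw [card_eq_zero] at h5
      exact absurd (h5 ▸ mem_filter.2 ⟨mem_univ a, ha⟩ : a ∈ (∅ : Finset ι)) (notMem_empty a)
    · exact h4
  have hGd : G.degree < (univ.image x).card := by
    rw [← hm]
    refine lt_of_le_of_lt (degree_sum_le _ _) ((Finset.sup_lt_iff (WithBot.bot_lt_coe m)).2 ?_)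
    intro j hj
    exact lt_of_le_of_lt (degree_C_mul_X_pow_le _ _) (WithBot.coe_lt_coe.2 (mem_range.1 hj))
  have hG0 := eq_zero_of_degree_lt_of_eval_finset_eq_zero _ hGd hvan
  refine hv (funext fun i => ?_)
  have := congrArg (fun p => p.coeff (i : ℕ)) hG0
  simpa [hG, finsetSum_coeff, coeff_C_mul, coeff_X_pow, hw] using this

theorem sum_mul_pow_sq_nonneg_of_im_eq_zero (hs : ∀ k, (s k : ℂ) = ∑ a, x a ^ k)
    (hx : ∀ a, (x a).im = 0) (k : ℕ) (u : ℕ → ℝ) :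
    ∑ i ∈ range k, ∑ j ∈ range k, u i * u j * s (i + j)
      = ∑ a, (∑ i ∈ range k, u i * (x a).re ^ i) ^ 2 := by
  have hxr : ∀ a, x a = ((x a).re : ℂ) := fun a => Complex.ext (by simp) (by simp [hx a])
  have h := hankel_bilinear hs k k (fun i => (u i : ℂ)) (fun i => (u i : ℂ))
  apply Complex.ofReal_injective
  push_cast
  rw [h]
  refine sum_congr rfl fun a _ => ?_
  rw [sq, ← hxr a]

/-- For real nodes the form is the sum of the squares of the values of a real polynomial of degree
below `k`. It vanishes only if the polynomial has at least `k` zeros, that is, if it is zero. -/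
theorem leadingMinor_hankel_pos (hs : ∀ k, (s k : ℂ) = ∑ a, x a ^ k) (hx : ∀ a, (x a).im = 0)
    (k : ℕ) (hk : k ≤ (univ.image x).card) : 0 < leadingMinor (fun i j => s (i + j)) k := by
  refine Matrix.PosDef.det_pos (Matrix.PosDef.of_dotProduct_mulVec_pos ?_ ?_)
  · ext i j; simp [Matrix.conjTranspose_apply, add_comm]
  · intro v hv
    set w : ℕ → ℝ := fun i => if h : i < k then v ⟨i, h⟩ else 0 with hw
    have hq : star v ⬝ᵥ (Matrix.of (fun i j : Fin k => s (i + j))).mulVec v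
        = ∑ i ∈ range k, ∑ j ∈ range k, w i * w j * s (i + j) := by
      rw [sum_range]
      simp only [dotProduct, Matrix.mulVec, Matrix.of_apply, star_trivial]
      refine sum_congr rfl fun i _ => ?_
      rw [mul_sum, sum_range]
      refine sum_congr rfl fun j _ => ?_
      simp only [hw, Fin.is_lt, dite_true, Fin.eta]; ring
    rw [hq, sum_mul_pow_sq_nonneg_of_im_eq_zero hs hx]
    refine lt_of_le_of_ne (sum_nonneg fun a _ => sq_nonneg _) fun h0 => hv ?_
    have hz := (sum_eq_zero_iff_of_nonneg fun a _ => sq_nonneg _).1 h0.symm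
    set G : ℝ[X] := ∑ j ∈ range k, C (w j) * X ^ j with hG
    have hG0 : G = 0 := by
      refine eq_zero_of_degree_lt_of_eval_finset_eq_zero ((univ.image x).image Complex.re) ?_ ?_
      · rw [card_image_of_injOn]
        · refine lt_of_lt_of_le ?_ (Nat.cast_le.2 hk)
          refine lt_of_le_of_lt (degree_sum_le _ _)
            ((Finset.sup_lt_iff (WithBot.bot_lt_coe k)).2 ?_)
          intro j hj
          exact lt_of_le_of_lt (degree_C_mul_X_pow_le _ _) (WithBot.coe_lt_coe.2 (mem_range.1 hj))
        · intro y hy z hz hyz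
          obtain ⟨a, -, rfl⟩ := mem_image.1 (mem_coe.1 hy)
          obtain ⟨b, -, rfl⟩ := mem_image.1 (mem_coe.1 hz)
          exact Complex.ext hyz (by rw [hx, hx])
      · intro y hy
        obtain ⟨z, hz', rfl⟩ := mem_image.1 hy
        obtain ⟨a, -, rfl⟩ := mem_image.1 hz'
        have := pow_eq_zero_iff (two_ne_zero) |>.1 (hz a (mem_univ a))
        simpa [hG, eval_finsetSum] using this
    ext i
    have := congrArg (fun p => p.coeff (i : ℕ)) hG0
    simpa [hG, finsetSum_coeff, coeff_C_mul, coeff_X_pow, hw] using this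

/-- The remainder of `X ^ i` modulo the polynomial with simple zeros at the nodes agrees with `X ^
i` at every node, and its coefficients are those of the relation. -/
theorem hankel_column_relation (hs : ∀ k, (s k : ℂ) = ∑ a, x a ^ k) (hx : ∀ a, (x a).im = 0)
    (i : ℕ) : ∃ c : ℕ → ℝ, ∀ b, s (b + i) = ∑ l ∈ range (univ.image x).card, c l * s (b + l) := by
  have hxr : ∀ a, x a = ((x a).re : ℂ) := fun a => Complex.ext (by simp) (by simp [hx a])
  set T := (univ.image x).image Complex.re with hT
  set Z : ℝ[X] := ∏ y ∈ T, (X - C y) with hZ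
  have hZm : Z.Monic := monic_prod_of_monic _ _ fun y _ => monic_X_sub_C y
  have hZd : Z.natDegree ≤ (univ.image x).card := by
    rw [hZ, natDegree_prod_of_monic _ _ fun y _ => monic_X_sub_C y]
    simpa using card_image_le
  set R : ℝ[X] := X ^ i %ₘ Z with hR
  have hRe : ∀ a, R.eval (x a).re = (x a).re ^ i := by
    intro a
    have h1 := modByMonic_add_div (X ^ i : ℝ[X]) Z
    have h2 : Z.eval (x a).re = 0 := by
      rw [hZ, eval_prod]
      refine prod_eq_zero (i := (x a).re)
        (mem_image_of_mem _ (mem_image_of_mem x (mem_univ a))) (by simp)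
    have h3 := congrArg (eval (x a).re) h1
    rw [eval_add, eval_mul, h2, zero_mul, add_zero, eval_pow, eval_X] at h3
    exact h3
  have hRs : ∀ y, R.eval y = ∑ l ∈ range (univ.image x).card, R.coeff l * y ^ l := by
    intro y
    -- If there are no nodes, the remainder is zero and has no degree below that of `Z`.
    by_cases hZ1 : Z = 1
    · have hR0 : R = 0 := by rw [hR, hZ1, modByMonic_one]
      simp [hR0]
    · exact eval_eq_sum_range' ((natDegree_modByMonic_lt _ hZm hZ1).trans_le hZd) y
  refine ⟨fun l => R.coeff l, fun b => ?_⟩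
  have hsr : ∀ k, s k = ∑ a, (x a).re ^ k := by
    intro k
    apply Complex.ofReal_injective
    rw [hs]; push_cast
    exact sum_congr rfl fun a _ => by rw [← hxr a]
  simp_rw [hsr, mul_sum]
  rw [sum_comm]
  refine sum_congr rfl fun a _ => ?_
  rw [pow_add, ← hRe, hRs, mul_sum]
  exact sum_congr rfl fun l _ => by ring

theorem regularPivots_hankel (hs : ∀ k, (s k : ℂ) = ∑ a, x a ^ k) (hx : ∀ a, (x a).im = 0)
    (d : ℕ) : RegularPivots (fun i j => s (i + j)) d :=
  regularPivots_of_column_relations (leadingMinor_hankel_pos hs hx)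
    (hankel_column_relation hs hx) d

/-- If the Hankel form of the power sums is nonnegative in degrees below the number of distinct
nodes, then all nodes are real. -/
theorem im_eq_zero_of_hankel_nonneg (hs : ∀ k, (s k : ℂ) = ∑ a, x a ^ k)
    (hconj : ∀ a, ∃ b, x b = (starRingEnd ℂ) (x a)) {r : ℕ} (hr : (univ.image x).card ≤ r)
    (hq : ∀ u : ℕ → ℝ, 0 ≤ ∑ i ∈ range r, ∑ j ∈ range r, u i * u j * s (i + j)) (a : ι) :
    (x a).im = 0 := by
  by_contra him
  set T := univ.image x with hT
  have hTc : ∀ y ∈ T, (starRingEnd ℂ) y ∈ T := by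
    intro y hy
    obtain ⟨a, -, rfl⟩ := mem_image.1 hy
    obtain ⟨b, hb⟩ := hconj a
    rw [← hb]; exact mem_image_of_mem x (mem_univ b)
  have hρ : (starRingEnd ℂ) (x a) ≠ x a := fun h => him (Complex.conj_eq_iff_im.1 h)
  -- A real polynomial with value `I` at the nonreal node, `-I` at its conjugate and `0` at the
  -- other nodes makes the form equal to minus the number of indices at these two nodes.
  set val : ℂ → ℂ := fun y => if y = x a then Complex.I
    else if y = (starRingEnd ℂ) (x a) then -Complex.I else 0 with hval
  have hvalc : ∀ y, (starRingEnd ℂ) (val ((starRingEnd ℂ) y)) = val y := by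
    intro y
    simp only [hval]
    by_cases h1 : y = x a
    · subst h1; simp [hρ]
    · have h1' : (starRingEnd ℂ) y ≠ (starRingEnd ℂ) (x a) := fun h => h1 (star_injective h)
      by_cases h2 : y = (starRingEnd ℂ) (x a)
      · subst h2; simp [hρ]
      · have h2' : (starRingEnd ℂ) y ≠ x a := fun h => h2 (by rw [← h]; simp)
        rw [if_neg h2', if_neg h1', if_neg h1, if_neg h2, map_zero]
  set G := Lagrange.interpolate T id val with hG
  have hGd : G.degree < T.card := Lagrange.degree_interpolate_lt _ (Set.injOn_id _)
  have hGe : ∀ y ∈ T, G.eval y = val y := fun y hy =>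
    Lagrange.eval_interpolate_at_node (v := id) val (Set.injOn_id _) hy
  -- The data are symmetric under conjugation, so uniqueness of interpolation makes the coefficients
  -- of `G` real.
  have hGc : G.map (starRingEnd ℂ) = G := by
    refine eq_of_degrees_lt_of_eval_finset_eq T ?_ hGd fun y hy => ?_
    · rwa [degree_map]
    · rw [hGe y hy, ← hvalc y, ← hGe _ (hTc y hy)]
      conv_lhs => rw [← Complex.conj_conj y]
      rw [eval_map, eval₂_at_apply]
  have hGr : ∀ i, ((G.coeff i).re : ℂ) = G.coeff i := by
    intro i
    have := congrArg (fun p => p.coeff i) hGc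
    simp only [coeff_map] at this
    exact Complex.conj_eq_iff_re.1 this
  have hcard : 0 < T.card := card_pos.2 ⟨x a, mem_image_of_mem x (mem_univ a)⟩
  have hGn : G.natDegree < r := by
    refine lt_of_lt_of_le ?_ hr
    rcases eq_or_ne G 0 with h0 | h0
    · rw [h0]; simpa using hcard
    · exact (natDegree_lt_iff_degree_lt h0).2 hGd
  have h1 := hankel_bilinear hs r r (fun i => ((G.coeff i).re : ℂ)) (fun i => ((G.coeff i).re : ℂ))
  have h2 : ∀ b, ∑ i ∈ range r, ((G.coeff i).re : ℂ) * x b ^ i = val (x b) := by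
    intro b
    simp_rw [hGr]
    rw [← eval_eq_sum_range' hGn, hGe _ (mem_image_of_mem x (mem_univ b))]
  simp_rw [h2] at h1
  have h3 : ∀ b, val (x b) * val (x b)
      = ((if x b = x a ∨ x b = (starRingEnd ℂ) (x a) then -1 else 0 : ℝ) : ℂ) := by
    intro b
    simp only [hval]
    by_cases e1 : x b = x a
    · simp [e1]
    · by_cases e2 : x b = (starRingEnd ℂ) (x a)
      · simp [e2, hρ]
      · simp [e1, e2]
  simp_rw [h3] at h1
  have h4 : ∑ i ∈ range r, ∑ j ∈ range r, (G.coeff i).re * (G.coeff j).re * s (i + j)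
      = ∑ b, (if x b = x a ∨ x b = (starRingEnd ℂ) (x a) then -1 else 0 : ℝ) := by
    apply Complex.ofReal_injective
    push_cast at h1 ⊢
    exact h1
  have h5 := hq fun i => (G.coeff i).re
  rw [h4] at h5
  have h6 : ∑ b, (if x b = x a ∨ x b = (starRingEnd ℂ) (x a) then -1 else 0 : ℝ) < 0 := by
    refine sum_neg' (fun b _ => by split_ifs <;> norm_num) ⟨a, mem_univ a, by simp⟩
  linarith

end Hermite

end

/-! ### Newton's identities, and real-rootedness along a one-parameter family. -/

section

open Finset Polynomial

/-- The power sums of the roots of `X ^ d + a 1 * X ^ (d - 1) + ⋯`, by Newton's identities. -/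
def newtonSum {R : Type*} [CommRing R] (d : ℕ) (a : ℕ → R) : ℕ → R
  | 0 => d
  | k + 1 => -(((k + 1 : ℕ) : R) * a (k + 1) + ∑ i : Fin k, a (i + 1) * newtonSum d a (k - i))

theorem newtonSum_zero {R : Type*} [CommRing R] (d : ℕ) (a : ℕ → R) : newtonSum d a 0 = d := by
  rw [newtonSum]

theorem newtonSum_succ {R : Type*} [CommRing R] (d : ℕ) (a : ℕ → R) (k : ℕ) :
    newtonSum d a (k + 1) = -(((k + 1 : ℕ) : R) * a (k + 1)
      + ∑ i ∈ range k, a (i + 1) * newtonSum d a (k - i)) := by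
  rw [newtonSum, sum_range]

theorem map_newtonSum {R S : Type*} [CommRing R] [CommRing S] (φ : R →+* S) (d : ℕ) (a : ℕ → R)
    (k : ℕ) : φ (newtonSum d a k) = newtonSum d (fun i => φ (a i)) k := by
  induction k using Nat.strong_induction_on with
  | _ k ih =>
  cases k with
  | zero => simp [newtonSum_zero]
  | succ k =>
    rw [newtonSum_succ, newtonSum_succ, map_neg, map_add, map_mul, map_natCast, map_sum]
    congr 2
    refine sum_congr rfl fun i hi => ?_
    rw [map_mul, ih _ (by omega)]

/-- Newton's identities are homogeneous when the coefficient `a k` has weight `k`. -/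
theorem natDegree_newtonSum_le {R : Type*} [CommRing R] (d : ℕ) {a : ℕ → R[X]}
    (ha : ∀ k, (a k).natDegree ≤ k) (k : ℕ) : (newtonSum d a k).natDegree ≤ k := by
  induction k using Nat.strong_induction_on with
  | _ k ih =>
  cases k with
  | zero => simp [newtonSum_zero]
  | succ k =>
    rw [newtonSum_succ, natDegree_neg]
    refine natDegree_add_le_of_degree_le ?_ (natDegree_sum_le_of_forall_le _ _ fun i hi => ?_)
    · refine natDegree_mul_le.trans ?_
      rw [natDegree_natCast, zero_add]; exact ha _
    · refine natDegree_mul_le.trans ((add_le_add (ha _) (ih _ (by omega))).trans ?_)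
      have := mem_range.1 hi
      omega

/-- The signs are those of Vieta's formulas for a monic polynomial with zeros `x i`. -/
theorem newtonSum_esymm {R σ : Type*} [CommRing R] [Fintype σ] (x : σ → R) (k : ℕ) :
    newtonSum (Fintype.card σ)
      (fun k => (-1) ^ k * MvPolynomial.aeval x (MvPolynomial.esymm σ R k)) k
      = ∑ i, x i ^ k := by
  induction k using Nat.strong_induction_on with
  | _ k ih =>
  cases k with
  | zero => simp [newtonSum_zero]
  | succ k =>
    have hp : ∀ k, ∑ i, x i ^ k = MvPolynomial.aeval x (MvPolynomial.psum σ R k) := by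
      intro k; simp [MvPolynomial.psum]
    have hN := congrArg (MvPolynomial.aeval x)
      (MvPolynomial.psum_eq_mul_esymm_sub_sum σ R (k + 1) k.succ_pos)
    rw [hp, hN, newtonSum_succ, map_sub, map_sum, neg_add, sub_eq_add_neg]
    congr 1
    · simp only [map_mul, map_pow, map_neg, map_one, map_natCast]; ring
    · congr 1
      refine sum_bij (fun i _ => (i + 1, k - i)) ?_ ?_ ?_ ?_
      · intro i hi
        have := mem_range.1 hi
        simp only [mem_filter, HasAntidiagonal.mem_antidiagonal, Set.mem_Ioo]
        omega
      · intro i _ j _ h; simpa using congrArg Prod.fst h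
      · rintro ⟨b, c⟩ h
        simp only [mem_filter, HasAntidiagonal.mem_antidiagonal, Set.mem_Ioo] at h
        exact ⟨b - 1, mem_range.2 (by omega), Prod.ext (by simp only; omega) (by simp only; omega)⟩
      · intro i hi
        rw [ih _ (by omega), hp]
        simp

/-- The nodes are indexed by the multiset of complex roots, so that multiplicities enter the power
sums. The coefficients beyond `d` have to vanish because Newton's identities of all orders refer to
them, as the elementary symmetric functions beyond the number of variables do. -/
theorem exists_nodes_of_coeffs (d : ℕ) {c : ℕ → ℝ} (h0 : c 0 = 1) (hc : ∀ k, d < k → c k = 0) :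
    ∃ (ι : Type) (_ : Fintype ι) (x : ι → ℂ), Fintype.card ι = d ∧
      (∀ k, ((newtonSum d c k : ℝ) : ℂ) = ∑ a, x a ^ k) ∧
      ∀ t : ℂ, ∑ k ∈ range (d + 1), (c k : ℂ) * t ^ (d - k) = 0 ↔ ∃ a, x a = t := by
  classical
  set q : ℂ[X] := ∑ k ∈ range (d + 1), C (c k : ℂ) * X ^ (d - k) with hq
  have hco : ∀ k ≤ d, q.coeff (d - k) = c k := by
    intro k hk
    rw [hq, finsetSum_coeff, sum_eq_single k]
    · simp
    · intro j hj hjk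
      have := mem_range.1 hj
      rw [coeff_C_mul_X_pow, if_neg (by omega)]
    · intro h; exact absurd (mem_range.2 (by omega)) h
  have hle : q.natDegree ≤ d := by
    refine natDegree_sum_le_of_forall_le _ _ fun k _ => ?_
    exact (natDegree_C_mul_X_pow_le _ _).trans (Nat.sub_le d k)
  have hd : q.coeff d = 1 := by simpa [h0] using hco 0 (Nat.zero_le d)
  have hdeg : q.natDegree = d := natDegree_eq_of_le_of_coeff_ne_zero hle (by rw [hd]; simp)
  have hmon : q.Monic := by rw [Monic, leadingCoeff, hdeg, hd]
  have hcard : Multiset.card q.roots = d := by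
    rw [← hdeg]; exact (IsAlgClosed.splits q).natDegree_eq_card_roots.symm
  have hcardT : Fintype.card q.roots = d := by rw [Multiset.card_coe, hcard]
  refine ⟨q.roots, inferInstance, fun a => a.1, hcardT, ?_, ?_⟩
  · intro k
    have hx : Multiset.map (fun a : q.roots => (a.1 : ℂ)) (univ : Finset q.roots).val = q.roots :=
      Multiset.map_univ_coe _
    have h1 : (fun k => ((c k : ℝ) : ℂ)) = fun k => (-1) ^ k *
        MvPolynomial.aeval (fun a : q.roots => (a.1 : ℂ))
          (MvPolynomial.esymm q.roots ℂ k) := by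
      funext k
      rw [MvPolynomial.aeval_esymm_eq_multiset_esymm, hx]
      rcases le_or_gt k d with h | h
      · rw [← hco k h, coeff_eq_esymm_roots_of_card (by rw [hcard, hdeg])
          (by rw [hdeg]; exact Nat.sub_le d k), hmon.leadingCoeff, hdeg, Nat.sub_sub_self h, one_mul]
      · rw [hc k h, Multiset.esymm, Multiset.powersetCard_eq_empty _ (by rw [hcard]; exact h)]
        simp
    have h2 := newtonSum_esymm (fun a : q.roots => (a.1 : ℂ)) k
    rw [← h2, hcardT, ← h1]
    exact map_newtonSum Complex.ofRealHom d c k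
  · intro t
    have he : ∑ k ∈ range (d + 1), (c k : ℂ) * t ^ (d - k) = q.eval t := by
      simp [hq, eval_finsetSum]
    rw [he]
    constructor
    · intro h
      have hmem : t ∈ q.roots := (mem_roots hmon.ne_zero).2 h
      exact ⟨⟨t, ⟨0, Multiset.count_pos.2 hmem⟩⟩, rfl⟩
    · rintro ⟨a, rfl⟩
      exact (mem_roots hmon.ne_zero).1 (Multiset.coe_mem)

/-- The polynomial `∑ c k * t ^ (d - k)` has only real zeros. -/
def RealRootedCoeffs (d : ℕ) (c : ℕ → ℝ) : Prop :=
  ∀ t : ℂ, ∑ k ∈ range (d + 1), (c k : ℂ) * t ^ (d - k) = 0 → t.im = 0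

theorem exists_conj_of_nodes {d : ℕ} {c : ℕ → ℝ} {ι : Type} {x : ι → ℂ}
    (hx : ∀ t : ℂ, ∑ k ∈ range (d + 1), (c k : ℂ) * t ^ (d - k) = 0 ↔ ∃ a, x a = t) (a : ι) :
    ∃ b, x b = (starRingEnd ℂ) (x a) := by
  rw [← hx]
  have h := congrArg (starRingEnd ℂ) ((hx (x a)).2 ⟨a, rfl⟩)
  simpa [map_sum] using h

theorem leadingMinor_zero {R : Type*} [CommRing R] (M : ℕ → ℕ → R) : leadingMinor M 0 = 1 := by
  simp [leadingMinor]

theorem map_leadingMinor {R S : Type*} [CommRing R] [CommRing S] (φ : R →+* S) (M : ℕ → ℕ → R)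
    (k : ℕ) : φ (leadingMinor M k) = leadingMinor (fun i j => φ (M i j)) k := by
  rw [leadingMinor, RingHom.map_det]; rfl

/-- Each term of the Leibniz formula picks every row and every column once, so its weight is twice
the sum of `0, …, k - 1`. A bound quadratic in `k` is what keeps the number of samples at `O(n ^
2)`. -/
theorem natDegree_leadingMinor_hankel_le {s : ℕ → ℝ[X]} (hs : ∀ k, (s k).natDegree ≤ k) (k : ℕ) :
    (leadingMinor (fun i j => s (i + j)) k).natDegree ≤ k * (k - 1) := by
  rw [leadingMinor, Matrix.det_apply]
  refine natDegree_sum_le_of_forall_le _ _ fun σ _ => ?_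
  refine (natDegree_smul_le _ _).trans ((natDegree_prod_le _ _).trans ?_)
  calc ∑ i : Fin k, (Matrix.of (fun i j : Fin k => s (i + j)) (σ i) i).natDegree
      ≤ ∑ i : Fin k, ((σ i : ℕ) + (i : ℕ)) := sum_le_sum fun i _ => hs _
    _ = (∑ i : Fin k, (i : ℕ)) + ∑ i : Fin k, (i : ℕ) := by
        rw [sum_add_distrib, Equiv.sum_comp σ (fun i : Fin k => (i : ℕ))]
    _ = k * (k - 1) := by
        rw [Fin.sum_univ_eq_sum_range (fun i => i), ← mul_two, sum_range_id_mul_two]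

section Family

variable {d : ℕ} {a : ℕ → ℝ[X]}

theorem regularPivots_of_realRooted {c : ℕ → ℝ} (h0 : c 0 = 1) (hc : ∀ k, d < k → c k = 0)
    (h : RealRootedCoeffs d c) : RegularPivots (fun i j => newtonSum d c (i + j)) d := by
  obtain ⟨ι, _, x, -, hs, hx⟩ := exists_nodes_of_coeffs d h0 hc
  exact regularPivots_hankel hs (fun a => h _ ((hx (x a)).2 ⟨a, rfl⟩)) d

theorem hankel_form_nonneg_of_realRooted {c : ℕ → ℝ} (h0 : c 0 = 1) (hc : ∀ k, d < k → c k = 0)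
    (h : RealRootedCoeffs d c) (r : ℕ) (u : ℕ → ℝ) :
    0 ≤ ∑ i ∈ range r, ∑ j ∈ range r, u i * u j * newtonSum d c (i + j) := by
  obtain ⟨ι, _, x, -, hs, hx⟩ := exists_nodes_of_coeffs d h0 hc
  rw [sum_mul_pow_sq_nonneg_of_im_eq_zero hs (fun a => h _ ((hx (x a)).2 ⟨a, rfl⟩))]
  exact sum_nonneg fun a _ => sq_nonneg _

theorem realRooted_of_hankel_form_nonneg {c : ℕ → ℝ} (h0 : c 0 = 1) (hc : ∀ k, d < k → c k = 0)
    (hq : ∀ u : ℕ → ℝ, 0 ≤ ∑ i ∈ range d, ∑ j ∈ range d, u i * u j * newtonSum d c (i + j)) :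
    RealRootedCoeffs d c := by
  classical
  obtain ⟨ι, _, x, hcard, hs, hx⟩ := exists_nodes_of_coeffs d h0 hc
  intro t ht
  obtain ⟨b, rfl⟩ := (hx t).1 ht
  exact im_eq_zero_of_hankel_nonneg hs (exists_conj_of_nodes hx)
    (card_image_le.trans (by rw [card_univ, hcard])) hq b

/-- The minor whose order is the number of distinct roots is nonzero, so that number is at most `r`.
Positive pivots make the form nonnegative in degrees below `r`, which is enough to exclude a nonreal
root. -/
theorem realRooted_of_leadingMinors {c : ℕ → ℝ} (h0 : c 0 = 1) (hc : ∀ k, d < k → c k = 0)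
    {r : ℕ} (hpos : ∀ k ≤ r, 0 < leadingMinor (fun i j => newtonSum d c (i + j)) k)
    (hzero : ∀ k, r < k → k ≤ d → leadingMinor (fun i j => newtonSum d c (i + j)) k = 0) :
    RealRootedCoeffs d c := by
  classical
  obtain ⟨ι, _, x, hcard, hs, hx⟩ := exists_nodes_of_coeffs d h0 hc
  have hm : (univ.image x).card ≤ d := card_image_le.trans (by rw [card_univ, hcard])
  have hmr : (univ.image x).card ≤ r := by
    by_contra h
    exact leadingMinor_hankel_ne_zero hs (hzero _ (not_le.1 h) hm)
  intro t ht
  obtain ⟨b, rfl⟩ := (hx t).1 ht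
  refine im_eq_zero_of_hankel_nonneg hs (exists_conj_of_nodes hx) hmr (fun u => ?_) b
  exact quadratic_form_nonneg_of_schur_pos (fun i j => by rw [add_comm])
    (schur_pivot_pos hpos) u

/-- The leading minors of the Hermite matrix of a one-parameter family. -/
noncomputable def hermiteMinor (d : ℕ) (a : ℕ → ℝ[X]) (k : ℕ) : ℝ[X] :=
  leadingMinor (fun i j => newtonSum d a (i + j)) k

theorem eval_hermiteMinor (k : ℕ) (γ : ℝ) : (hermiteMinor d a k).eval γ
    = leadingMinor (fun i j => newtonSum d (fun l => (a l).eval γ) (i + j)) k := by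
  rw [hermiteMinor, ← coe_evalRingHom, map_leadingMinor]
  simp_rw [map_newtonSum]

theorem natDegree_hermiteMinor_le (ha : ∀ k, (a k).natDegree ≤ k) {k : ℕ} (hk : k ≤ d) :
    (hermiteMinor d a k).natDegree ≤ d * d :=
  (natDegree_leadingMinor_hankel_le (natDegree_newtonSum_le d ha) k).trans
    (Nat.mul_le_mul hk ((Nat.sub_le k 1).trans hk))

/-- A one-parameter family of monic polynomials consists of real-rooted ones if and only if
elimination on the Hermite matrix succeeds at sufficiently many parameters and the
leading minors are nonnegative everywhere. -/
theorem forall_realRooted_iff (h0 : a 0 = 1) (hz : ∀ k, d < k → a k = 0)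
    (ha : ∀ k, (a k).natDegree ≤ k) {N : ℕ} (hN : d * d < N) :
    (∀ γ, RealRootedCoeffs d fun k => (a k).eval γ) ↔
      (∀ g < N, RegularPivots
        (fun i j => newtonSum d (fun l => (a l).eval (g : ℝ)) (i + j)) d) ∧
      ∀ k ≤ d, ∀ γ, 0 ≤ (hermiteMinor d a k).eval γ := by
  have h0' : ∀ γ, (a 0).eval γ = 1 := fun γ => by simp [h0]
  have hz' : ∀ γ k, d < k → (a k).eval γ = 0 := fun γ k hk => by simp [hz k hk]
  constructor
  · intro h
    have hreg : ∀ γ, RegularPivots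
        (fun i j => newtonSum d (fun l => (a l).eval γ) (i + j)) d := fun γ =>
      regularPivots_of_realRooted (h0' γ) (hz' γ) (h γ)
    refine ⟨fun g _ => hreg g, fun k hk γ => ?_⟩
    rw [eval_hermiteMinor, ((hreg γ).nonsingularPivots.mono hk).leadingMinor_eq_prod]
    refine prod_nonneg fun l hl => ?_
    have hld : l < d := (mem_range.1 hl).trans_le hk
    rcases hreg γ l hld with h1 | h1
    · exact h1.le
    · rw [h1 l l le_rfl hld le_rfl hld]
  · rintro ⟨hreg, hnn⟩
    classical
    -- The generic rank of the Hermite matrix, as the order of the last minor that is not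
    -- identically zero.
    obtain ⟨r, hr⟩ : ∃ r, r ≤ d ∧ hermiteMinor d a r ≠ 0 ∧
        ∀ k, r < k → k ≤ d → hermiteMinor d a k = 0 := by
      let S := (range (d + 1)).filter fun k => hermiteMinor d a k ≠ 0
      have hS : S.Nonempty := ⟨0, mem_filter.2 ⟨by simp, by rw [hermiteMinor, leadingMinor_zero]; exact one_ne_zero⟩⟩
      have hmem := S.max'_mem hS
      simp only [S, mem_filter, mem_range] at hmem
      refine ⟨S.max' hS, Nat.lt_succ_iff.1 hmem.1, hmem.2, fun k hk hkd => ?_⟩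
      by_contra hne
      exact absurd (S.le_max' k (by simp [S, hne, Nat.lt_succ_iff.2 hkd])) (not_le.2 hk)
    obtain ⟨hrd, hrne, hrz⟩ := hr
    -- The `r`-th minor has too low a degree to vanish at all samples. At a sample where it does
    -- not, it is the product of the pivots, and the smaller minors are partial products of it. This
    -- is the only use of the samples.
    have hall : ∀ k ≤ r, hermiteMinor d a k ≠ 0 := by
      obtain ⟨g, hgN, hg⟩ : ∃ g < N, (hermiteMinor d a r).eval (g : ℝ) ≠ 0 := by
        by_contra hcon
        push Not at hcon
        refine hrne (eq_zero_of_degree_lt_of_eval_finset_eq_zero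
          ((range N).image fun g : ℕ => (g : ℝ)) ?_ ?_)
        · rw [card_image_of_injective _ Nat.cast_injective, card_range]
          refine (natDegree_lt_iff_degree_lt hrne).1 ?_
          exact (natDegree_hermiteMinor_le ha hrd).trans_lt hN
        · intro y hy
          obtain ⟨g, hg, rfl⟩ := mem_image.1 hy
          exact hcon g (mem_range.1 hg)
      intro k hk hk0
      have hns := (hreg g hgN).nonsingularPivots
      rw [eval_hermiteMinor, (hns.mono hrd).leadingMinor_eq_prod] at hg
      have h1 : (hermiteMinor d a k).eval (g : ℝ) = 0 := by rw [hk0]; simp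
      rw [eval_hermiteMinor, (hns.mono (hk.trans hrd)).leadingMinor_eq_prod] at h1
      obtain ⟨l, hl, hl0⟩ := prod_eq_zero_iff.1 h1
      exact hg (prod_eq_zero (mem_range.2 ((mem_range.1 hl).trans_le hk)) hl0)
    set D : ℝ[X] := ∏ k ∈ range (r + 1), hermiteMinor d a k with hD
    have hD0 : D ≠ 0 := prod_ne_zero_iff.2 fun k hk =>
      hall k (Nat.lt_succ_iff.1 (mem_range.1 hk))
    have hgen : ∀ γ, D.eval γ ≠ 0 → RealRootedCoeffs d fun k => (a k).eval γ := by
      intro γ hγ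
      refine realRooted_of_leadingMinors (h0' γ) (hz' γ) (r := r) (fun k hk => ?_)
        (fun k hk hkd => ?_)
      · rw [← eval_hermiteMinor]
        refine lt_of_le_of_ne (hnn k (hk.trans hrd) γ) (Ne.symm fun h => hγ ?_)
        rw [hD, eval_prod]
        exact prod_eq_zero (mem_range.2 (Nat.lt_succ_iff.2 hk)) h
      · rw [← eval_hermiteMinor, hrz k hk hkd, eval_zero]
    -- Away from the finitely many zeros of `D` the minors of order at most `r` are strictly
    -- positive, which `hgen` exploits.
    have hdense : Dense {γ : ℝ | D.eval γ ≠ 0} := by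
      have hfin : (D.roots.toFinset : Set ℝ).Countable := D.roots.toFinset.countable_toSet
      refine (hfin.dense_compl ℝ).mono ?_
      intro γ hγ h
      exact hγ (by simpa [hD0] using h)
    intro γ
    refine realRooted_of_hankel_form_nonneg (h0' γ) (hz' γ) fun u => ?_
    -- For a fixed vector `u` the value of the Hermite form is a polynomial in `γ`, so its
    -- nonnegativity extends from a dense set to all `γ`.
    set φ : ℝ[X] := ∑ i ∈ range d, ∑ j ∈ range d, C (u i * u j) * newtonSum d a (i + j) with hφ
    have hφe : ∀ γ, φ.eval γ = ∑ i ∈ range d, ∑ j ∈ range d,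
        u i * u j * newtonSum d (fun l => (a l).eval γ) (i + j) := by
      intro γ
      simp only [hφ, eval_finsetSum, eval_mul, eval_C]
      refine sum_congr rfl fun i _ => sum_congr rfl fun j _ => ?_
      rw [← coe_evalRingHom, map_newtonSum]
    rw [← hφe]
    have hcl : IsClosed {γ : ℝ | 0 ≤ φ.eval γ} := isClosed_le continuous_const φ.continuous
    have hsub : {γ : ℝ | D.eval γ ≠ 0} ⊆ {γ : ℝ | 0 ≤ φ.eval γ} := by
      intro γ hγ
      show 0 ≤ φ.eval γ
      rw [hφe]
      exact hankel_form_nonneg_of_realRooted (h0' γ) (hz' γ) (hgen γ hγ) d u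
    exact hcl.closure_subset_iff.2 hsub (hdense γ)

end Family

end

/-! ### Stability in terms of the top form and of the lines of direction `(1, 1)`. -/

section

open Finset Polynomial

/-- A polynomial of degree at most `d` whose value at `t₀` is small against its coefficient
of order `d` has a zero near `t₀`. -/
theorem exists_root_near {g : ℂ[X]} {d : ℕ} (hdeg : g.natDegree ≤ d) {t₀ : ℂ} {ε : ℝ}
    (hε : 0 < ε) (h : ‖g.eval t₀‖ < ‖g.coeff d‖ * ε ^ d) : ∃ r, g.eval r = 0 ∧ ‖t₀ - r‖ < ε := by
  have hc : g.coeff d ≠ 0 := by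
    intro h0
    rw [h0, norm_zero, zero_mul] at h
    exact absurd h (not_lt.2 (norm_nonneg _))
  have hd : g.natDegree = d := natDegree_eq_of_le_of_coeff_ne_zero hdeg hc
  have hg0 : g ≠ 0 := by rintro rfl; simp at hc
  by_contra hcon
  push Not at hcon
  refine absurd h (not_lt.2 ?_)
  have hcard : Multiset.card g.roots = d := by
    rw [← hd]; exact (IsAlgClosed.splits g).natDegree_eq_card_roots.symm
  have hev : g.eval t₀ = g.coeff d * (g.roots.map fun r => t₀ - r).prod := by
    conv_lhs => rw [← C_leadingCoeff_mul_prod_multiset_X_sub_C (hcard.trans hd.symm)]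
    rw [eval_mul, eval_C, leadingCoeff, hd, eval_multiset_prod, Multiset.map_map]
    simp
  have hnorm : ‖(g.roots.map fun r => t₀ - r).prod‖ = (g.roots.map fun r => ‖t₀ - r‖).prod := by
    rw [← normHom_apply, map_multiset_prod, Multiset.map_map]; rfl
  rw [hev, norm_mul, hnorm]
  refine mul_le_mul_of_nonneg_left ?_ (norm_nonneg _)
  have := Multiset.prod_map_le_prod_map₀ (s := g.roots) (fun _ => ε) (fun r => ‖t₀ - r‖)
    (fun _ _ => hε.le) (fun r hr => hcon r ((mem_roots hg0).1 hr))
  simpa [hcard] using this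

/-- The homogenization in degree `d` of the polynomial with coefficients `P i j`. -/
noncomputable def homEval (P : ℕ → ℕ → ℝ) (n d : ℕ) (δ z w : ℂ) : ℂ :=
  ∑ i ∈ range (n + 1), ∑ j ∈ range (n + 1), (P i j : ℂ) * δ ^ (d - (i + j)) * z ^ i * w ^ j

/-- The value of the polynomial with coefficients `P i j`. -/
noncomputable def biEval (P : ℕ → ℕ → ℝ) (n : ℕ) (z w : ℂ) : ℂ :=
  ∑ i ∈ range (n + 1), ∑ j ∈ range (n + 1), (P i j : ℂ) * z ^ i * w ^ j

/-- The restriction of the polynomial with coefficients `P i j` to a line. -/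
noncomputable def linePoly (P : ℕ → ℕ → ℝ) (n : ℕ) (z w e f : ℂ) : ℂ[X] :=
  ∑ i ∈ range (n + 1), ∑ j ∈ range (n + 1),
    C (P i j : ℂ) * ((C z + C e * X) ^ i * (C w + C f * X) ^ j)

/-- Passage from the square of coefficients to the antidiagonal carrying the top form. As `d` may
exceed `n`, the antidiagonal may leave the square; `F` is zero there. -/
theorem sum_ite_add_eq {R : Type*} [AddCommMonoid R] {n d : ℕ} {F : ℕ → ℕ → R}
    (hF : ∀ i j, n < i ∨ n < j → F i j = 0) :
    ∑ i ∈ range (n + 1), ∑ j ∈ range (n + 1), (if i + j = d then F i j else 0)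
      = ∑ i ∈ range (d + 1), F i (d - i) := by
  have h1 : ∀ i, ∑ j ∈ range (n + 1), (if i + j = d then F i j else 0)
      = if i ≤ d then F i (d - i) else 0 := by
    intro i
    split_ifs with h
    · rw [sum_eq_single (d - i)]
      · rw [if_pos (by omega)]
      · intro j _ hj; rw [if_neg (by omega)]
      · intro hj
        rw [hF _ _ (Or.inr (by rw [mem_range] at hj; omega))]; simp
    · exact sum_eq_zero fun j _ => if_neg (by omega)
  simp_rw [h1]
  rw [← sum_filter]
  refine sum_subset_zero_on_sdiff (fun i hi => ?_) (fun i hi => ?_) fun _ _ => rfl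
  · simp only [mem_filter, mem_range] at hi ⊢; omega
  · simp only [mem_sdiff, mem_filter, mem_range] at hi
    exact hF _ _ (Or.inl (by omega))

section Criterion

variable {P : ℕ → ℕ → ℝ} {n d : ℕ}

theorem homEval_one (z w : ℂ) : homEval P n d 1 z w = biEval P n z w := by
  simp [homEval, biEval]

theorem homEval_smul (hd : ∀ i j, d < i + j → P i j = 0) (l δ z w : ℂ) :
    homEval P n d (l * δ) (l * z) (l * w) = l ^ d * homEval P n d δ z w := by
  simp only [homEval, mul_sum]
  refine sum_congr rfl fun i _ => sum_congr rfl fun j _ => ?_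
  rcases le_or_gt (i + j) d with h | h
  · have : l ^ d = l ^ (d - (i + j)) * l ^ i * l ^ j := by
      rw [mul_assoc, ← pow_add, ← pow_add]; congr 1; omega
    rw [this, mul_pow, mul_pow, mul_pow]; ring
  · simp [hd i j h]

theorem homEval_zero (hd : ∀ i j, d < i + j → P i j = 0) (z w : ℂ) : homEval P n d 0 z w
    = ∑ i ∈ range (n + 1), ∑ j ∈ range (n + 1),
        if i + j = d then (P i j : ℂ) * z ^ i * w ^ j else 0 := by
  refine sum_congr rfl fun i _ => sum_congr rfl fun j _ => ?_
  rcases lt_trichotomy (i + j) d with h | h | h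
  · rw [if_neg h.ne, zero_pow (by omega)]; simp
  · rw [if_pos h, h, Nat.sub_self]; simp
  · rw [hd i j h]; simp

theorem homEval_zero' (hP : ∀ i j, n < i ∨ n < j → P i j = 0)
    (hd : ∀ i j, d < i + j → P i j = 0) (z w : ℂ) : homEval P n d 0 z w
    = ∑ i ∈ range (d + 1), (P i (d - i) : ℂ) * z ^ i * w ^ (d - i) := by
  rw [homEval_zero hd]
  refine sum_ite_add_eq (F := fun i j => (P i j : ℂ) * z ^ i * w ^ j) fun i j hij => ?_
  simp [hP i j hij]

theorem Continuous.homEval {T : Type*} [TopologicalSpace T] {f g h : T → ℂ} (hf : Continuous f)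
    (hg : Continuous g) (hh : Continuous h) :
    Continuous fun x => homEval P n d (f x) (g x) (h x) := by
  unfold _root_.homEval; fun_prop

theorem Continuous.biEval {T : Type*} [TopologicalSpace T] {g h : T → ℂ}
    (hg : Continuous g) (hh : Continuous h) : Continuous fun x => biEval P n (g x) (h x) := by
  unfold _root_.biEval; fun_prop

/-- On a segment of lines on which the top form does not vanish the zeros stay bounded. -/
theorem exists_norm_le_of_biEval_eq_zero (hd : ∀ i j, d < i + j → P i j = 0) {e f : ℝ → ℝ}
    (he : Continuous e) (hf : Continuous f) (b₁ b₂ : ℂ)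
    (htop : ∀ s ∈ Set.Icc (0 : ℝ) 1, homEval P n d 0 (e s) (f s) ≠ 0) :
    ∃ R : ℝ, ∀ s ∈ Set.Icc (0 : ℝ) 1, ∀ t : ℂ,
      biEval P n (b₁ + e s * t) (b₂ + f s * t) = 0 → ‖t‖ ≤ R := by
  -- In the coordinate `τ = 1 / t`, zeros near infinity become zeros of the homogenization near `τ =
  -- 0`, where it is the top form. The tube lemma gives a neighbourhood of `0` free of zeros that
  -- serves all `s` of the segment.
  have hcont : Continuous fun x : ℝ × ℂ =>
      homEval P n d x.2 (x.2 * b₁ + e x.1) (x.2 * b₂ + f x.1) :=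
    Continuous.homEval (by fun_prop) (by fun_prop) (by fun_prop)
  have hopen : IsOpen {x : ℝ × ℂ |
      homEval P n d x.2 (x.2 * b₁ + e x.1) (x.2 * b₂ + f x.1) ≠ 0} :=
    isOpen_ne_fun hcont continuous_const
  obtain ⟨U, V, -, hV, hU, h0V, hUV⟩ := generalized_tube_lemma (isCompact_Icc (a := (0 : ℝ))
    (b := 1)) (isCompact_singleton (x := (0 : ℂ))) hopen (by
      rintro ⟨s, τ⟩ ⟨hs, hτ⟩
      obtain rfl : τ = 0 := hτ
      simpa using htop s hs)
  obtain ⟨ρ, hρ, hball⟩ := Metric.isOpen_iff.1 hV 0 (h0V rfl)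
  refine ⟨ρ⁻¹, fun s hs t hst => ?_⟩
  by_contra hlt
  rw [not_le] at hlt
  have ht0 : t ≠ 0 := by
    rintro rfl
    rw [norm_zero] at hlt
    exact absurd (inv_pos.2 hρ) (not_lt.2 hlt.le)
  have hmem : t⁻¹ ∈ V := hball (by
    rw [mem_ball_zero_iff, norm_inv]; exact inv_lt_of_inv_lt₀ hρ hlt)
  refine hUV (Set.mk_mem_prod (hU hs) hmem) ?_
  have h1 := homEval_smul (n := n) hd t t⁻¹ (t⁻¹ * b₁ + e s) (t⁻¹ * b₂ + f s)
  rw [mul_inv_cancel₀ ht0, homEval_one, mul_add, mul_add, ← mul_assoc, ← mul_assoc,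
    mul_inv_cancel₀ ht0, one_mul, one_mul, mul_comm t, mul_comm t] at h1
  exact (mul_eq_zero.1 (h1.symm.trans hst)).resolve_left (pow_ne_zero _ ht0)

theorem eval_linePoly (z w e f t : ℂ) :
    (linePoly P n z w e f).eval t = biEval P n (z + e * t) (w + f * t) := by
  simp [linePoly, biEval, eval_finsetSum, mul_assoc]

theorem natDegree_C_add_C_mul_X_le (z e : ℂ) : (C z + C e * X).natDegree ≤ 1 :=
  natDegree_add_le_of_degree_le (by simp) ((natDegree_C_mul_le _ _).trans natDegree_X_le)

theorem natDegree_linePoly_le (hd : ∀ i j, d < i + j → P i j = 0) (z w e f : ℂ) :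
    (linePoly P n z w e f).natDegree ≤ d := by
  refine natDegree_sum_le_of_forall_le _ _ fun i _ => natDegree_sum_le_of_forall_le _ _ fun j _ => ?_
  rcases le_or_gt (i + j) d with h | h
  · refine (natDegree_C_mul_le _ _).trans (natDegree_mul_le.trans ((add_le_add
      (natDegree_pow_le_of_le i (natDegree_C_add_C_mul_X_le z e))
      (natDegree_pow_le_of_le j (natDegree_C_add_C_mul_X_le w f))).trans ?_))
    omega
  · simp [hd i j h]

theorem coeff_linePoly (hd : ∀ i j, d < i + j → P i j = 0) (z w e f : ℂ) :
    (linePoly P n z w e f).coeff d = homEval P n d 0 e f := by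
  rw [homEval_zero hd, linePoly, finsetSum_coeff]
  refine sum_congr rfl fun i _ => ?_
  rw [finsetSum_coeff]
  refine sum_congr rfl fun j _ => ?_
  rw [coeff_C_mul]
  have h1 := natDegree_pow_le_of_le i (natDegree_C_add_C_mul_X_le z e)
  have h2 := natDegree_pow_le_of_le j (natDegree_C_add_C_mul_X_le w f)
  rcases lt_trichotomy (i + j) d with h | h | h
  · rw [if_neg h.ne, coeff_eq_zero_of_natDegree_lt, mul_zero]
    exact (natDegree_mul_le.trans (add_le_add h1 h2)).trans_lt (by omega)
  · subst h
    rw [if_pos rfl]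
    have e1 := coeff_mul_add_eq_of_natDegree_le h1 h2
    have e2 := coeff_pow_of_natDegree_le (natDegree_C_add_C_mul_X_le z e) (m := i)
    have e3 := coeff_pow_of_natDegree_le (natDegree_C_add_C_mul_X_le w f) (m := j)
    rw [e2, e3] at e1
    rw [mul_one, mul_one] at e1
    rw [e1]
    simp [coeff_C, mul_assoc]
  · rw [hd i j h]; simp [h.ne']

/-- The condition on the top form: all of its coefficients have the same sign. -/
def TopSameSign (P : ℕ → ℕ → ℝ) (d : ℕ) : Prop :=
  ∑ i ∈ range (d + 1), P i (d - i) ≠ 0 ∧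
    ∀ i ≤ d, 0 ≤ P i (d - i) * ∑ i ∈ range (d + 1), P i (d - i)

/-- An argument of Hurwitz type. The top form is the limit of `δ ^ d * p (z / δ, w / δ)` as `δ`
tends to `0`; if it vanished at `(z, w)`, then `p` would have a zero close, on the scale `1 / δ`, to
`(z / δ, w / δ)`. -/
theorem homEval_zero_ne_zero_of_stable (hP : ∀ i j, n < i ∨ n < j → P i j = 0)
    (hd : ∀ i j, d < i + j → P i j = 0) (htop : ∃ i ≤ d, P i (d - i) ≠ 0)
    (hst : ∀ z w : ℂ, 0 < z.im → 0 < w.im → biEval P n z w ≠ 0) {z w : ℂ} (hz : 0 < z.im)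
    (hw : 0 < w.im) : homEval P n d 0 z w ≠ 0 := by
  intro h0
  -- The zero is sought along a positive direction in which the top form does not vanish, so that
  -- the restriction has full degree `d`.
  obtain ⟨e, he, hne⟩ : ∃ e : ℝ, 0 < e ∧ homEval P n d 0 e 1 ≠ 0 := by
    set R : ℝ[X] := ∑ i ∈ range (d + 1), C (P i (d - i)) * X ^ i with hR
    have hR0 : R ≠ 0 := by
      obtain ⟨i, hi, hi0⟩ := htop
      intro h
      have := congrArg (fun p => p.coeff i) h
      simp [hR, finsetSum_coeff, coeff_C_mul, coeff_X_pow, hi0, Nat.lt_succ_iff.2 hi] at this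
    obtain ⟨e, he, hne⟩ := (Set.Ioi_infinite (0 : ℝ)).exists_notMem_finset R.roots.toFinset
    refine ⟨e, he, fun h => hne ?_⟩
    have : R.eval e = 0 := by
      apply Complex.ofReal_injective
      rw [homEval_zero' hP hd] at h
      simpa [hR, eval_finsetSum] using h
    simpa [hR0] using this
  -- A displacement of size `ε` along `(e, 1)` keeps both coordinates in the upper half-plane;
  -- everything is later scaled by `1 / δ`.
  obtain ⟨ε, hε, hε1, hε2⟩ : ∃ ε > 0, e * ε < z.im ∧ ε < w.im := by
    refine ⟨min (z.im / e) w.im / 2, by positivity, ?_, ?_⟩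
    · have h1 : min (z.im / e) w.im ≤ z.im / e := min_le_left _ _
      have h2 : e * (min (z.im / e) w.im) ≤ z.im := by
        calc _ ≤ e * (z.im / e) := mul_le_mul_of_nonneg_left h1 he.le
          _ = z.im := by field_simp
      linarith
    · have h1 : min (z.im / e) w.im ≤ w.im := min_le_right _ _
      linarith
  have hcont : Continuous fun δ : ℝ => ‖homEval P n d δ z w‖ := by
    exact (Continuous.homEval (by fun_prop) (by fun_prop) (by fun_prop)).norm
  have hpos : 0 < ‖homEval P n d 0 e 1‖ * ε ^ d := by
    have := norm_pos_iff.2 hne; positivity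
  have hev : ∀ᶠ δ : ℝ in nhdsWithin 0 (Set.Ioi 0),
      ‖homEval P n d δ z w‖ < ‖homEval P n d 0 e 1‖ * ε ^ d := by
    refine Filter.Eventually.filter_mono nhdsWithin_le_nhds ?_
    refine hcont.continuousAt.eventually_lt_const ?_
    simpa [h0] using hpos
  obtain ⟨δ, hδlt, hδ⟩ := (hev.and self_mem_nhdsWithin).exists
  have hδ : 0 < δ := hδ
  have hδ0 : (δ : ℂ) ≠ 0 := by exact_mod_cast hδ.ne'
  have hb : biEval P n ((δ : ℂ)⁻¹ * z) ((δ : ℂ)⁻¹ * w)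
      = ((δ : ℂ)⁻¹) ^ d * homEval P n d δ z w := by
    rw [← homEval_smul hd, inv_mul_cancel₀ hδ0, homEval_one]
  obtain ⟨r, hr, hrn⟩ := exists_root_near (d := d) (g := linePoly P n ((δ : ℂ)⁻¹ * z)
    ((δ : ℂ)⁻¹ * w) e 1) (natDegree_linePoly_le hd _ _ _ _) (t₀ := 0) (ε := δ⁻¹ * ε)
    (by positivity) (by
      rw [eval_linePoly, coeff_linePoly hd, mul_zero, mul_zero, add_zero, add_zero, hb, norm_mul,
        norm_pow, norm_inv, Complex.norm_real, Real.norm_of_nonneg hδ.le, mul_pow]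
      have : 0 < δ⁻¹ ^ d := by positivity
      nlinarith [mul_lt_mul_of_pos_left hδlt this])
  rw [eval_linePoly] at hr
  rw [zero_sub, norm_neg] at hrn
  have him : |r.im| < δ⁻¹ * ε := (Complex.abs_im_le_norm r).trans_lt hrn
  have him' := (abs_lt.1 him).1
  have hinv : 0 < δ⁻¹ := by positivity
  refine hst _ _ ?_ ?_ hr
  · have : (((δ : ℂ)⁻¹ * z) + e * r).im = δ⁻¹ * z.im + e * r.im := by
      rw [← Complex.ofReal_inv]; simp
    rw [this]
    nlinarith [mul_lt_mul_of_pos_left hε1 hinv, mul_lt_mul_of_pos_left him' he]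
  · have : (((δ : ℂ)⁻¹ * w) + 1 * r).im = δ⁻¹ * w.im + r.im := by
      rw [← Complex.ofReal_inv]; simp
    rw [this]
    nlinarith [mul_lt_mul_of_pos_left hε2 hinv]

/-- With `u` the square root of `t` in the right half-plane, `I / u` and `I * u` lie in the upper
half-plane and have the quotient `t`. -/
theorem exists_mul_eq_upperHalfPlane {t : ℂ} (ht : t ∈ Complex.slitPlane) :
    ∃ w : ℂ, 0 < w.im ∧ 0 < (t * w).im := by
  set u := Complex.exp (Complex.log t / 2) with hu
  have ht0 : t ≠ 0 := Complex.slitPlane_ne_zero ht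
  have huu : u * u = t := by
    rw [hu, ← Complex.exp_add, add_halves, Complex.exp_log ht0]
  have hre : 0 < u.re := by
    rw [hu, Complex.exp_re]
    refine mul_pos (Real.exp_pos _) (Real.cos_pos_of_mem_Ioo ?_)
    have him : (Complex.log t / 2).im = Complex.arg t / 2 := by
      rw [← Complex.log_im]; simp
    rw [him]
    have h1 := Complex.neg_pi_lt_arg t
    have h2 := lt_of_le_of_ne (Complex.arg_le_pi t) (Complex.mem_slitPlane_iff_arg.1 ht).1
    constructor <;> linarith
  have hu0 : u ≠ 0 := Complex.exp_ne_zero _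
  refine ⟨Complex.I * u⁻¹, ?_, ?_⟩
  · simp only [Complex.mul_im, Complex.I_re, Complex.I_im, zero_mul, one_mul, zero_add,
      Complex.inv_re]
    exact div_pos hre (Complex.normSq_pos.2 hu0)
  · have : t * (Complex.I * u⁻¹) = Complex.I * u := by rw [← huu]; field_simp
    rw [this]; simpa using hre

theorem coeff_prod_X_add_C_nonneg (T : Multiset ℝ) (hT : ∀ a ∈ T, 0 ≤ a) (i : ℕ) :
    0 ≤ ((T.map fun a => X + C a).prod).coeff i := by
  induction T using Multiset.induction_on generalizing i with
  | empty => simp only [Multiset.map_zero, Multiset.prod_zero, coeff_one]; split_ifs <;> norm_num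
  | cons a T ih =>
    have ih := ih fun b hb => hT b (Multiset.mem_cons_of_mem hb)
    rw [Multiset.map_cons, Multiset.prod_cons, add_mul, coeff_add, coeff_C_mul]
    refine add_nonneg ?_ (mul_nonneg (hT a (Multiset.mem_cons_self a T)) (ih i))
    cases i with
    | zero => simp
    | succ i => rw [coeff_X_mul]; exact ih i

/-- A zero of the dehomogenized top form off the negative half-line and `0` is a quotient of two
points of the upper half-plane, where the top form does not vanish. So all zeros are real and
nonpositive, and the form is a constant times a product of factors `X + a` with `0 ≤ a`. -/
theorem topSameSign_of_stable (hP : ∀ i j, n < i ∨ n < j → P i j = 0)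
    (hd : ∀ i j, d < i + j → P i j = 0) (htop : ∃ i ≤ d, P i (d - i) ≠ 0)
    (hst : ∀ z w : ℂ, 0 < z.im → 0 < w.im → biEval P n z w ≠ 0) : TopSameSign P d := by
  set R : ℝ[X] := ∑ i ∈ range (d + 1), C (P i (d - i)) * X ^ i with hR
  have hRc : ∀ i ≤ d, R.coeff i = P i (d - i) := by
    intro i hi
    simp [hR, finsetSum_coeff, coeff_C_mul, coeff_X_pow, Nat.lt_succ_iff.2 hi]
  have hR0 : R ≠ 0 := by
    obtain ⟨i, hi, hi0⟩ := htop
    rintro h; rw [← hRc i hi, h] at hi0; simp at hi0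
  set RC := R.map Complex.ofRealHom with hRC
  have hRC0 : RC ≠ 0 := (map_ne_zero_iff (f := Polynomial.mapRingHom Complex.ofRealHom)
    (map_injective _ Complex.ofRealHom.injective)).2 hR0
  have hroot : ∀ t ∈ RC.roots, t.im = 0 ∧ t.re ≤ 0 := by
    intro t ht
    have ht0 : RC.eval t = 0 := (mem_roots hRC0).1 ht
    by_contra hcon
    have hsl : t ∈ Complex.slitPlane := by
      rw [Complex.mem_slitPlane_iff]
      by_contra h
      push Not at h
      exact hcon ⟨h.2, h.1⟩
    obtain ⟨w, hw, htw⟩ := exists_mul_eq_upperHalfPlane hsl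
    refine homEval_zero_ne_zero_of_stable hP hd htop hst htw hw ?_
    have h1 := homEval_smul (n := n) hd w 0 t 1
    rw [mul_zero, mul_one, mul_comm w t] at h1
    rw [h1, homEval_zero' hP hd]
    have : ∑ i ∈ range (d + 1), (P i (d - i) : ℂ) * t ^ i * 1 ^ (d - i) = RC.eval t := by
      simp [hRC, hR, Polynomial.map_sum, eval_finsetSum]
    rw [this, ht0, mul_zero]
  set T := RC.roots.map fun t => -t.re with hT
  have hTnn : ∀ a ∈ T, 0 ≤ a := by
    intro a ha
    obtain ⟨t, ht, rfl⟩ := Multiset.mem_map.1 ha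
    linarith [(hroot t ht).2]
  have hfac : R = C R.leadingCoeff * (T.map fun a => X + C a).prod := by
    apply map_injective _ Complex.ofRealHom.injective
    have hsp := C_leadingCoeff_mul_prod_multiset_X_sub_C
      (IsAlgClosed.splits RC).natDegree_eq_card_roots.symm
    rw [Polynomial.map_mul, map_C, Polynomial.map_multiset_prod, hT, Multiset.map_map,
      Multiset.map_map, ← hRC]
    refine hsp.symm.trans ?_
    congr 1
    · rw [hRC, leadingCoeff_map]
    · congr 1
      refine Multiset.map_congr rfl fun t ht => ?_
      have : t = (t.re : ℂ) := Complex.ext rfl (by simp [(hroot t ht).1])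
      simp only [Function.comp, Polynomial.map_add, map_X, map_C, Complex.ofRealHom_eq_coe]
      conv_lhs => rw [this]
      simp [sub_eq_add_neg]
  have hsum : ∑ i ∈ range (d + 1), P i (d - i) = R.eval 1 := by simp [hR, eval_finsetSum]
  have hprod : 0 < ((T.map fun a => X + C a).prod).eval 1 := by
    rw [eval_multiset_prod, Multiset.map_map]
    refine Multiset.prod_pos fun b hb => ?_
    obtain ⟨a, ha, rfl⟩ := Multiset.mem_map.1 hb
    have := hTnn a ha
    simp only [Function.comp, eval_add, eval_X, eval_C]; linarith
  have hev : R.eval 1 = R.leadingCoeff * ((T.map fun a => X + C a).prod).eval 1 := by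
    conv_lhs => rw [hfac]
    rw [eval_mul, eval_C]
  refine ⟨?_, fun i hi => ?_⟩
  · rw [hsum, hev]
    exact mul_ne_zero (leadingCoeff_ne_zero.2 hR0) hprod.ne'
  · rw [hsum, hev, ← hRc i hi]
    have : R.coeff i = R.leadingCoeff * ((T.map fun a => X + C a).prod).coeff i := by
      conv_lhs => rw [hfac]
      rw [coeff_C_mul]
    rw [this]
    have h1 := mul_nonneg (mul_self_nonneg R.leadingCoeff)
      (mul_nonneg (coeff_prod_X_add_C_nonneg T hTnn i) hprod.le)
    linarith

/-- At positive arguments, terms of one sign cannot cancel. -/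
theorem homEval_zero_ne_zero_of_pos (hP : ∀ i j, n < i ∨ n < j → P i j = 0)
    (hd : ∀ i j, d < i + j → P i j = 0) (ht : TopSameSign P d) {u v : ℝ} (hu : 0 < u)
    (hv : 0 < v) : homEval P n d 0 u v ≠ 0 := by
  rw [homEval_zero' hP hd]
  set c := ∑ i ∈ range (d + 1), P i (d - i) with hc
  intro h
  have h1 : ∑ i ∈ range (d + 1), P i (d - i) * c * (u ^ i * v ^ (d - i)) = 0 := by
    have h2 : ∑ i ∈ range (d + 1), P i (d - i) * u ^ i * v ^ (d - i) = 0 := by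
      apply Complex.ofReal_injective; push_cast; exact h
    calc _ = c * ∑ i ∈ range (d + 1), P i (d - i) * u ^ i * v ^ (d - i) := by
          rw [mul_sum]; exact sum_congr rfl fun i _ => by ring
      _ = 0 := by rw [h2, mul_zero]
  have h3 := (sum_eq_zero_iff_of_nonneg fun i hi => mul_nonneg
    (ht.2 i (Nat.lt_succ_iff.1 (mem_range.1 hi))) (by positivity)).1 h1
  refine ht.1 (sum_eq_zero fun i hi => ?_)
  have h4 : 0 < u ^ i * v ^ (d - i) := by positivity
  have h5 := (mul_eq_zero.1 (h3 i hi)).resolve_right h4.ne'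
  exact (mul_eq_zero.1 h5).resolve_right ht.1

/-- Lines through a common base point, both of whose coordinates have imaginary part `δ`, are
deformed from the direction `(1, 1)` at `s = 0` to the one that meets `(z, w)` at `t = I` when `s =
1`. At the least `s` with a zero in the closed upper half-plane, the zero is interior and `s` is
positive; but then zeros persist for slightly smaller `s`. -/
theorem stable_of_realRooted (hP : ∀ i j, n < i ∨ n < j → P i j = 0)
    (hd : ∀ i j, d < i + j → P i j = 0) (ht : TopSameSign P d)
    (hrr : ∀ (γ : ℝ) (t : ℂ), biEval P n (γ + t) t = 0 → t.im = 0) (z w : ℂ) (hz : 0 < z.im)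
    (hw : 0 < w.im) : biEval P n z w ≠ 0 := by
  intro hzw
  obtain ⟨δ, hδ, hδz, hδw⟩ : ∃ δ > 0, δ < z.im ∧ δ < w.im := by
    refine ⟨min z.im w.im / 2, by positivity, ?_, ?_⟩
    · have := min_le_left z.im w.im; linarith
    · have := min_le_right z.im w.im; linarith
  set b₁ : ℂ := z.re + δ * Complex.I with hb₁
  set b₂ : ℂ := w.re + δ * Complex.I with hb₂
  set e : ℝ → ℝ := fun s => (1 - s) + s * (z.im - δ) with he
  set f : ℝ → ℝ := fun s => (1 - s) + s * (w.im - δ) with hf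
  have hpos : ∀ y : ℝ, 0 < y → ∀ s ∈ Set.Icc (0 : ℝ) 1, 0 < (1 - s) + s * y := by
    rintro y hy s ⟨hs0, hs1⟩
    rcases hs0.eq_or_lt with h | h
    · rw [← h]; norm_num
    · nlinarith [mul_pos h hy]
  have hepos : ∀ s ∈ Set.Icc (0 : ℝ) 1, 0 < e s := hpos _ (by linarith)
  have hfpos : ∀ s ∈ Set.Icc (0 : ℝ) 1, 0 < f s := hpos _ (by linarith)
  have hec : Continuous e := by fun_prop
  have hfc : Continuous f := by fun_prop
  clear_value e f b₁ b₂
  have htop : ∀ s ∈ Set.Icc (0 : ℝ) 1, homEval P n d 0 (e s) (f s) ≠ 0 := fun s hs =>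
    homEval_zero_ne_zero_of_pos hP hd ht (hepos s hs) (hfpos s hs)
  obtain ⟨R, hR⟩ := exists_norm_le_of_biEval_eq_zero hd hec hfc b₁ b₂ htop
  -- Compactness of `K`, hence the existence of a least `s`, rests on the uniform bound `R` for the
  -- zeros.
  set K : Set (ℝ × ℂ) := {x | x.1 ∈ Set.Icc (0 : ℝ) 1 ∧ 0 ≤ x.2.im ∧
    biEval P n (b₁ + e x.1 * x.2) (b₂ + f x.1 * x.2) = 0} with hK
  have hcontK : Continuous fun x : ℝ × ℂ => biEval P n (b₁ + e x.1 * x.2) (b₂ + f x.1 * x.2) :=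
    Continuous.biEval (by fun_prop) (by fun_prop)
  have hKb : K ⊆ Set.Icc (0 : ℝ) 1 ×ˢ Metric.closedBall (0 : ℂ) R := by
    rintro ⟨s, t⟩ ⟨hs, -, hst⟩
    exact ⟨hs, mem_closedBall_zero_iff.2 (hR s hs t hst)⟩
  have hKc : IsCompact K := by
    refine IsCompact.of_isClosed_subset (isCompact_Icc.prod (isCompact_closedBall _ _)) ?_ hKb
    refine IsClosed.inter (isClosed_Icc.preimage continuous_fst) (IsClosed.inter ?_ ?_)
    · exact isClosed_le continuous_const (Complex.continuous_im.comp continuous_snd)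
    · exact isClosed_eq hcontK continuous_const
  have hKne : K.Nonempty := by
    refine ⟨(1, Complex.I), by simp, by simp, ?_⟩
    have h1 : b₁ + (e 1 : ℂ) * Complex.I = z := by
      apply Complex.ext <;> simp [hb₁, he]
    have h2 : b₂ + (f 1 : ℂ) * Complex.I = w := by
      apply Complex.ext <;> simp [hb₂, hf]
    simp only [h1, h2, hzw]
  obtain ⟨⟨s, t⟩, ⟨hs, him, hst⟩, hmin⟩ := hKc.exists_isMinOn hKne continuous_fst.continuousOn
  simp only at hs him hst
  have hmin : ∀ x ∈ K, s ≤ x.1 := fun x hx => hmin hx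
  -- At real `t` both coordinates have imaginary part `δ`, so they differ by a real number, and
  -- real-rootedness forces `δ = 0`.
  have him0 : 0 < t.im := by
    refine lt_of_le_of_ne him fun h0 => ?_
    have h1 : b₁ + e s * t = ((z.re + e s * t.re - (w.re + f s * t.re) : ℝ) : ℂ)
        + (b₂ + f s * t) := by
      apply Complex.ext <;> simp [hb₁, hb₂, ← h0]
    rw [h1] at hst
    have := hrr _ _ hst
    simp [hb₂, ← h0] at this
    exact hδ.ne' this
  -- In the direction `(1, 1)` the coordinates differ by a real number for every `t`, so a zero has
  -- imaginary part `-δ`.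
  have hs0 : 0 < s := by
    refine lt_of_le_of_ne hs.1 fun h0 => ?_
    have h1 : b₁ + e s * t = ((z.re - w.re : ℝ) : ℂ) + (b₂ + f s * t) := by
      apply Complex.ext
      · simp [hb₁, hb₂, ← h0, he, hf]; ring
      · simp [hb₁, hb₂, ← h0, he, hf]
    rw [h1] at hst
    have := hrr _ _ hst
    simp [hb₂, ← h0, hf] at this
    linarith
  have hlt : ∀ᶠ s' in nhdsWithin s (Set.Iio s),
      ‖biEval P n (b₁ + e s' * t) (b₂ + f s' * t)‖ < ‖homEval P n d 0 (e s') (f s')‖ * t.im ^ d := by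
    refine Filter.Eventually.filter_mono nhdsWithin_le_nhds ?_
    have c1 : Continuous fun s' : ℝ => ‖biEval P n (b₁ + e s' * t) (b₂ + f s' * t)‖ := by
      exact (Continuous.biEval (by fun_prop) (by fun_prop)).norm
    have c2 : Continuous fun s' : ℝ => ‖homEval P n d 0 (e s') (f s')‖ * t.im ^ d := by
      exact (Continuous.homEval (by fun_prop) (by fun_prop) (by fun_prop)).norm.mul
        continuous_const
    refine c1.continuousAt.eventually_lt c2.continuousAt ?_
    rw [hst, norm_zero]
    have := norm_pos_iff.2 (htop s hs)
    positivity
  have hIoo : ∀ᶠ s' in nhdsWithin s (Set.Iio s), s' ∈ Set.Ioo 0 s := Ioo_mem_nhdsLT hs0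
  obtain ⟨s', hs', hs'I⟩ := (hlt.and hIoo).exists
  -- The radius `t.im` is as large as possible for the new zero to stay in the closed upper
  -- half-plane.
  obtain ⟨r, hr, hrn⟩ := exists_root_near (d := d) (g := linePoly P n b₁ b₂ (e s') (f s'))
    (natDegree_linePoly_le hd _ _ _ _) (t₀ := t) him0 (by
      rw [eval_linePoly, coeff_linePoly hd]; exact hs')
  rw [eval_linePoly] at hr
  have hrim : 0 ≤ r.im := by
    have h1 := (Complex.abs_im_le_norm (t - r)).trans_lt hrn
    rw [Complex.sub_im] at h1
    linarith [(abs_lt.1 h1).2]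
  exact absurd (hmin (s', r) ⟨⟨hs'I.1.le, hs'I.2.le.trans hs.2⟩, hrim, hr⟩) (not_le.2 hs'I.2)

end Criterion

end

/-! ### The family `p (γ + t, t)` and the decision criterion. -/

section

open Finset Polynomial

/-- The polynomial `p (γ + t, t)` in `t`. -/
noncomputable def diagPoly {R : Type*} [CommRing R] [Algebra ℝ R] (P : ℕ → ℕ → ℝ) (n : ℕ) (γ : R) :
    R[X] :=
  ∑ i ∈ range (n + 1), ∑ j ∈ range (n + 1), C (algebraMap ℝ R (P i j)) * ((X + C γ) ^ i * X ^ j)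

/-- The coefficients of `p (γ + t, t)`, normalized to be monic in `t`, as polynomials in `γ`;
the coefficient of order `k` belongs to `t ^ (d - k)`. -/
noncomputable def diagCoeff (P : ℕ → ℕ → ℝ) (n d k : ℕ) : ℝ[X] :=
  if k ≤ d then C (∑ i ∈ range (d + 1), P i (d - i))⁻¹ * (diagPoly P n (X : ℝ[X])).coeff (d - k)
  else 0

section Family

variable {P : ℕ → ℕ → ℝ} {n d : ℕ}

theorem coeff_X_add_C_pow_mul_X_pow {R : Type*} [CommRing R] (γ : R) (i j l : ℕ) :
    ((X + C γ) ^ i * X ^ j).coeff l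
      = if j ≤ l then γ ^ (i - (l - j)) * ((i.choose (l - j) : ℕ) : R) else 0 := by
  rw [coeff_mul_X_pow']
  split_ifs
  · rw [coeff_X_add_C_pow]
  · rfl

/-- The substitution does not raise the total degree in `γ` and `t`. Hence the coefficient at `t ^
(d - k)` has weight `k`, as the degree bounds for the Hermite minors require. -/
theorem natDegree_coeff_diagPoly_le (hd : ∀ i j, d < i + j → P i j = 0) (l : ℕ) :
    ((diagPoly P n (X : ℝ[X])).coeff l).natDegree ≤ d - l := by
  rw [diagPoly, finsetSum_coeff]
  refine natDegree_sum_le_of_forall_le _ _ fun i _ => ?_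
  rw [finsetSum_coeff]
  refine natDegree_sum_le_of_forall_le _ _ fun j _ => ?_
  rcases le_or_gt (i + j) d with h | h
  · rw [coeff_C_mul, coeff_X_add_C_pow_mul_X_pow]
    split_ifs with h'
    · refine (natDegree_C_mul_le _ _).trans (natDegree_mul_le.trans ?_)
      rw [natDegree_natCast, add_zero, natDegree_X_pow]; omega
    · simp
  · simp [hd i j h]

/-- The leading coefficient in `t` is the value of the top form at `(1, 1)`. As it does not depend
on `γ`, the family can be made monic without denominators in `γ`. -/
theorem coeff_diagPoly_top (hP : ∀ i j, n < i ∨ n < j → P i j = 0)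
    (hd : ∀ i j, d < i + j → P i j = 0) {R : Type*} [CommRing R] [Algebra ℝ R] (γ : R) :
    (diagPoly P n γ).coeff d = algebraMap ℝ R (∑ i ∈ range (d + 1), P i (d - i)) := by
  rw [← sum_ite_add_eq (F := P) hP, map_sum, diagPoly, finsetSum_coeff]
  refine sum_congr rfl fun i _ => ?_
  rw [finsetSum_coeff, map_sum]
  refine sum_congr rfl fun j _ => ?_
  rcases lt_trichotomy (i + j) d with h | h | h
  · rw [coeff_C_mul, coeff_X_add_C_pow_mul_X_pow, if_neg h.ne, if_pos (by omega),
      Nat.choose_eq_zero_of_lt (by omega)]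
    simp
  · rw [coeff_C_mul, coeff_X_add_C_pow_mul_X_pow, if_pos h, if_pos (by omega), ← h,
      Nat.add_sub_cancel]
    simp
  · simp [hd i j h]

theorem map_diagPoly {R S : Type*} [CommRing R] [Algebra ℝ R] [CommRing S] [Algebra ℝ S]
    (φ : R →ₐ[ℝ] S) (γ : R) :
    (diagPoly P n γ).map (φ : R →+* S) = diagPoly P n (φ γ) := by
  simp [diagPoly, Polynomial.map_sum]

theorem eval_coeff_diagPoly (γ : ℝ) (l : ℕ) :
    ((diagPoly P n (X : ℝ[X])).coeff l).eval γ = (diagPoly P n γ).coeff l := by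
  have h := map_diagPoly (P := P) (n := n) (aeval γ : ℝ[X] →ₐ[ℝ] ℝ) X
  rw [aeval_X] at h
  rw [← h, coeff_map]
  simp

theorem eval_diagCoeff (γ : ℝ) (k : ℕ) : (diagCoeff P n d k).eval γ
    = if k ≤ d then (diagPoly P n γ).coeff (d - k) / ∑ i ∈ range (d + 1), P i (d - i) else 0 := by
  rw [diagCoeff]
  split_ifs
  · rw [eval_mul, eval_C, eval_coeff_diagPoly]; ring
  · simp

theorem diagCoeff_zero (hP : ∀ i j, n < i ∨ n < j → P i j = 0)
    (hd : ∀ i j, d < i + j → P i j = 0) (hc : ∑ i ∈ range (d + 1), P i (d - i) ≠ 0) :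
    diagCoeff P n d 0 = 1 := by
  rw [diagCoeff, if_pos (Nat.zero_le d), Nat.sub_zero, coeff_diagPoly_top hP hd, algebraMap_eq,
    ← C_mul, inv_mul_cancel₀ hc, C_1]

theorem diagCoeff_eq_zero {k : ℕ} (hk : d < k) : diagCoeff P n d k = 0 :=
  if_neg (not_le.2 hk)

theorem natDegree_diagCoeff_le (hd : ∀ i j, d < i + j → P i j = 0) (k : ℕ) :
    (diagCoeff P n d k).natDegree ≤ k := by
  rw [diagCoeff]
  split_ifs with h
  · refine (natDegree_C_mul_le _ _).trans ((natDegree_coeff_diagPoly_le hd _).trans ?_)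
    omega
  · simp

theorem natDegree_diagPoly_le (hd : ∀ i j, d < i + j → P i j = 0) {R : Type*} [CommRing R]
    [Algebra ℝ R] (γ : R) : (diagPoly P n γ).natDegree ≤ d := by
  nontriviality R
  refine natDegree_sum_le_of_forall_le _ _ fun i _ =>
    natDegree_sum_le_of_forall_le _ _ fun j _ => ?_
  rcases le_or_gt (i + j) d with h | h
  · refine (natDegree_C_mul_le _ _).trans (natDegree_mul_le.trans ((add_le_add
      (natDegree_pow_le_of_le i (natDegree_X_add_C γ).le) (natDegree_X_pow_le j)).trans ?_))
    omega
  · simp [hd i j h]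

theorem sum_diagCoeff_mul_pow (hd : ∀ i j, d < i + j → P i j = 0) (γ : ℝ) (t : ℂ) :
    ∑ k ∈ range (d + 1), (((diagCoeff P n d k).eval γ : ℝ) : ℂ) * t ^ (d - k)
      = ((∑ i ∈ range (d + 1), P i (d - i) : ℝ) : ℂ)⁻¹ * biEval P n (γ + t) t := by
  have h1 : biEval P n (γ + t) t = (diagPoly P n (γ : ℂ)).eval t := by
    simp [biEval, diagPoly, eval_finsetSum, add_comm, mul_assoc]
  have h2 : ∀ l, (diagPoly P n (γ : ℂ)).coeff l = ((diagPoly P n γ).coeff l : ℝ) := by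
    intro l
    have h := map_diagPoly (P := P) (n := n) Complex.ofRealAm γ
    rw [Complex.ofRealAm_coe] at h
    rw [← h, coeff_map]; simp
  rw [h1, eval_eq_sum_range' (Nat.lt_succ_iff.2 (natDegree_diagPoly_le hd _)), mul_sum,
    ← sum_range_reflect]
  refine sum_congr rfl fun k hk => ?_
  have hk' := Nat.lt_succ_iff.1 (mem_range.1 hk)
  rw [Nat.add_sub_cancel, eval_diagCoeff, if_pos (Nat.sub_le d k), Nat.sub_sub_self hk', h2]
  push_cast; ring

theorem biEval_conj (z w : ℂ) :
    biEval P n ((starRingEnd ℂ) z) ((starRingEnd ℂ) w) = (starRingEnd ℂ) (biEval P n z w) := by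
  simp [biEval, map_sum]

/-- The decision procedure: a nonzero bivariate polynomial of total degree `d` is stable if and
only if the coefficients of its top form have the same sign, elimination on the Hermite matrices
of `p (g + t, t)` succeeds for `g = 0, …, N - 1`, and their leading minors are nonnegative. -/
theorem stable_iff (hP : ∀ i j, n < i ∨ n < j → P i j = 0)
    (hd : ∀ i j, d < i + j → P i j = 0) (htop : ∃ i ≤ d, P i (d - i) ≠ 0) {N : ℕ}
    (hN : d * d < N) :
    (∀ z w : ℂ, 0 < z.im → 0 < w.im → biEval P n z w ≠ 0) ↔
      TopSameSign P d ∧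
      (∀ g < N, RegularPivots (fun i j =>
        newtonSum d (fun l => (diagCoeff P n d l).eval (g : ℝ)) (i + j)) d) ∧
      ∀ k ≤ d, ∀ γ, 0 ≤ (hermiteMinor d (diagCoeff P n d) k).eval γ := by
  have key : TopSameSign P d → ((∀ (γ : ℝ) (t : ℂ), biEval P n (γ + t) t = 0 → t.im = 0) ↔
      (∀ g < N, RegularPivots (fun i j =>
        newtonSum d (fun l => (diagCoeff P n d l).eval (g : ℝ)) (i + j)) d) ∧
      ∀ k ≤ d, ∀ γ, 0 ≤ (hermiteMinor d (diagCoeff P n d) k).eval γ) := by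
    intro ht
    rw [← forall_realRooted_iff (diagCoeff_zero hP hd ht.1) (fun k => diagCoeff_eq_zero)
      (natDegree_diagCoeff_le hd) hN]
    refine forall_congr' fun γ => forall_congr' fun t => ?_
    have hc : ((∑ i ∈ range (d + 1), P i (d - i) : ℝ) : ℂ)⁻¹ ≠ 0 :=
      inv_ne_zero (by exact_mod_cast ht.1)
    rw [sum_diagCoeff_mul_pow hd, mul_eq_zero, or_iff_right hc]
  constructor
  · intro hst
    have ht := topSameSign_of_stable hP hd htop hst
    refine ⟨ht, (key ht).1 fun γ t h0 => ?_⟩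
    -- A zero in the lower half-plane is conjugated into the upper one, the coefficients being real.
    rcases lt_trichotomy t.im 0 with h | h | h
    · exfalso
      refine hst ((starRingEnd ℂ) (γ + t)) ((starRingEnd ℂ) t) (by simpa using h)
        (by simpa using h) ?_
      rw [biEval_conj, h0, map_zero]
    · exact h
    · exact absurd h0 (hst _ _ (by simpa using h) h)
  · rintro ⟨ht, h⟩ z w hz hw
    exact stable_of_realRooted hP hd ht ((key ht).2 h) z w hz hw

end Family

end

/-! ### Rules for proving correctness and cost of programs. -/

section

open Finset

namespace RealRAM

/-- The index registers to which a program writes. -/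
def Program.wIdx : Program → List ℕ
  | skip => []
  | setIdx r _ => [r]
  | setMem _ _ _ _ => []
  | divMem _ _ _ _ _ => []
  | seq P Q => P.wIdx ++ Q.wIdx
  | cond _ P Q => P.wIdx ++ Q.wIdx
  | loop _ P => P.wIdx

/-- The arrays to which a program writes. -/
def Program.wMem : Program → List ℕ
  | skip => []
  | setIdx _ _ => []
  | setMem a _ _ _ => [a]
  | divMem a _ _ _ _ => [a]
  | seq P Q => P.wMem ++ Q.wMem
  | cond _ P Q => P.wMem ++ Q.wMem
  | loop _ P => P.wMem

/-- The states `s` and `s'` agree outside the registers and arrays to which `P` writes. -/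
structure Frame (P : Program) (s s' : State) : Prop where
  idx : ∀ r, r ∉ P.wIdx → s'.idx r = s.idx r
  mem : ∀ a, a ∉ P.wMem → s'.mem a = s.mem a

theorem Frame.refl (P : Program) (s : State) : Frame P s s := ⟨fun _ _ => rfl, fun _ _ => rfl⟩

theorem Frame.trans {P : Program} {s s' s'' : State} (h : Frame P s s') (h' : Frame P s' s'') :
    Frame P s s'' :=
  ⟨fun r hr => (h'.idx r hr).trans (h.idx r hr), fun a ha => (h'.mem a ha).trans (h.mem a ha)⟩

theorem Frame.mono {P Q : Program} {s s' : State} (h : Frame P s s') (hi : P.wIdx ⊆ Q.wIdx)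
    (hm : P.wMem ⊆ Q.wMem) : Frame Q s s' :=
  ⟨fun r hr => h.idx r fun h => hr (hi h), fun a ha => h.mem a fun h => ha (hm h)⟩

@[simp] theorem State.setIdx_idx (s : State) (r v q : ℕ) :
    (s.setIdx r v).idx q = if q = r then v else s.idx q := by
  simp [State.setIdx, Function.update_apply]

@[simp] theorem State.setIdx_mem (s : State) (r v : ℕ) : (s.setIdx r v).mem = s.mem := rfl

@[simp] theorem State.setMem_idx (s : State) (a i j : ℕ) (v : ℝ) :
    (s.setMem a i j v).idx = s.idx := rfl

theorem State.setMem_mem (s : State) (a i j : ℕ) (v : ℝ) (a' i' j' : ℕ) :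
    (s.setMem a i j v).mem a' i' j'
      = if a' = a ∧ i' = i ∧ j' = j then v else s.mem a' i' j' := rfl

@[simp] theorem State.setMem_mem_self (s : State) (a i j : ℕ) (v : ℝ) :
    (s.setMem a i j v).mem a i j = v := by simp [State.setMem]

theorem State.setMem_mem_of_ne (s : State) (a i j : ℕ) (v : ℝ) {a' : ℕ} (h : a' ≠ a) :
    (s.setMem a i j v).mem a' = s.mem a' := by
  funext i' j'; simp [State.setMem, h]

/-- The lists of written registers and arrays are syntactic, so that later on the preservation of
data is settled by `decide`. -/
theorem Exec.frame {P : Program} {s s' : State} {t : ℕ} (h : Exec P s t s') : Frame P s s' := by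
  induction h with
  | skip s => exact .refl _ s
  | setIdx s r e =>
    exact ⟨fun q hq => by simp_all [Program.wIdx], fun a _ => rfl⟩
  | setMem s a i j e =>
    exact ⟨fun q _ => rfl, fun b hb => State.setMem_mem_of_ne _ _ _ _ _ (by
      simpa [Program.wMem] using hb)⟩
  | divMem s a i j e f _ =>
    exact ⟨fun q _ => rfl, fun b hb => State.setMem_mem_of_ne _ _ _ _ _ (by
      simpa [Program.wMem] using hb)⟩
  | seq _ _ ihP ihQ =>
    exact (ihP.mono (List.subset_append_left _ _) (List.subset_append_left _ _)).trans
      (ihQ.mono (List.subset_append_right _ _) (List.subset_append_right _ _))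
  | condTrue _ _ ih => exact ih.mono (List.subset_append_left _ _) (List.subset_append_left _ _)
  | condFalse _ _ ih => exact ih.mono (List.subset_append_right _ _) (List.subset_append_right _ _)
  | loopDone _ => exact .refl _ _
  | loopStep _ _ _ ihP ihl => exact .trans ⟨ihP.idx, ihP.mem⟩ ihl

/-- Started in `s`, the program `P` halts after at most `B` operations in a state
satisfying `Q`. -/
def Reach (P : Program) (s : State) (B : ℕ) (Q : State → Prop) : Prop :=
  ∃ t s', Exec P s t s' ∧ t ≤ B ∧ Q s'

theorem Reach.mono {P : Program} {s : State} {B B' : ℕ} {Q Q' : State → Prop}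
    (h : Reach P s B Q) (hB : B ≤ B') (hQ : ∀ s', Frame P s s' → Q s' → Q' s') :
    Reach P s B' Q' := by
  obtain ⟨t, s', he, ht, hq⟩ := h
  exact ⟨t, s', he, ht.trans hB, hQ s' he.frame hq⟩

theorem Reach.skip {s : State} {B : ℕ} {Q : State → Prop} (hB : 1 ≤ B) (h : Q s) :
    Reach .skip s B Q :=
  ⟨_, _, .skip s, hB, h⟩

theorem Reach.setIdx {s : State} {r : ℕ} {e : IExp} {B : ℕ} {Q : State → Prop}
    (hB : e.cost + 1 ≤ B) (h : Q (s.setIdx r (e.eval s))) : Reach (.setIdx r e) s B Q :=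
  ⟨_, _, .setIdx s r e, hB, h⟩

theorem Reach.setMem {s : State} {a : ℕ} {i j : IExp} {e : RExp} {B : ℕ} {Q : State → Prop}
    (hB : i.cost + j.cost + e.cost + 1 ≤ B) (h : Q (s.setMem a (i.eval s) (j.eval s) (e.eval s))) :
    Reach (.setMem a i j e) s B Q :=
  ⟨_, _, .setMem s a i j e, hB, h⟩

theorem Reach.divMem {s : State} {a : ℕ} {i j : IExp} {e f : RExp} {B : ℕ} {Q : State → Prop}
    (hf : f.eval s ≠ 0) (hB : i.cost + j.cost + e.cost + f.cost + 1 ≤ B)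
    (h : Q (s.setMem a (i.eval s) (j.eval s) (e.eval s / f.eval s))) :
    Reach (.divMem a i j e f) s B Q :=
  ⟨_, _, .divMem s a i j e f hf, hB, h⟩

theorem Reach.seq {P P' : Program} {s : State} {B₁ B₂ B : ℕ} {R Q : State → Prop}
    (h₁ : Reach P s B₁ R) (h₂ : ∀ s', Frame P s s' → R s' → Reach P' s' B₂ Q)
    (hB : B₁ + B₂ ≤ B) : Reach (.seq P P') s B Q := by
  obtain ⟨t, s', he, ht, hr⟩ := h₁
  obtain ⟨u, s'', he', hu, hq⟩ := h₂ s' he.frame hr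
  exact ⟨_, _, .seq he he', (add_le_add ht hu).trans hB, hq⟩

theorem Reach.cond {b : Test} {P P' : Program} {s : State} {B' B : ℕ} {Q : State → Prop}
    (h₁ : b.Holds s → Reach P s B' Q) (h₂ : ¬ b.Holds s → Reach P' s B' Q)
    (hB : b.cost + 1 + B' ≤ B) : Reach (.cond b P P') s B Q := by
  by_cases h : b.Holds s
  · obtain ⟨t, s', he, ht, hq⟩ := h₁ h
    exact ⟨_, _, .condTrue h he, (Nat.add_le_add_left ht _).trans hB, hq⟩
  · obtain ⟨t, s', he, ht, hq⟩ := h₂ h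
    exact ⟨_, _, .condFalse h he, (Nat.add_le_add_left ht _).trans hB, hq⟩

/-- A loop with an invariant and a decreasing measure. -/
theorem Reach.loop {b : Test} {P : Program} {Bb : ℕ} (Inv : State → Prop) (μ : State → ℕ)
    (hstep : ∀ s, Inv s → b.Holds s → Reach P s Bb fun s' => Inv s' ∧ μ s' < μ s)
    {s : State} (h : Inv s) :
    Reach (.loop b P) s ((μ s + 1) * (b.cost + 1 + Bb)) fun s' => Inv s' ∧ ¬ b.Holds s' := by
  induction hm : μ s using Nat.strong_induction_on generalizing s with
  | _ m ih =>
  by_cases hb : b.Holds s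
  · obtain ⟨t, s', he, ht, hI, hμ⟩ := hstep s h hb
    obtain ⟨u, s'', he', hu, hq⟩ := ih (μ s') (hm ▸ hμ) hI rfl
    refine ⟨_, _, .loopStep hb he he', ?_, hq⟩
    have h1 : (μ s' + 1) * (b.cost + 1 + Bb) ≤ m * (b.cost + 1 + Bb) :=
      Nat.mul_le_mul_right _ (by omega)
    rw [Nat.add_mul, Nat.one_mul]
    omega
  · refine ⟨_, _, .loopDone hb, ?_, h, hb⟩
    rw [Nat.add_mul]; omega

/-- `for r = 0, …, m - 1 do body`. -/
def forUp (r : ℕ) (m : IExp) (body : Program) : Program :=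
  .seq (.setIdx r (.const 0))
    (.loop (.neg (.ile m (.reg r))) (.seq body (.setIdx r (.add (.reg r) (.const 1)))))

/-- The bound `m` is evaluated anew in each pass, so it has to be stable under whatever the loop
changes. The body establishes the invariant for the state in which the counter has already been
raised. -/
theorem Reach.forUp {r : ℕ} {m : IExp} {body : Program} {s : State} {M Bb B : ℕ}
    (Inv : ℕ → State → Prop) (hr : r ∉ body.wIdx)
    (hm : ∀ s', Frame (forUp r m body) s s' → m.eval s' = M)
    (h0 : Inv 0 (s.setIdx r 0))
    (hb : ∀ i < M, ∀ s', Frame (RealRAM.forUp r m body) s s' → s'.idx r = i → Inv i s' →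
      Reach body s' Bb fun s'' => Inv (i + 1) (s''.setIdx r (i + 1)))
    (hB : (M + 1) * (Bb + m.cost + 10) ≤ B) :
    Reach (RealRAM.forUp r m body) s B fun s' => s'.idx r = M ∧ Inv M s' := by
  have hfr : Frame (RealRAM.forUp r m body) s (s.setIdx r 0) := by
    refine ⟨fun q hq => ?_, fun a _ => rfl⟩
    have : q ≠ r := fun h => hq (by simp [RealRAM.forUp, Program.wIdx, h])
    simp [this]
  have hsub : Frame (.seq body (.setIdx r (.add (.reg r) (.const 1)))) ≤
      Frame (RealRAM.forUp r m body) := by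
    intro s₁ s₂ h
    refine h.mono ?_ ?_
    · simp only [RealRAM.forUp, Program.wIdx]; exact List.subset_append_right _ _
    · simp only [RealRAM.forUp, Program.wMem]; exact List.subset_append_right _ _
  have hloop := Reach.loop (b := .neg (.ile m (.reg r)))
    (P := .seq body (.setIdx r (.add (.reg r) (.const 1)))) (Bb := Bb + 4)
    (fun s' => Frame (RealRAM.forUp r m body) s s' ∧ s'.idx r ≤ M ∧ Inv (s'.idx r) s')
    (fun s' => M - s'.idx r) (by
      rintro s' ⟨hF, hle, hI⟩ hlt
      simp only [Test.Holds, IExp.eval, hm s' hF, not_le] at hlt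
      have h1 : Reach (.seq body (.setIdx r (.add (.reg r) (.const 1)))) s' (Bb + 4)
          fun s'' => s''.idx r = s'.idx r + 1 ∧ Inv (s'.idx r + 1) s'' := by
        refine Reach.seq (hb _ hlt s' hF rfl hI) (fun s'' hF' hI' => ?_) le_rfl
        refine Reach.setIdx (by simp [IExp.cost]) ?_
        have : s''.idx r = s'.idx r := hF'.idx r hr
        simp only [IExp.eval, this]
        exact ⟨by simp, hI'⟩
      refine h1.mono le_rfl fun s'' hF' ⟨h2, h3⟩ => ⟨⟨hF.trans (hsub _ _ hF'), ?_, ?_⟩, ?_⟩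
      · omega
      · rw [h2]; exact h3
      · omega)
    (s := s.setIdx r 0) ⟨hfr, by simp, by simpa using h0⟩
  refine Reach.seq (B₁ := 2) (R := fun s' => s' = s.setIdx r 0)
    (B₂ := (M + 1) * (m.cost + 4 + (Bb + 4)))
    (Reach.setIdx (by simp [IExp.cost]) rfl) ?_ ?_
  · rintro s' - rfl
    refine hloop.mono (le_of_eq ?_) ?_
    · simp [Test.cost, IExp.cost]
    · rintro s'' - ⟨⟨hF, hle, hI⟩, hnot⟩
      simp only [Test.Holds, IExp.eval, hm s'' hF, not_not] at hnot
      have : s''.idx r = M := le_antisymm hle hnot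
      rw [this] at hI
      exact ⟨this, hI⟩
  · refine le_trans ?_ hB
    have : (M + 1) * (Bb + m.cost + 10) = (M + 1) * (m.cost + 4 + (Bb + 4)) + (M + 1) * 2 := by ring
    omega

/-- The state with `v 0, …, v (k - 1)` written to row `i` of array `a` from column `o` on. -/
noncomputable def State.fillRow (s : State) (a i o k : ℕ) (v : ℕ → ℝ) : State where
  idx := s.idx
  mem := fun a' i' j' =>
    if a' = a ∧ i' = i ∧ o ≤ j' ∧ j' < o + k then v (j' - o) else s.mem a' i' j'

@[simp] theorem State.fillRow_idx (s : State) (a i o k : ℕ) (v : ℕ → ℝ) :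
    (s.fillRow a i o k v).idx = s.idx := rfl

theorem State.fillRow_mem (s : State) (a i o k : ℕ) (v : ℕ → ℝ) (a' i' j' : ℕ) :
    (s.fillRow a i o k v).mem a' i' j'
      = if a' = a ∧ i' = i ∧ o ≤ j' ∧ j' < o + k then v (j' - o) else s.mem a' i' j' := rfl

/-- Fill a segment of a row of an array. -/
def fill (a : ℕ) (i j : IExp) (r : ℕ) (m : IExp) (e : RExp) : Program :=
  forUp r m (.setMem a i j e)

/-- The `k`-th value is computed in the state in which the previous ones are already written, so
that a segment can be filled by a recurrence. -/
theorem reach_fill {a r : ℕ} {i j m : IExp} {e : RExp} {s : State} (M i₀ o : ℕ) (v : ℕ → ℝ)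
    {B : ℕ} (hm : ∀ s' : State, (∀ q, q ≠ r → s'.idx q = s.idx q) → m.eval s' = M)
    (h : ∀ k < M, i.eval ((s.fillRow a i₀ o k v).setIdx r k) = i₀ ∧
      j.eval ((s.fillRow a i₀ o k v).setIdx r k) = o + k ∧
      e.eval ((s.fillRow a i₀ o k v).setIdx r k) = v k)
    (hB : (M + 1) * (i.cost + j.cost + e.cost + m.cost + 11) ≤ B) :
    Reach (fill a i j r m e) s B fun s' => s' = (s.fillRow a i₀ o M v).setIdx r M := by
  refine (Reach.forUp (M := M) (Bb := i.cost + j.cost + e.cost + 1)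
    (fun k s' => s' = (s.fillRow a i₀ o k v).setIdx r k) (by simp [Program.wIdx]) ?_ ?_ ?_
    (le_trans (le_of_eq (by ring)) hB)).mono le_rfl fun s' _ h => h.2
  · intro s' hF
    exact hm s' fun q hq => hF.idx q (by simp [forUp, Program.wIdx, hq])
  · have : s.fillRow a i₀ o 0 v = s := by
      obtain ⟨idx, mem⟩ := s
      simp only [State.fillRow, State.mk.injEq, true_and]
      funext a' i' j'
      rw [if_neg (by omega)]
    rw [this]
  · rintro k hk s' - - rfl
    obtain ⟨h1, h2, h3⟩ := h k hk
    refine Reach.setMem le_rfl ?_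
    rw [h1, h2, h3]
    simp only [State.setIdx, State.setMem, State.fillRow, State.mk.injEq]
    refine ⟨by simp, ?_⟩
    funext a' i' j'
    by_cases hc : a' = a ∧ i' = i₀ ∧ j' = o + k
    · obtain ⟨rfl, rfl, rfl⟩ := hc
      rw [if_pos ⟨rfl, rfl, rfl⟩, if_pos ⟨rfl, rfl, by omega, by omega⟩, Nat.add_sub_cancel_left]
    · rw [if_neg hc]
      by_cases hd : a' = a ∧ i' = i₀ ∧ o ≤ j' ∧ j' < o + k
      · rw [if_pos hd, if_pos ⟨hd.1, hd.2.1, hd.2.2.1, by omega⟩]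
      · rw [if_neg hd, if_neg (by omega)]

/-- Sum up the values of an expression in the cell `(i, j)` of the array `a`. -/
def accum (a : ℕ) (i j : IExp) (r : ℕ) (m : IExp) (e : RExp) : Program :=
  .seq (.setMem a i j (.const 0)) (forUp r m (.setMem a i j (.add (.load a i j) e)))

/-- The summand may not depend on the partial sum; this is the role of the arbitrary content `x` of
the accumulating cell. -/
theorem reach_accum {a r : ℕ} {i j m : IExp} {e : RExp} {s : State} (M i₀ j₀ : ℕ) (v : ℕ → ℝ)
    {B : ℕ} (hij : ∀ s' : State, (∀ q, q ≠ r → s'.idx q = s.idx q) →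
      i.eval s' = i₀ ∧ j.eval s' = j₀ ∧ m.eval s' = M)
    (hij₀ : i.eval s = i₀ ∧ j.eval s = j₀)
    (h : ∀ k < M, ∀ x, e.eval ((s.setMem a i₀ j₀ x).setIdx r k) = v k)
    (hB : (M + 1) * (3 * (i.cost + j.cost) + e.cost + m.cost + 15) ≤ B) :
    Reach (accum a i j r m e) s B
      fun s' => s' = (s.setMem a i₀ j₀ (∑ k ∈ range M, v k)).setIdx r M := by
  have hset : ∀ x y, (s.setMem a i₀ j₀ x).setMem a i₀ j₀ y = s.setMem a i₀ j₀ y := by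
    intro x y
    simp only [State.setMem, State.mk.injEq, true_and]
    funext a' i' j'
    split_ifs <;> rfl
  refine Reach.seq (B₁ := i.cost + j.cost + 2) (R := fun s' => s' = s.setMem a i₀ j₀ 0)
    (B₂ := (M + 1) * (2 * (i.cost + j.cost) + e.cost + m.cost + 13)) ?_ ?_ ?_
  · refine Reach.setMem (by simp [RExp.cost]) ?_
    rw [hij₀.1, hij₀.2]; simp [RExp.eval]
  · rintro s' - rfl
    refine (Reach.forUp (M := M) (Bb := 2 * (i.cost + j.cost) + e.cost + 3)
      (fun k s' => s' = (s.setMem a i₀ j₀ (∑ l ∈ range k, v l)).setIdx r k)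
      (by simp [Program.wIdx]) ?_ ?_ ?_ (le_of_eq (by ring))).mono le_rfl fun s' _ h => h.2
    · intro s' hF
      refine (hij s' fun q hq => ?_).2.2
      exact hF.idx q (by simp [forUp, Program.wIdx, hq])
    · simp
    · rintro k hk s' - - rfl
      have hidx : ∀ q, q ≠ r →
          ((s.setMem a i₀ j₀ (∑ l ∈ range k, v l)).setIdx r k).idx q = s.idx q := by
        intro q hq; simp [hq]
      obtain ⟨h1, h2, -⟩ := hij _ hidx
      refine Reach.setMem (by simp only [RExp.cost]; omega) ?_
      simp only [RExp.eval]
      rw [h1, h2, h k hk, State.setIdx_mem, State.setMem_mem_self, ← sum_range_succ]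
      have := hset (∑ l ∈ range k, v l) (∑ l ∈ range (k + 1), v l)
      simp only [State.setIdx, State.setMem, State.mk.injEq] at this ⊢
      refine ⟨by simp, this.2⟩
  · refine le_trans ?_ hB
    have h1 : (M + 1) * (3 * (i.cost + j.cost) + e.cost + m.cost + 15)
      = (M + 1) * (2 * (i.cost + j.cost) + e.cost + m.cost + 13)
        + (M + 1) * (i.cost + j.cost + 2) := by ring
    have h2 : i.cost + j.cost + 2 ≤ (M + 1) * (i.cost + j.cost + 2) :=
      Nat.le_mul_of_pos_left _ (Nat.succ_pos M)
    omega

/-- The test that a real expression has the value zero. -/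
def isZero (e : RExp) : Test := .conj (.rle e (.const 0)) (.rle (.const 0) e)

theorem isZero_holds {e : RExp} {s : State} : (isZero e).Holds s ↔ e.eval s = 0 := by
  simp only [isZero, Test.Holds, RExp.eval, Int.cast_zero]
  exact ⟨fun h => le_antisymm h.1 h.2, fun h => by simp [h]⟩

/-- The test that a real expression has a positive value. -/
def isPos (e : RExp) : Test := .neg (.rle e (.const 0))

theorem isPos_holds {e : RExp} {s : State} : (isPos e).Holds s ↔ 0 < e.eval s := by
  simp [isPos, Test.Holds, RExp.eval]

end RealRAM

end

/-! ### Euclid's algorithm for Cauchy indices on the machine. -/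

section

open Finset Polynomial

namespace RealRAM

/-- The cells `0, …, N - 1` of row `0` of the array `a` hold the coefficients of `f`. -/
def HoldsPoly (s : State) (a N : ℕ) (f : ℝ[X]) : Prop :=
  ∀ l < N, s.mem a 0 l = f.coeff l

/-- Exchange the arrays `11` and `12`, changing the sign of the latter, and the degree registers
`10` and `11`; the contribution to the Cauchy index is added to the cell `(13, 0, 5)`. -/
def euclidSwap : Program :=
  .seq
    (.cond (isPos (.mul (.load 2 (.const 0) (.reg 10)) (.load 2 (.const 0) (.reg 11))))
      .skip
      (.cond (isPos (.mul (.load 11 (.const 0) (.reg 10)) (.load 12 (.const 0) (.reg 11))))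
        (.setMem 13 (.const 0) (.const 5) (.add (.load 13 (.const 0) (.const 5)) (.const 1)))
        (.setMem 13 (.const 0) (.const 5) (.sub (.load 13 (.const 0) (.const 5)) (.const 1)))))
    (.seq (fill 17 (.const 0) (.reg 5) 5 (.reg 2) (.load 11 (.const 0) (.reg 5)))
      (.seq (fill 11 (.const 0) (.reg 5) 5 (.reg 2)
          (.sub (.const 0) (.load 12 (.const 0) (.reg 5))))
        (.seq (fill 12 (.const 0) (.reg 5) 5 (.reg 2) (.load 17 (.const 0) (.reg 5)))
          (.seq (.setIdx 6 (.reg 10)) (.seq (.setIdx 10 (.reg 11)) (.setIdx 11 (.reg 6)))))))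

/-- Subtract from the polynomial in array `11` a multiple of the one in array `12`. -/
def euclidReduce : Program :=
  .seq (.divMem 13 (.const 0) (.const 2) (.load 11 (.const 0) (.reg 10))
      (.load 12 (.const 0) (.reg 11)))
    (fill 11 (.const 0) (.add (.sub (.reg 10) (.reg 11)) (.reg 5)) 5 (.add (.reg 11) (.const 1))
      (.sub (.load 11 (.const 0) (.add (.sub (.reg 10) (.reg 11)) (.reg 5)))
        (.mul (.load 13 (.const 0) (.const 2)) (.load 12 (.const 0) (.reg 5)))))

/-- One step of the Euclidean algorithm. -/
def euclidStep : Program :=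
  .cond (isZero (.load 11 (.const 0) (.reg 10)))
    (.setIdx 10 (.sub (.reg 10) (.const 1)))
    (.cond (.ile (.reg 11) (.reg 10)) euclidReduce euclidSwap)

/-- The Cauchy index of the polynomials in the arrays `11` and `12`, by Euclid's algorithm. -/
def euclidLoop : Program :=
  .loop (.neg (.conj (.ile (.reg 10) (.const 0)) (isZero (.load 11 (.const 0) (.reg 10)))))
    euclidStep

/-- The invariant of Euclid's algorithm: the Cauchy index sought is `τ`. -/
structure EuclidInv (N : ℕ) (τ : ℝ) (A B : ℝ[X]) (s : State) : Prop where
  size : s.idx 2 = N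
  par : ∀ l < N, s.mem 2 0 l = (-1) ^ l
  holdsA : HoldsPoly s 11 N A
  holdsB : HoldsPoly s 12 N B
  degA : A.natDegree ≤ s.idx 10
  ltA : s.idx 10 < N
  degB : B.natDegree = s.idx 11
  ltB : s.idx 11 < N
  ne : B ≠ 0
  index : s.mem 13 0 5 + cauchyIndex A B = τ

/-- The measure that decreases in each step of Euclid's algorithm. -/
noncomputable def euclidMeasure (s : State) : ℕ :=
  3 * (s.idx 10 + s.idx 11) + (if s.mem 11 0 (s.idx 10) = 0 then 0 else 1)
    + (if s.idx 10 < s.idx 11 then 1 else 0)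

/-- Subtracting a monomial multiple of `B` removes the coefficient of `A` in the recorded degree
and, by `cauchyIndex_add_mul`, keeps the index. -/
theorem reach_euclidReduce {N : ℕ} {τ : ℝ} {A B : ℝ[X]} {s : State} (h : EuclidInv N τ A B s)
    (hA : A.coeff (s.idx 10) ≠ 0) (hle : s.idx 11 ≤ s.idx 10) :
    Reach euclidReduce s (60 * (N + 1)) fun s' =>
      (∃ A' B', EuclidInv N τ A' B' s') ∧ euclidMeasure s' < euclidMeasure s := by
  obtain ⟨size, par, holdsA, holdsB, degA, ltA, degB, ltB, ne, index⟩ := h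
  set a := s.idx 10 with ha
  set b := s.idx 11 with hb
  have hAa : s.mem 11 0 a = A.coeff a := holdsA a ltA
  have hBb : s.mem 12 0 b = B.coeff b := holdsB b ltB
  have hB0 : B.coeff b ≠ 0 := by rw [← degB]; exact leadingCoeff_ne_zero.2 ne
  set q := A.coeff a / B.coeff b with hq
  refine Reach.seq (B₁ := 20) (R := fun s' => s' = s.setMem 13 0 2 q)
    (B₂ := (b + 2) * 37) ?_ ?_ (by nlinarith)
  · refine Reach.divMem ?_ (by decide) ?_
    · simp only [RExp.eval, IExp.eval]; rw [← hb, hBb]; exact hB0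
    · simp only [RExp.eval, IExp.eval]; rw [← ha, ← hb, hAa, hBb]
  · rintro s₁ - rfl
    refine (reach_fill (b + 1) 0 (a - b)
      (fun k => s.mem 11 0 (a - b + k) - q * s.mem 12 0 k) ?_ ?_ ?_).mono le_rfl ?_
    · intro s' hs'
      simp [IExp.eval, hs', ← hb]
    · intro k _
      refine ⟨rfl, ?_, ?_⟩
      · simp [IExp.eval, ← ha, ← hb]
      · simp [RExp.eval, IExp.eval, State.fillRow_mem, State.setMem_mem, ← ha, ← hb]
    · simp [IExp.cost, RExp.cost]
    · rintro s' - rfl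
      have hmem : ∀ l < N, (((s.setMem 13 0 2 q).fillRow 11 0 (a - b) (b + 1)
          (fun k => s.mem 11 0 (a - b + k) - q * s.mem 12 0 k)).setIdx 5 (b + 1)).mem 11 0 l
          = (A + -(C q * X ^ (a - b)) * B).coeff l := by
        intro l hl
        have hcoef : (A + -(C q * X ^ (a - b)) * B).coeff l
            = A.coeff l - q * (if a - b ≤ l then B.coeff (l - (a - b)) else 0) := by
          rw [coeff_add, neg_mul, coeff_neg, mul_assoc, coeff_C_mul, coeff_X_pow_mul']
          ring
        rw [hcoef]
        simp only [State.setIdx_mem, State.fillRow_mem, State.setMem_mem]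
        by_cases h1 : a - b ≤ l
        · by_cases h2 : l < a - b + (b + 1)
          · rw [if_pos ⟨trivial, trivial, h1, h2⟩, if_pos h1, Nat.add_sub_cancel' h1, holdsA l hl,
              holdsB _ (by omega)]
          · rw [if_neg (by omega), if_neg (by omega), if_pos h1, holdsA l hl,
              coeff_eq_zero_of_natDegree_lt (p := B) (by omega)]
            ring
        · rw [if_neg (by omega), if_neg (by omega), if_neg h1, holdsA l hl]; ring
      have hzero : (A + -(C q * X ^ (a - b)) * B).coeff a = 0 := by
        rw [coeff_add, neg_mul, coeff_neg, mul_assoc, coeff_C_mul, coeff_X_pow_mul',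
          if_pos (Nat.sub_le a b), Nat.sub_sub_self hle, hq]
        field_simp; ring
      refine ⟨⟨A + -(C q * X ^ (a - b)) * B, B, ?_, ?_, hmem, ?_, ?_, ?_, ?_, ?_, ne, ?_⟩, ?_⟩
      · simpa using size
      · intro l hl
        simp [State.fillRow_mem, State.setMem_mem, par l hl]
      · intro l hl
        simp [State.fillRow_mem, State.setMem_mem, holdsB l hl]
      · refine natDegree_add_le_of_degree_le (by simpa using degA) ?_
        rw [neg_mul, natDegree_neg, mul_assoc]
        refine (natDegree_C_mul_le _ _).trans (natDegree_mul_le.trans ?_)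
        rw [natDegree_X_pow, degB]
        simp only [State.setIdx_idx, State.fillRow_idx, State.setMem_idx]
        rw [if_neg (by norm_num), ← ha]; omega
      · simpa using ltA
      · simpa using degB
      · simpa using ltB
      · rw [cauchyIndex_add_mul, ← index]
        simp [State.fillRow_mem, State.setMem_mem]
      · have h10 : (((s.setMem 13 0 2 q).fillRow 11 0 (a - b) (b + 1)
          (fun k => s.mem 11 0 (a - b + k) - q * s.mem 12 0 k)).setIdx 5 (b + 1)).idx 10 = a := by
          simp [ha]
        have h11 : (((s.setMem 13 0 2 q).fillRow 11 0 (a - b) (b + 1)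
          (fun k => s.mem 11 0 (a - b + k) - q * s.mem 12 0 k)).setIdx 5 (b + 1)).idx 11 = b := by
          simp [hb]
        -- The degree registers are unchanged, but the cell at the recorded degree is now zero, so
        -- its indicator drops.
        rw [euclidMeasure, euclidMeasure, h10, h11, hmem a ltA, hzero, ← ha, ← hb, hAa,
          if_pos rfl, if_neg hA]
        omega

/-- By `cauchyIndex_swap` the exchange costs the jump of `A * B` at infinity, which is read off from
the parities of the degrees and the leading coefficients. -/
theorem reach_euclidSwap {N : ℕ} {τ : ℝ} {A B : ℝ[X]} {s : State} (h : EuclidInv N τ A B s)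
    (hA : A.coeff (s.idx 10) ≠ 0) (hlt : s.idx 10 < s.idx 11) :
    Reach euclidSwap s (150 * (N + 1)) fun s' =>
      (∃ A' B', EuclidInv N τ A' B' s') ∧ euclidMeasure s' < euclidMeasure s := by
  obtain ⟨size, par, holdsA, holdsB, degA, ltA, degB, ltB, ne, index⟩ := h
  set a := s.idx 10 with ha
  set b := s.idx 11 with hb
  have hAa : s.mem 11 0 a = A.coeff a := holdsA a ltA
  have hBb : s.mem 12 0 b = B.coeff b := holdsB b ltB
  have hB0 : B.coeff b ≠ 0 := by rw [← degB]; exact leadingCoeff_ne_zero.2 ne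
  have hA0 : A ≠ 0 := by rintro rfl; simp at hA
  have hdA : A.natDegree = a := natDegree_eq_of_le_of_coeff_ne_zero degA hA
  have hjump : signJumpInfty (A * B)
      = if 0 < (-1 : ℝ) ^ a * (-1) ^ b then 0 else Real.sign (A.coeff a * B.coeff b) := by
    rw [signJumpInfty, natDegree_mul hA0 ne, hdA, degB, leadingCoeff_mul, leadingCoeff,
      leadingCoeff, hdA, degB, ← pow_add]
    rcases Nat.even_or_odd (a + b) with he | ho
    · rw [if_neg (Nat.not_odd_iff_even.2 he), he.neg_one_pow, if_pos one_pos]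
    · rw [if_pos ho, ho.neg_one_pow, if_neg (by norm_num)]
  refine Reach.seq (B₁ := 50)
    (R := fun s' => s' = s.setMem 13 0 5 (s.mem 13 0 5 + signJumpInfty (A * B)))
    (B₂ := 3 * ((N + 1) * 20) + 6) ?_ ?_ (by omega)
  · have hself : s = s.setMem 13 0 5 (s.mem 13 0 5 + 0) := by
      obtain ⟨idx, mem⟩ := s
      simp only [State.setMem, State.mk.injEq, true_and]
      funext a' i' j'
      split_ifs with hc
      · obtain ⟨rfl, rfl, rfl⟩ := hc; simp
      · rfl
    refine Reach.cond (B' := 30) (fun hp => Reach.skip (by norm_num) ?_) (fun hp => ?_) (by decide)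
    · simp only [isPos_holds, RExp.eval, IExp.eval] at hp
      rw [← ha, ← hb, par a ltA, par b ltB] at hp
      rw [hjump, if_pos hp]; exact hself
    · simp only [isPos_holds, RExp.eval, IExp.eval] at hp
      rw [← ha, ← hb, par a ltA, par b ltB] at hp
      rw [hjump, if_neg hp]
      refine Reach.cond (B' := 12) (fun hs => Reach.setMem (by decide) ?_)
        (fun hs => Reach.setMem (by decide) ?_) (by decide)
      · simp only [isPos_holds, RExp.eval, IExp.eval] at hs
        rw [← ha, ← hb, hAa, hBb] at hs
        rw [Real.sign_of_pos hs]; simp [RExp.eval, IExp.eval]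
      · simp only [isPos_holds, RExp.eval, IExp.eval] at hs
        rw [← ha, ← hb, hAa, hBb] at hs
        rw [Real.sign_of_neg (lt_of_le_of_ne (not_lt.1 hs) (mul_ne_zero hA hB0))]
        simp [RExp.eval, IExp.eval, sub_eq_add_neg]
  rintro s₁ - rfl
  refine Reach.seq (B₁ := (N + 1) * 20) (reach_fill N 0 0 (fun k => s.mem 11 0 k) ?_ ?_ ?_)
    (B₂ := 2 * ((N + 1) * 20) + 6) ?_ (by omega)
  · intro s' hs'; simp [IExp.eval, hs', size]
  · intro k _
    refine ⟨rfl, by simp [IExp.eval], ?_⟩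
    simp [RExp.eval, IExp.eval, State.fillRow_mem, State.setMem_mem]
  · simp [IExp.cost, RExp.cost]
  rintro s₂ - hs₂
  refine Reach.seq (B₁ := (N + 1) * 20) (reach_fill N 0 0 (fun k => - s.mem 12 0 k) ?_ ?_ ?_)
    (B₂ := (N + 1) * 20 + 6) ?_ (by omega)
  · intro s' hs'; simp [IExp.eval, hs', size, hs₂]
  · intro k _
    refine ⟨rfl, by simp [IExp.eval], ?_⟩
    simp [RExp.eval, IExp.eval, State.fillRow_mem, State.setMem_mem, hs₂]
  · simp [IExp.cost, RExp.cost]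
  rintro s₃ - hs₃
  refine Reach.seq (B₁ := (N + 1) * 20) (reach_fill N 0 0 (fun k => s.mem 11 0 k) ?_ ?_ ?_)
    (B₂ := 6) ?_ (by omega)
  · intro s' hs'; simp [IExp.eval, hs', size, hs₂, hs₃]
  · intro k hk
    refine ⟨rfl, by simp [IExp.eval], ?_⟩
    simp [RExp.eval, IExp.eval, State.fillRow_mem, hs₂, hs₃, hk]
  · simp [IExp.cost, RExp.cost]
  rintro s₄ - hs₄
  refine Reach.seq (B₁ := 2) (B₂ := 4)
    (R := fun s' => s' = s₄.setIdx 6 (IExp.eval s₄ (.reg 10))) (Reach.setIdx (by decide) rfl) ?_ le_rfl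
  rintro s₅ - hs₅
  refine Reach.seq (B₁ := 2) (B₂ := 2)
    (R := fun s' => s' = s₅.setIdx 10 (IExp.eval s₅ (.reg 11))) (Reach.setIdx (by decide) rfl) ?_ le_rfl
  rintro s₆ - hs₆
  refine Reach.setIdx (by decide) ?_
  have h10 : (s₆.setIdx 11 (IExp.eval s₆ (.reg 6))).idx 10 = b := by
    simp [hs₆, hs₅, hs₄, hs₃, hs₂, IExp.eval, hb]
  have h11 : (s₆.setIdx 11 (IExp.eval s₆ (.reg 6))).idx 11 = a := by
    simp [hs₆, hs₅, hs₄, hs₃, hs₂, IExp.eval, ha]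
  have hm11 : ∀ l < N, (s₆.setIdx 11 (IExp.eval s₆ (.reg 6))).mem 11 0 l = (-B).coeff l := by
    intro l hl
    simp [hs₆, hs₅, hs₄, hs₃, State.fillRow_mem, hl, holdsB l hl]
  refine ⟨⟨-B, A, ?_, ?_, hm11, ?_, ?_, ?_, ?_, ?_, hA0, ?_⟩, ?_⟩
  · simp [hs₆, hs₅, hs₄, hs₃, hs₂, size]
  · intro l hl
    simp [hs₆, hs₅, hs₄, hs₃, hs₂, State.fillRow_mem, State.setMem_mem, par l hl]
  · intro l hl
    simp [hs₆, hs₅, hs₄, State.fillRow_mem, hl, holdsA l hl]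
  · rw [h10, natDegree_neg, degB]
  · rw [h10]; exact ltB
  · rw [h11, hdA]
  · rw [h11]; exact ltA
  · rw [← index, cauchyIndex_swap hA0 ne]
    simp [hs₆, hs₅, hs₄, hs₃, hs₂, State.fillRow_mem, add_assoc]
  -- The sum of the degrees stays, and the indicator of the wrong order of degrees drops.
  · rw [euclidMeasure, euclidMeasure, h10, h11, hm11 b ltB, ← ha, ← hb, hAa, if_neg hA, if_pos hlt,
      if_neg (by simpa using hB0), if_neg (by omega)]
    omega

/-- The number of steps and the cost of each are linear in `N`. The loop ends when the bound for the
degree of `A` is `0` and its constant term vanishes, that is, with `A = 0`. -/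
theorem reach_euclidLoop {N : ℕ} {τ : ℝ} {A B : ℝ[X]} {s : State} (h : EuclidInv N τ A B s) :
    Reach euclidLoop s (1500 * (N + 1) ^ 2) fun s' => s'.mem 13 0 5 = τ := by
  have hloop := Reach.loop (b := .neg (.conj (.ile (.reg 10) (.const 0))
      (isZero (.load 11 (.const 0) (.reg 10))))) (P := euclidStep) (Bb := 190 * (N + 1))
    (fun s => ∃ A B, EuclidInv N τ A B s) euclidMeasure (by
      rintro s ⟨A, B, h⟩ hb
      refine Reach.cond (B' := 170 * (N + 1)) (fun hz => ?_) (fun hz => ?_)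
        (by simp [isZero, Test.cost, RExp.cost, IExp.cost]; omega)
      · rw [isZero_holds] at hz
        simp only [Test.Holds, isZero_holds, IExp.eval, RExp.eval, not_and] at hb hz
        have hpos : s.idx 10 ≠ 0 := fun h0 => hb h0.le hz
        refine Reach.setIdx (by simp only [IExp.cost]; omega) ?_
        obtain ⟨size, par, holdsA, holdsB, degA, ltA, degB, ltB, ne, index⟩ := h
        have hA0 : A.coeff (s.idx 10) = 0 := by rw [← holdsA _ ltA]; exact hz
        refine ⟨⟨A, B, by simpa using size, by simpa using par, by simpa [HoldsPoly] using holdsA,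
          by simpa [HoldsPoly] using holdsB, ?_, ?_, by simpa using degB, by simpa using ltB, ne,
          by simpa using index⟩, ?_⟩
        · simp only [State.setIdx_idx, IExp.eval, if_true]
          rcases Nat.lt_or_ge A.natDegree (s.idx 10) with h1 | h1
          · omega
          · have : A.natDegree = s.idx 10 := le_antisymm degA h1
            rw [← this] at hA0
            have hA00 : A = 0 := leadingCoeff_eq_zero.1 hA0
            rw [hA00]; simp
        · simp only [State.setIdx_idx, IExp.eval, if_true]; omega
        -- Lowering the degree register saves `3`, while the two indicators can gain at most `2`.
        · simp only [euclidMeasure, State.setIdx_idx, State.setIdx_mem, IExp.eval, if_true]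
          rw [if_neg (show (11 : ℕ) ≠ 10 by norm_num)]
          split_ifs <;> omega
      · rw [isZero_holds] at hz
        simp only [IExp.eval, RExp.eval] at hz
        have hA0 : A.coeff (s.idx 10) ≠ 0 := by rw [← h.holdsA _ h.ltA]; exact hz
        refine Reach.cond (B' := 150 * (N + 1)) (fun hle => ?_) (fun hle => ?_)
          (by simp [Test.cost, IExp.cost]; omega)
        · exact (reach_euclidReduce h hA0 hle).mono (by omega) fun _ _ h => h
        · exact reach_euclidSwap h hA0 (not_le.1 hle))
    (s := s) ⟨A, B, h⟩
  refine hloop.mono ?_ ?_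
  · have hμ : euclidMeasure s + 1 ≤ 6 * (N + 1) := by
      have h1 := h.ltA
      have h2 := h.ltB
      rw [euclidMeasure]; split_ifs <;> omega
    calc _ ≤ (6 * (N + 1)) * (220 * (N + 1)) := by
          refine Nat.mul_le_mul hμ ?_
          simp [isZero, Test.cost, RExp.cost, IExp.cost]; omega
      _ = 1320 * (N + 1) ^ 2 := by ring
      _ ≤ _ := Nat.mul_le_mul_right _ (by norm_num)
  · rintro s' - ⟨⟨A, B, h⟩, hn⟩
    simp only [Test.Holds, isZero_holds, IExp.eval, RExp.eval, not_not] at hn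
    have h0 : s'.idx 10 = 0 := Nat.le_zero.1 hn.1
    have hA : A = 0 := by
      have h1 := h.holdsA _ h.ltA
      have h2 := h.degA
      rw [hn.2] at h1
      rw [h0] at h1 h2
      rw [eq_C_of_natDegree_le_zero h2, ← h1, C_0]
    have := h.index
    rwa [hA, cauchyIndex_zero_left, add_zero] at this

end RealRAM

end

/-! ### Polynomial products and the nonnegativity test on the machine. -/

section

open Finset Polynomial

namespace RealRAM

theorem HoldsPoly.congr {s s' : State} {a N : ℕ} {f : ℝ[X]} (h : HoldsPoly s a N f)
    (hs : s'.mem a = s.mem a) : HoldsPoly s' a N f := fun l hl => by rw [hs]; exact h l hl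

theorem HoldsPoly.mono {s : State} {a N M : ℕ} {f : ℝ[X]} (h : HoldsPoly s a N f) (hM : M ≤ N) :
    HoldsPoly s a M f := fun l hl => h l (hl.trans_le hM)

/-- Register `2` holds `N`, and the arrays `1` and `2` hold the numbers `l` and the signs
`(-1) ^ l` for `l < N + 2`. -/
structure Tables (N : ℕ) (s : State) : Prop where
  size : s.idx 2 = N
  num : ∀ l < N + 2, s.mem 1 0 l = l
  par : ∀ l < N + 2, s.mem 2 0 l = (-1) ^ l

theorem Tables.of_frame {N : ℕ} {P : Program} {s s' : State} (h : Tables N s) (hF : Frame P s s')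
    (h2 : 2 ∉ P.wIdx) (h1 : 1 ∉ P.wMem) (h2' : 2 ∉ P.wMem) : Tables N s' :=
  ⟨by rw [hF.idx 2 h2]; exact h.size, by rw [hF.mem 1 h1]; exact h.num,
    by rw [hF.mem 2 h2']; exact h.par⟩

/-- Multiply the polynomials in the arrays `a` and `b`, writing the product to `c`. -/
def conv (c a b : ℕ) : Program :=
  forUp 5 (.reg 2)
    (.seq (accum 13 (.const 0) (.const 0) 6 (.add (.reg 5) (.const 1))
        (.mul (.load a (.const 0) (.reg 6)) (.load b (.const 0) (.sub (.reg 5) (.reg 6)))))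
      (.setMem c (.const 0) (.reg 5) (.load 13 (.const 0) (.const 0))))

/-- Array `13` serves as scratch space. Only `N` coefficients are produced; callers keep the degree
of the product below `N`. -/
theorem reach_conv {N a b c : ℕ} {f g : ℝ[X]} {s : State} (hN : s.idx 2 = N)
    (hf : HoldsPoly s a N f) (hg : HoldsPoly s b N g) (ha : a ∉ [13, c]) (hb : b ∉ [13, c])
    (hc : c ≠ 13) :
    Reach (conv c a b) s (100 * (N + 1) ^ 2) fun s' => HoldsPoly s' c N (f * g) := by
  refine (Reach.forUp (M := N) (Bb := 60 * (N + 1)) (fun k s' => HoldsPoly s' c k (f * g))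
    (by simp [Program.wIdx, accum, forUp]) ?_ ?_ ?_ ?_).mono le_rfl fun s' _ h => h.2
  · intro s' hF
    exact (hF.idx 2 (by simp [forUp, accum, Program.wIdx])).trans hN
  · intro l hl; omega
  · intro i hi s' hF hi5 hI
    have hwm : (conv c a b).wMem = [13, 13, c] := rfl
    have hf' := hf.congr (hF.mem a (by
      show a ∉ (conv c a b).wMem
      rw [hwm]; simpa using ha))
    have hg' := hg.congr (hF.mem b (by
      show b ∉ (conv c a b).wMem
      rw [hwm]; simpa using hb))
    have ha13 : a ≠ 13 := fun h => by simp [h] at ha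
    have hb13 : b ≠ 13 := fun h => by simp [h] at hb
    refine Reach.seq (B₁ := 50 * (N + 1))
      (reach_accum (i + 1) 0 0 (fun k => f.coeff k * g.coeff (i - k)) ?_ ⟨rfl, rfl⟩ ?_ ?_)
      (B₂ := 10) ?_ (by omega)
    · intro s'' hs''
      exact ⟨rfl, rfl, by simp [IExp.eval, hs'', hi5]⟩
    · intro k hk x
      simp [RExp.eval, IExp.eval, State.setMem_mem, ha13, hb13, hi5, hf' k (by omega),
        hg' (i - k) (by omega)]
    · simp only [IExp.cost, RExp.cost]; nlinarith
    · rintro s₁ - rfl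
      refine Reach.setMem (by decide) ?_
      intro l hl
      simp only [IExp.eval, RExp.eval, State.setIdx_mem, State.setMem_mem, State.setIdx_idx,
        State.setMem_idx]
      rcases Nat.lt_succ_iff_lt_or_eq.1 hl with h | h
      · rw [if_neg (by simp [hi5]; omega), if_neg (by simp [hc])]
        exact hI l h
      · rw [if_pos (by simp [hi5, h]), if_pos (by simp), h, coeff_mul,
          Finset.Nat.sum_antidiagonal_eq_sum_range_succ_mk]
  · simp only [IExp.cost]; nlinarith

/-- The Cauchy index of the polynomial in the array `a` and the derivative of the polynomial in
the array `10`, whose degree is in register `9`. -/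
def euclidRun (a : ℕ) : Program :=
  .seq (fill 12 (.const 0) (.reg 5) 5 (.reg 2)
      (.mul (.load 1 (.const 0) (.add (.reg 5) (.const 1)))
        (.load 10 (.const 0) (.add (.reg 5) (.const 1)))))
    (.seq (fill 11 (.const 0) (.reg 5) 5 (.reg 2) (.load a (.const 0) (.reg 5)))
      (.seq (.setIdx 10 (.sub (.reg 2) (.const 1)))
        (.seq (.setIdx 11 (.sub (.reg 9) (.const 1)))
          (.seq (.setMem 13 (.const 0) (.const 5) (.const 0)) euclidLoop))))

theorem reach_euclidRun {N a : ℕ} {f g : ℝ[X]} {s : State} (hT : Tables N s)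
    (hf : HoldsPoly s 10 (N + 2) f) (hg : HoldsPoly s a N g) (ha : a ∉ [11, 12])
    (hdf : f.natDegree = s.idx 9) (hf0 : f.natDegree ≠ 0) (hfN : f.natDegree < N)
    (hgN : g.natDegree < N) :
    Reach (euclidRun a) s (1600 * (N + 1) ^ 2) fun s' =>
      s'.mem 13 0 5 = cauchyIndex g (derivative f) := by
  have ha11 : a ≠ 11 := fun h => by simp [h] at ha
  have ha12 : a ≠ 12 := fun h => by simp [h] at ha
  have hcost : N + 1 ≤ (N + 1) ^ 2 := Nat.le_self_pow (by norm_num) _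
  have hN := hT.size
  refine Reach.seq (B₁ := 25 * (N + 1)) (B₂ := 1560 * (N + 1) ^ 2)
    (reach_fill N 0 0 (fun k => (derivative f).coeff k) ?_ ?_ ?_) ?_ (by omega)
  · intro s' hs'; simp [IExp.eval, hs', hN]
  · intro k hk
    refine ⟨rfl, by simp [IExp.eval], ?_⟩
    simp [RExp.eval, IExp.eval, State.fillRow_mem, hT.num (k + 1) (by omega),
      hf (k + 1) (by omega), coeff_derivative, mul_comm]
  · simp only [IExp.cost, RExp.cost]; omega
  rintro s₁ - hs₁
  refine Reach.seq (B₁ := 25 * (N + 1)) (B₂ := 1530 * (N + 1) ^ 2)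
    (reach_fill N 0 0 (fun k => g.coeff k) ?_ ?_ ?_) ?_ (by omega)
  · intro s' hs'; simp [IExp.eval, hs', hs₁, hN]
  · intro k hk
    refine ⟨rfl, by simp [IExp.eval], ?_⟩
    simp [RExp.eval, IExp.eval, State.fillRow_mem, hs₁, ha11, ha12, hg k hk]
  · simp only [IExp.cost, RExp.cost]; omega
  rintro s₂ - hs₂
  -- For the numerator Euclid's algorithm needs only an upper bound of the degree; for the
  -- derivative in array `12` it needs the exact degree.
  refine Reach.seq (B₁ := 4) (R := fun s' => s' = s₂.setIdx 10 (N - 1))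
    (B₂ := 1520 * (N + 1) ^ 2) (Reach.setIdx (by decide) ?_) ?_ (by omega)
  · simp [IExp.eval, hs₂, hs₁, hN]
  rintro s₃ - hs₃
  refine Reach.seq (B₁ := 4) (R := fun s' => s' = s₃.setIdx 11 (f.natDegree - 1))
    (B₂ := 1510 * (N + 1) ^ 2) (Reach.setIdx (by decide) ?_) ?_ (by omega)
  · simp [IExp.eval, hs₃, hs₂, hs₁, hdf]
  rintro s₄ - hs₄
  refine Reach.seq (B₁ := 5) (R := fun s' => s' = s₄.setMem 13 0 5 0)
    (B₂ := 1500 * (N + 1) ^ 2) (Reach.setMem (by decide) ?_) ?_ (by omega)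
  · simp [IExp.eval, RExp.eval]
  rintro s₅ - hs₅
  have hdd : (derivative f).natDegree = f.natDegree - 1 := natDegree_derivative f
  refine reach_euclidLoop (A := g) (B := derivative f) ⟨?_, ?_, ?_, ?_, ?_, ?_, ?_, ?_, ?_, ?_⟩
  · simp [hs₅, hs₄, hs₃, hs₂, hs₁, hN]
  · intro l hl
    simp [hs₅, hs₄, hs₃, hs₂, hs₁, State.setMem_mem, State.fillRow_mem, hT.par l (by omega)]
  · intro l hl
    simp [hs₅, hs₄, hs₃, hs₂, State.setMem_mem, State.fillRow_mem, hl]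
  · intro l hl
    simp [hs₅, hs₄, hs₃, hs₂, hs₁, State.setMem_mem, State.fillRow_mem, hl]
  · simp [hs₅, hs₄, hs₃]; omega
  · simp [hs₅, hs₄, hs₃]; omega
  · simp [hs₅, hs₄, hdd]
  · simp [hs₅, hs₄]; omega
  · intro h0
    exact hf0 (derivative_eq_zero.1 h0)
  · simp [hs₅]

/-- Find the degree of the polynomial in the array `10` and write it to register `9`. -/
def findDegree : Program :=
  .seq (.setIdx 9 (.const 0))
    (forUp 5 (.reg 2)
      (.cond (isZero (.load 10 (.const 0) (.reg 5))) .skip (.setIdx 9 (.reg 5))))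

theorem reach_findDegree {N : ℕ} {f : ℝ[X]} {s : State} (hN : s.idx 2 = N)
    (hf : HoldsPoly s 10 N f) (hfN : f.natDegree < N) :
    Reach findDegree s (50 * (N + 1)) fun s' => s'.idx 9 = f.natDegree := by
  refine Reach.seq (B₁ := 2) (R := fun s' => s' = s.setIdx 9 0) (B₂ := 40 * (N + 1))
    (Reach.setIdx (by decide) rfl) ?_ (by omega)
  rintro s₁ - hs₁
  refine (Reach.forUp (M := N) (Bb := 20)
    (fun k s' => (∀ l < k, f.coeff l ≠ 0 → l ≤ s'.idx 9) ∧
      (s'.idx 9 = 0 ∨ f.coeff (s'.idx 9) ≠ 0)) (by decide) ?_ ?_ ?_ ?_).mono le_rfl ?_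
  · intro s' hF
    refine (hF.idx 2 (by decide)).trans ?_
    simp [hs₁, hN]
  · simp [hs₁]
  · rintro i hi s' hF hi5 ⟨h1, h2⟩
    have hF10 := hF.mem 10 (by decide)
    have hmem : s'.mem 10 0 i = f.coeff i := by rw [hF10, hs₁]; exact hf i hi
    refine Reach.cond (B' := 3) (fun hz => Reach.skip (by norm_num) ?_)
      (fun hz => Reach.setIdx (by decide) ?_) (by decide)
    · simp only [isZero_holds, RExp.eval, IExp.eval, hi5, hmem] at hz
      refine ⟨fun l hl hne => ?_, by simpa using h2⟩
      rcases Nat.lt_succ_iff_lt_or_eq.1 hl with h | h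
      · simpa using h1 l h hne
      · rw [h] at hne; exact absurd hz hne
    · simp only [isZero_holds, RExp.eval, IExp.eval, hi5, hmem] at hz
      simp only [IExp.eval, State.setIdx_idx, hi5]
      refine ⟨fun l hl _ => ?_, ?_⟩
      · simp; omega
      · right; simpa using hz
  · simp only [IExp.cost]; omega
  · rintro s' - ⟨-, h1, h2⟩
    by_cases h0 : f = 0
    · rcases h2 with h2 | h2
      · rw [h2, h0, natDegree_zero]
      · simp [h0] at h2
    · have hle : f.natDegree ≤ s'.idx 9 := h1 _ hfN (leadingCoeff_ne_zero.2 h0)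
      rcases h2 with h2 | h2
      · omega
      · exact le_antisymm (le_natDegree_of_ne_zero h2) hle

/-- The comparison of two Cauchy indices that decides whether the nonconstant polynomial in the
array `10`, of even degree and with positive leading coefficient, is nonnegative;
if not, the cell `(18, 0, 0)` is cleared. -/
def indexTest : Program :=
  .seq (fill 14 (.const 0) (.reg 5) 5 (.reg 2)
      (.mul (.load 1 (.const 0) (.add (.reg 5) (.const 1)))
        (.mul (.load 1 (.const 0) (.add (.reg 5) (.const 2)))
          (.load 10 (.const 0) (.add (.reg 5) (.const 2))))))
    (.seq (conv 15 10 14)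
      (.seq (conv 16 10 15)
        (.seq (euclidRun 15)
          (.seq (.setMem 19 (.const 0) (.const 0) (.load 13 (.const 0) (.const 5)))
            (.seq (euclidRun 16)
              (.cond (isZero (.sub (.load 13 (.const 0) (.const 5)) (.load 19 (.const 0) (.const 0))))
                .skip (.setMem 18 (.const 0) (.const 0) (.const 0))))))))

/-- The factor `3` in the degree hypothesis makes room for `f ^ 2 * derivative (derivative f)`, the
largest polynomial that occurs. -/
theorem reach_indexTest {N : ℕ} {f : ℝ[X]} {s : State} (hT : Tables N s)
    (hf : HoldsPoly s 10 (N + 2) f) (hdf : f.natDegree = s.idx 9) (hf0 : f.natDegree ≠ 0)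
    (hfN : 3 * f.natDegree < N) :
    Reach indexTest s (4000 * (N + 1) ^ 2) fun s' =>
      s'.mem 18 0 0 = if cauchyIndex (f * derivative (derivative f)) (derivative f)
        = cauchyIndex (f ^ 2 * derivative (derivative f)) (derivative f)
        then s.mem 18 0 0 else 0 := by
  have hcost : N + 1 ≤ (N + 1) ^ 2 := Nat.le_self_pow (by norm_num) _
  have hd2 : (derivative (derivative f)).natDegree ≤ f.natDegree := by
    have h1 := natDegree_derivative_le f
    have h2 := natDegree_derivative_le (derivative f)
    omega
  have hd3 : (f * derivative (derivative f)).natDegree < N := by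
    have := natDegree_mul_le (p := f) (q := derivative (derivative f)); omega
  have hd4 : (f * (f * derivative (derivative f))).natDegree < N := by
    have := natDegree_mul_le (p := f) (q := derivative (derivative f))
    have := natDegree_mul_le (p := f) (q := f * derivative (derivative f)); omega
  refine Reach.seq (B₁ := 40 * (N + 1)) (B₂ := 3900 * (N + 1) ^ 2)
    (reach_fill N 0 0 (fun k => (derivative (derivative f)).coeff k) ?_ ?_ ?_) ?_ (by omega)
  · intro s' hs'; simp [IExp.eval, hs', hT.size]
  · intro k hk
    refine ⟨rfl, by simp [IExp.eval], ?_⟩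
    rw [coeff_derivative, coeff_derivative]
    simp only [RExp.eval, IExp.eval, State.setIdx_mem, State.setIdx_idx, State.fillRow_mem]
    simp [hT.num (k + 1) (by omega), hT.num (k + 2) (by omega), hf (k + 2) (by omega)]
    ring
  · simp only [IExp.cost, RExp.cost]; omega
  intro s₁ hF₁ hs₁
  have hT₁ := hT.of_frame hF₁ (by decide) (by decide) (by decide)
  have hf₁ := hf.congr (hF₁.mem 10 (by decide))
  have hg₁ : HoldsPoly s₁ 14 N (derivative (derivative f)) := by
    intro l hl; simp [hs₁, State.fillRow_mem, hl]
  refine Reach.seq (B₁ := 100 * (N + 1) ^ 2) (B₂ := 3800 * (N + 1) ^ 2)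
    (reach_conv hT₁.size (hf₁.mono (by omega)) hg₁ (by decide) (by decide) (by decide)) ?_
    (by omega)
  intro s₂ hF₂ hg₂
  have hT₂ := hT₁.of_frame hF₂ (by decide) (by decide) (by decide)
  have hf₂ := hf₁.congr (hF₂.mem 10 (by decide))
  refine Reach.seq (B₁ := 100 * (N + 1) ^ 2) (B₂ := 3700 * (N + 1) ^ 2)
    (reach_conv hT₂.size (hf₂.mono (by omega)) hg₂ (by decide) (by decide) (by decide)) ?_
    (by omega)
  intro s₃ hF₃ hg₃
  have hT₃ := hT₂.of_frame hF₃ (by decide) (by decide) (by decide)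
  have hf₃ := hf₂.congr (hF₃.mem 10 (by decide))
  have hg₃' := hg₂.congr (hF₃.mem 15 (by decide))
  have he₃ : f.natDegree = s₃.idx 9 := by
    rw [hdf, hF₃.idx 9 (by decide), hF₂.idx 9 (by decide), hF₁.idx 9 (by decide)]
  refine Reach.seq (B₁ := 1600 * (N + 1) ^ 2) (B₂ := 2000 * (N + 1) ^ 2)
    (reach_euclidRun hT₃ hf₃ hg₃' (by decide) he₃ hf0 (by omega) hd3) ?_ (by omega)
  intro s₄ hF₄ hi₄
  have hT₄ := hT₃.of_frame hF₄ (by decide) (by decide) (by decide)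
  have hf₄ := hf₃.congr (hF₄.mem 10 (by decide))
  have hg₄ := hg₃.congr (hF₄.mem 16 (by decide))
  refine Reach.seq (B₁ := 7) (R := fun s' => s'.mem 19 0 0 = s₄.mem 13 0 5)
    (B₂ := 1900 * (N + 1) ^ 2) (Reach.setMem (by decide) ?_) ?_ (by omega)
  · simp [IExp.eval, RExp.eval]
  intro s₅ hF₅ hi₅
  have hT₅ := hT₄.of_frame hF₅ (by decide) (by decide) (by decide)
  have hf₅ := hf₄.congr (hF₅.mem 10 (by decide))
  have hg₅ := hg₄.congr (hF₅.mem 16 (by decide))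
  have he₅ : f.natDegree = s₅.idx 9 := by
    rw [he₃, hF₅.idx 9 (by decide), hF₄.idx 9 (by decide)]
  refine Reach.seq (B₁ := 1600 * (N + 1) ^ 2) (B₂ := 100)
    (reach_euclidRun hT₅ hf₅ hg₅ (by decide) he₅ hf0 (by omega) hd4) ?_ (by omega)
  intro s₆ hF₆ hi₆
  have h18 : s₆.mem 18 = s.mem 18 := by
    rw [hF₆.mem 18 (by decide), hF₅.mem 18 (by decide), hF₄.mem 18 (by decide),
      hF₃.mem 18 (by decide), hF₂.mem 18 (by decide), hF₁.mem 18 (by decide)]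
  have h19 : s₆.mem 19 0 0 = cauchyIndex (f * derivative (derivative f)) (derivative f) := by
    rw [hF₆.mem 19 (by decide), hi₅, hi₄]
  rw [show f * (f * derivative (derivative f)) = f ^ 2 * derivative (derivative f) by ring] at hi₆
  refine Reach.cond (B' := 10) (fun hz => Reach.skip (by norm_num) ?_)
    (fun hz => Reach.setMem (by decide) ?_) (by decide)
  · simp only [isZero_holds, RExp.eval, IExp.eval, hi₆, h19, sub_eq_zero] at hz
    rw [if_pos hz.symm, h18]
  · simp only [isZero_holds, RExp.eval, IExp.eval, hi₆, h19, sub_eq_zero] at hz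
    rw [if_neg (fun h => hz h.symm)]
    simp [RExp.eval, IExp.eval]

/-- Clear the cell `(18, 0, 0)` unless the polynomial in the array `10` is nonnegative. -/
def nonnegTest : Program :=
  .seq findDegree
    (.cond (.ile (.reg 9) (.const 0))
      (.cond (.rle (.const 0) (.load 10 (.const 0) (.const 0))) .skip
        (.setMem 18 (.const 0) (.const 0) (.const 0)))
      (.cond (.conj (isPos (.load 10 (.const 0) (.reg 9))) (isPos (.load 2 (.const 0) (.reg 9))))
        indexTest
        (.setMem 18 (.const 0) (.const 0) (.const 0))))

-- Constants, including zero, are tested directly, since the criterion by critical points needs a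
-- nonzero derivative. The parity of the degree is read from the table of signs.
open Classical in
theorem reach_nonnegTest {N : ℕ} {f : ℝ[X]} {s : State} (hT : Tables N s)
    (hf : HoldsPoly s 10 (N + 2) f) (hfN : 3 * f.natDegree < N) :
    Reach nonnegTest s (4200 * (N + 1) ^ 2) fun s' =>
      s'.mem 18 0 0 = if ∀ x, 0 ≤ f.eval x then s.mem 18 0 0 else 0 := by
  have hcost : N + 1 ≤ (N + 1) ^ 2 := Nat.le_self_pow (by norm_num) _
  refine Reach.seq (B₁ := 50 * (N + 1)) (B₂ := 4100 * (N + 1) ^ 2)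
    (reach_findDegree hT.size (hf.mono (by omega)) (by omega)) ?_ (by omega)
  intro s₁ hF₁ hd₁
  have hT₁ := hT.of_frame hF₁ (by decide) (by decide) (by decide)
  have hf₁ := hf.congr (hF₁.mem 10 (by decide))
  have h18 := hF₁.mem 18 (by decide)
  refine Reach.cond (B' := 4050 * (N + 1) ^ 2) (fun h0 => ?_) (fun h0 => ?_)
    (by simp only [Test.cost, IExp.cost]; omega)
  · simp only [Test.Holds, IExp.eval, hd₁, Nat.le_zero] at h0
    have hfC := eq_C_of_natDegree_eq_zero h0
    have hiff : (∀ x, 0 ≤ f.eval x) ↔ 0 ≤ f.coeff 0 := by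
      rw [hfC]; simp
    rw [show (if ∀ x, 0 ≤ f.eval x then s.mem 18 0 0 else 0)
      = if 0 ≤ f.coeff 0 then s.mem 18 0 0 else 0 from if_congr hiff rfl rfl]
    refine Reach.cond (B' := 10) (fun hz => Reach.skip (by norm_num) ?_)
      (fun hz => Reach.setMem (by decide) ?_)
      (by simp only [Test.cost, RExp.cost, IExp.cost]; omega)
    · simp only [Test.Holds, RExp.eval, IExp.eval, hf₁ 0 (by omega), Int.cast_zero] at hz
      rw [if_pos hz, h18]
    · simp only [Test.Holds, RExp.eval, IExp.eval, hf₁ 0 (by omega), Int.cast_zero] at hz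
      rw [if_neg hz]; simp [RExp.eval, IExp.eval]
  · simp only [Test.Holds, IExp.eval, hd₁, Nat.le_zero] at h0
    have hiff := forall_eval_nonneg_iff h0
    have hpar : Even f.natDegree ↔ (0 : ℝ) < (-1) ^ f.natDegree := by
      rcases Nat.even_or_odd f.natDegree with he | ho
      · simp [he]
      · rw [ho.neg_one_pow]
        simp only [Nat.not_even_iff_odd.2 ho]; norm_num
    refine Reach.cond (B' := 4000 * (N + 1) ^ 2) (fun hz => ?_)
      (fun hz => Reach.setMem (by simp only [RExp.cost, IExp.cost]; omega) ?_)
      (by simp only [Test.cost, RExp.cost, IExp.cost, isPos]; omega)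
    · simp only [Test.Holds, isPos_holds, RExp.eval, IExp.eval, hd₁, hf₁ _ (show f.natDegree < N + 2 by omega),
        hT₁.par _ (show f.natDegree < N + 2 by omega), ← hpar] at hz
      refine (reach_indexTest hT₁ hf₁ hd₁.symm h0 hfN).mono le_rfl ?_
      intro s' _ h
      rw [h, h18]
      refine if_congr ?_ rfl rfl
      rw [hiff]
      exact ⟨fun h => ⟨hz.1, hz.2, h⟩, fun h => h.2.2⟩
    · simp only [Test.Holds, isPos_holds, RExp.eval, IExp.eval, hd₁, hf₁ _ (show f.natDegree < N + 2 by omega),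
        hT₁.par _ (show f.natDegree < N + 2 by omega), ← hpar] at hz
      rw [if_neg (fun h => hz ⟨(hiff.1 h).1, (hiff.1 h).2.1⟩)]
      simp [RExp.eval, IExp.eval]

end RealRAM

end

/-! ### Interpolation at `0, …, N - 1` in Newton's form. -/

section

open Finset Polynomial

/-- The Newton polynomial `X (X - 1) ⋯ (X - j + 1) / j!`. -/
noncomputable def newtonPoly : ℕ → ℝ[X]
  | 0 => 1
  | j + 1 => C (1 / ((j + 1 : ℕ) : ℝ)) * ((X - C (j : ℝ)) * newtonPoly j)

theorem natDegree_newtonPoly_le (j : ℕ) : (newtonPoly j).natDegree ≤ j := by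
  induction j with
  | zero => simp [newtonPoly]
  | succ j ih =>
    rw [newtonPoly]
    refine (natDegree_C_mul_le _ _).trans (natDegree_mul_le.trans ?_)
    rw [natDegree_X_sub_C]; omega

theorem eval_newtonPoly (j g : ℕ) : (newtonPoly j).eval (g : ℝ) = g.choose j := by
  induction j with
  | zero => simp [newtonPoly]
  | succ j ih =>
    rw [newtonPoly, eval_C_mul, eval_mul, ih, eval_sub, eval_X, eval_C]
    have h0 : ((j + 1 : ℕ) : ℝ) ≠ 0 := by positivity
    have h := Nat.choose_succ_right_eq g j
    rcases le_or_gt j g with hj | hj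
    · have h' : ((g.choose (j + 1) : ℕ) : ℝ) * ((j + 1 : ℕ) : ℝ) = g.choose j * ((g : ℝ) - j) := by
        rw [← Nat.cast_sub hj]; exact_mod_cast h
      field_simp
      linarith
    · rw [Nat.choose_eq_zero_of_lt hj, Nat.choose_eq_zero_of_lt (by omega)]; simp

/-- The Gregory–Newton formula. It expresses `f` through forward differences at `0` and a basis
independent of `f`, so that each interpolation takes only `O(N ^ 2)` operations once the basis is
tabulated. -/
theorem eq_sum_fwdDiff_mul_newtonPoly {f : ℝ[X]} {N : ℕ} (hf : f.natDegree < N) :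
    f = ∑ j ∈ range N, C ((fwdDiff 1)^[j] (fun i : ℕ => f.eval (i : ℝ)) 0) * newtonPoly j := by
  set r := ∑ j ∈ range N, C ((fwdDiff 1)^[j] (fun i : ℕ => f.eval (i : ℝ)) 0) * newtonPoly j
    with hr
  have hrdeg : r.natDegree < N := by
    refine lt_of_le_of_lt (natDegree_sum_le_of_forall_le (n := N - 1) _ _ fun j hj => ?_) (by omega)
    rw [mem_range] at hj
    exact (natDegree_C_mul_le _ _).trans ((natDegree_newtonPoly_le j).trans (by omega))
  have heval : ∀ g : ℕ, g < N → f.eval (g : ℝ) = r.eval (g : ℝ) := by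
    intro g hg
    have h1 := shift_eq_sum_fwdDiff_iter (1 : ℕ) (fun i : ℕ => f.eval (i : ℝ)) g 0
    simp only [smul_eq_mul, mul_one, zero_add, nsmul_eq_mul] at h1
    rw [h1, hr, eval_finsetSum]
    refine (sum_subset (range_subset_range.2 (show g + 1 ≤ N by omega)) fun j _ hj => ?_).trans
      (sum_congr rfl fun j _ => ?_)
    · rw [mem_range] at hj
      rw [Nat.choose_eq_zero_of_lt (by omega)]; simp
    · rw [eval_C_mul, eval_newtonPoly, mul_comm]
  have hinj : Set.InjOn (fun i : ℕ => (i : ℝ)) (range N : Set ℕ) :=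
    fun _ _ _ _ h => Nat.cast_injective h
  refine Polynomial.eq_of_degrees_lt_of_eval_index_eq (range N) hinj ?_ ?_ fun i hi =>
    heval i (mem_range.1 hi)
  · rw [card_range]
    exact lt_of_le_of_lt degree_le_natDegree (by exact_mod_cast hf)
  · rw [card_range]
    exact lt_of_le_of_lt degree_le_natDegree (by exact_mod_cast hrdeg)

namespace RealRAM

/-- The coefficients of the Newton polynomials are in the array `3`, shifted by one column. -/
structure HoldsNewton (N : ℕ) (s : State) : Prop where
  zero : ∀ j ≤ N, s.mem 3 j 0 = 0
  coeff : ∀ j ≤ N, ∀ l < N + 2, s.mem 3 j (l + 1) = (newtonPoly j).coeff l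

/-- Tabulate the Newton polynomials. -/
def newtonTable : Program :=
  .seq (.setMem 3 (.const 0) (.const 1) (.const 1))
    (forUp 5 (.reg 2)
      (.seq (.divMem 13 (.const 0) (.const 1) (.const 1)
          (.load 1 (.const 0) (.add (.reg 5) (.const 1))))
        (fill 3 (.add (.reg 5) (.const 1)) (.add (.reg 6) (.const 1)) 6 (.add (.reg 2) (.const 2))
          (.mul (.load 13 (.const 0) (.const 1))
            (.sub (.load 3 (.reg 5) (.reg 6))
              (.mul (.load 1 (.const 0) (.reg 5)) (.load 3 (.reg 5) (.add (.reg 6) (.const 1)))))))))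

/-- Each row follows from the previous one by the recursion of `newtonPoly`. Column `0` plays the
role of the coefficient of order `-1`, so that multiplication by `X` needs no special case at the
constant term. -/
theorem reach_newtonTable {N : ℕ} {s : State} (hT : Tables N s) (h3 : ∀ i j, s.mem 3 i j = 0) :
    Reach newtonTable s (200 * (N + 1) ^ 2) (HoldsNewton N) := by
  refine Reach.seq (B₁ := 4) (R := fun s' => s' = s.setMem 3 0 1 1) (B₂ := 180 * (N + 1) ^ 2)
    (Reach.setMem (by decide) (by simp [RExp.eval, IExp.eval])) ?_
    (by have := Nat.one_le_pow 2 (N + 1) (by omega); omega)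
  intro s₁ hF₁ hs₁
  have hT₁ := hT.of_frame hF₁ (by decide) (by decide) (by decide)
  refine (Reach.forUp (M := N) (Bb := 130 * (N + 1))
    (fun k s' => (∀ j, s'.mem 3 j 0 = 0) ∧
      ∀ j ≤ k, ∀ l < N + 2, s'.mem 3 j (l + 1) = (newtonPoly j).coeff l)
    (by decide) ?_ ?_ ?_ ?_).mono le_rfl ?_
  · intro s' hF
    exact (hF.idx 2 (by decide)).trans hT₁.size
  · refine ⟨fun j => by simp [hs₁, State.setMem_mem, h3], fun j hj l _ => ?_⟩
    obtain rfl : j = 0 := by omega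
    simp only [hs₁, State.setIdx_mem, State.setMem_mem, h3, newtonPoly, coeff_one]
    simp
  · rintro i hi s' hF hi5 ⟨hz, hc⟩
    have hT' := hT₁.of_frame hF (by decide) (by decide) (by decide)
    have hnum := hT'.num (i + 1) (by omega)
    have hnum' := hT'.num i (by omega)
    refine Reach.seq (B₁ := 10) (R := fun s'' => s'' = s'.setMem 13 0 1 (1 / ((i + 1 : ℕ) : ℝ)))
      (B₂ := 120 * (N + 1)) (Reach.divMem ?_ (by decide) ?_) ?_ (by omega)
    · simp only [RExp.eval, IExp.eval, hi5, hnum]; positivity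
    · simp [RExp.eval, IExp.eval, hi5, hnum]
    rintro s₂ - hs₂
    refine (reach_fill (N + 2) (i + 1) 1 (fun k => (newtonPoly (i + 1)).coeff k) ?_ ?_ ?_).mono
      le_rfl ?_
    · intro s'' h''; simp [IExp.eval, h'', hs₂, hT'.size]
    · intro k hk
      refine ⟨by simp [IExp.eval, hs₂, hi5], by simp [IExp.eval]; omega, ?_⟩
      have h1 : s'.mem 3 i k = (X * newtonPoly i).coeff k := by
        rcases k with _ | k
        · simp [hz]
        · rw [hc i le_rfl k (by omega), coeff_X_mul]
      have h2 := hc i le_rfl k hk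
      rw [newtonPoly, coeff_C_mul, sub_mul, coeff_sub, coeff_C_mul]
      simp [RExp.eval, IExp.eval, State.fillRow_mem, State.setMem_mem, hs₂, hi5, h1, h2, hnum']
    · simp only [IExp.cost, RExp.cost]; omega
    · rintro s₃ - rfl
      refine ⟨fun j => ?_, fun j hj l hl => ?_⟩
      · simp [State.fillRow_mem, State.setMem_mem, hs₂, hz]
      · rcases Nat.lt_or_ge j (i + 1) with h | h
        · simp [State.fillRow_mem, State.setMem_mem, hs₂, hc j (by omega) l hl, h.ne]
        · obtain rfl : j = i + 1 := by omega
          simp only [State.setIdx_mem, State.fillRow_mem]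
          rw [if_pos (by simp; omega), Nat.add_sub_cancel]
  · simp only [IExp.cost]; nlinarith
  · rintro s' - ⟨-, h1, h2⟩
    exact ⟨fun j _ => h1 j, h2⟩

/-- Interpolate the values in row `k` of the array `8`, where `k` is the content of register `4`,
at `0, …, N - 1` by a polynomial in the array `10`. -/
def interpolate : Program :=
  .seq (fill 9 (.const 0) (.reg 5) 5 (.reg 2) (.load 8 (.reg 4) (.reg 5)))
    (.seq
      (forUp 5 (.reg 2)
        (fill 9 (.add (.reg 5) (.const 1)) (.reg 6) 6 (.sub (.reg 2) (.add (.reg 5) (.const 1)))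
          (.sub (.load 9 (.reg 5) (.add (.reg 6) (.const 1))) (.load 9 (.reg 5) (.reg 6)))))
      (forUp 5 (.add (.reg 2) (.const 2))
        (.seq (accum 13 (.const 0) (.const 0) 6 (.reg 2)
            (.mul (.load 9 (.reg 6) (.const 0)) (.load 3 (.reg 6) (.add (.reg 5) (.const 1)))))
          (.setMem 10 (.const 0) (.reg 5) (.load 13 (.const 0) (.const 0))))))

theorem reach_interpolate {N : ℕ} {f : ℝ[X]} {s : State} (hN : s.idx 2 = N)
    (hB : HoldsNewton N s) (hf : f.natDegree < N)
    (hV : ∀ i < N, s.mem 8 (s.idx 4) i = f.eval (i : ℝ)) :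
    Reach interpolate s (300 * (N + 1) ^ 2) fun s' => HoldsPoly s' 10 (N + 2) f := by
  have hcost : N + 1 ≤ (N + 1) ^ 2 := Nat.le_self_pow (by norm_num) _
  set v : ℕ → ℝ := fun i => f.eval (i : ℝ) with hv
  refine Reach.seq (B₁ := 30 * (N + 1)) (B₂ := 265 * (N + 1) ^ 2)
    (reach_fill N 0 0 v ?_ ?_ ?_) ?_ (by omega)
  · intro s' hs'; simp [IExp.eval, hs', hN]
  · intro k hk
    refine ⟨rfl, by simp [IExp.eval], ?_⟩
    simp [RExp.eval, IExp.eval, State.fillRow_mem, hV k hk, hv]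
  · simp only [IExp.cost, RExp.cost]; omega
  intro s₁ hF₁ hs₁
  have hN₁ : s₁.idx 2 = N := by rw [hF₁.idx 2 (by decide), hN]
  refine Reach.seq (B₁ := 60 * (N + 1) ^ 2) (B₂ := 200 * (N + 1) ^ 2)
    (Reach.forUp (M := N) (Bb := 40 * (N + 1))
      (fun k s' => ∀ j ≤ k, ∀ i, i + j < N → s'.mem 9 j i = (fwdDiff 1)^[j] v i)
      (by decide) ?_ ?_ ?_ ?_) ?_ (by omega)
  · intro s' hF
    exact (hF.idx 2 (by decide)).trans hN₁
  · intro j hj i hi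
    obtain rfl : j = 0 := by omega
    simp [hs₁, State.fillRow_mem, show i < N by omega]
  · intro k hk s' hF hk5 hI
    have hN' : s'.idx 2 = N := (hF.idx 2 (by decide)).trans hN₁
    refine (reach_fill (N - (k + 1)) (k + 1) 0 (fun i => (fwdDiff 1)^[k + 1] v i) ?_ ?_ ?_).mono
      le_rfl ?_
    · intro s'' h''; simp [IExp.eval, h'', hN', hk5]
    · intro i hi
      refine ⟨by simp [IExp.eval, hk5], by simp [IExp.eval], ?_⟩
      rw [Function.iterate_succ_apply', fwdDiff, ← hI k le_rfl _ (by omega),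
        ← hI k le_rfl _ (by omega)]
      simp [RExp.eval, IExp.eval, State.fillRow_mem, hk5]
    · simp only [IExp.cost, RExp.cost]
      exact le_trans (Nat.mul_le_mul (show N - (k + 1) + 1 ≤ N + 1 by omega)
        (show _ ≤ 40 by norm_num)) (by omega)
    · rintro s₃ - rfl j hj i hi
      rcases Nat.lt_or_ge j (k + 1) with h | h
      · simp [State.fillRow_mem, hI j (by omega) i hi, h.ne]
      · obtain rfl : j = k + 1 := by omega
        simp only [State.setIdx_mem, State.fillRow_mem]
        rw [if_pos (by simp; omega), Nat.sub_zero]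
  · simp only [IExp.cost]; nlinarith
  rintro s₂ hF₂ ⟨-, hD⟩
  have hN₂ : s₂.idx 2 = N := by rw [hF₂.idx 2 (by decide), hN₁]
  have hB₂ : s₂.mem 3 = s.mem 3 := by rw [hF₂.mem 3 (by decide), hF₁.mem 3 (by decide)]
  -- Two zero coefficients beyond the degree are written as well, since the second derivative is
  -- formed by reading two cells ahead.
  refine (Reach.forUp (M := N + 2) (Bb := 50 * (N + 1))
    (fun k s' => HoldsPoly s' 10 k f) (by decide) ?_ ?_ ?_ ?_).mono le_rfl fun s' _ h => h.2
  · intro s' hF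
    have := (hF.idx 2 (by decide)).trans hN₂
    simp [IExp.eval, this]
  · intro l hl; omega
  · intro k hk s' hF hk5 hI
    have hN' : s'.idx 2 = N := (hF.idx 2 (by decide)).trans hN₂
    have h9 := hF.mem 9 (by decide)
    have h3 := (hF.mem 3 (by decide)).trans hB₂
    refine Reach.seq (B₁ := 40 * (N + 1))
      (reach_accum N 0 0 (fun j => (fwdDiff 1)^[j] v 0 * (newtonPoly j).coeff k) ?_ ⟨rfl, rfl⟩ ?_ ?_)
      (B₂ := 10) ?_ (by omega)
    · intro s'' hs''
      exact ⟨rfl, rfl, by simp [IExp.eval, hs'', hN']⟩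
    · intro j hj x
      simp [RExp.eval, IExp.eval, State.setMem_mem, hk5, h9, h3, hD j (by omega) 0 (by omega),
        hB.coeff j (by omega) k hk]
    · simp only [IExp.cost, RExp.cost]; omega
    · rintro s₁ - rfl
      refine Reach.setMem (by decide) ?_
      intro l hl
      simp only [IExp.eval, RExp.eval, State.setIdx_mem, State.setMem_mem, State.setIdx_idx,
        State.setMem_idx]
      rcases Nat.lt_succ_iff_lt_or_eq.1 hl with h | h
      · rw [if_neg (by simp [hk5]; omega), if_neg (by simp)]
        exact hI l h
      · rw [if_pos (by simp [hk5, h]), if_pos (by simp), h]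
        conv_rhs => rw [eq_sum_fwdDiff_mul_newtonPoly hf, finsetSum_coeff]
        simp only [coeff_C_mul]
        rfl
  · simp only [IExp.cost]
    calc _ ≤ (3 * (N + 1)) * (63 * (N + 1)) := Nat.mul_le_mul (by omega) (by omega)
      _ = 189 * (N + 1) ^ 2 := by ring
      _ ≤ _ := Nat.mul_le_mul_right _ (by norm_num)

/-- Clear the cell `(18, 0, 0)` unless the polynomials interpolating the rows
`1, …, d` of the array `8` are nonnegative; the number `d` is in register `1`. -/
def nonnegLoop : Program :=
  forUp 3 (.reg 1) (.seq (.setIdx 4 (.add (.reg 3) (.const 1))) (.seq interpolate nonnegTest))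

-- The minor of order `0` is left out because it is `1`. Each of the `d` tests is quadratic in `N`,
-- which is one of the two contributions of order `n ^ 5`.
open Classical in
theorem reach_nonnegLoop {N d : ℕ} {f : ℕ → ℝ[X]} {s : State} (hT : Tables N s) (hd : s.idx 1 = d)
    (hB : HoldsNewton N s) (hf : ∀ k ≤ d, 3 * (f k).natDegree < N)
    (hV : ∀ k ≤ d, ∀ i < N, s.mem 8 k i = (f k).eval (i : ℝ)) :
    Reach nonnegLoop s (4600 * ((d + 1) * (N + 1) ^ 2)) fun s' =>
      s'.mem 18 0 0 = if ∀ k < d, ∀ x, 0 ≤ (f (k + 1)).eval x then s.mem 18 0 0 else 0 := by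
  have hcost : 1 ≤ (N + 1) ^ 2 := Nat.one_le_pow _ _ (by omega)
  refine (Reach.forUp (M := d) (Bb := 4550 * (N + 1) ^ 2)
    (fun m s' => s'.mem 18 0 0
      = if ∀ k < m, ∀ x, 0 ≤ (f (k + 1)).eval x then s.mem 18 0 0 else 0)
    (by decide) ?_ ?_ ?_ ?_).mono le_rfl fun s' _ h => h.2
  · intro s' hF
    exact (hF.idx 1 (by decide)).trans hd
  · simp
  · intro m hm s' hF hm3 hI
    have hT' := hT.of_frame hF (by decide) (by decide) (by decide)
    refine Reach.seq (B₁ := 4) (R := fun s'' => s'' = s'.setIdx 4 (m + 1))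
      (B₂ := 4540 * (N + 1) ^ 2) (Reach.setIdx (by decide) (by simp [IExp.eval, hm3])) ?_ (by omega)
    intro s₁ hF₁ hs₁
    have hT₁ := hT'.of_frame hF₁ (by decide) (by decide) (by decide)
    have hB₁ : HoldsNewton N s₁ := by
      have h3 : s₁.mem 3 = s.mem 3 := (hF₁.mem 3 (by decide)).trans (hF.mem 3 (by decide))
      exact ⟨by rw [h3]; exact hB.zero, by rw [h3]; exact hB.coeff⟩
    have hV₁ : ∀ i < N, s₁.mem 8 (s₁.idx 4) i = (f (m + 1)).eval (i : ℝ) := by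
      intro i hi
      rw [hF₁.mem 8 (by decide), hF.mem 8 (by decide), ← hV (m + 1) (by omega) i hi, hs₁]
      simp
    have hdeg := hf (m + 1) (by omega)
    refine Reach.seq (B₁ := 300 * (N + 1) ^ 2) (B₂ := 4200 * (N + 1) ^ 2)
      (reach_interpolate hT₁.size hB₁ (by omega) hV₁) ?_ (by omega)
    intro s₂ hF₂ hf₂
    have hT₂ := hT₁.of_frame hF₂ (by decide) (by decide) (by decide)
    refine (reach_nonnegTest hT₂ hf₂ hdeg).mono le_rfl ?_
    intro s₃ _ h
    have h18 : s₂.mem 18 = s'.mem 18 := (hF₂.mem 18 (by decide)).trans (hF₁.mem 18 (by decide))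
    rw [State.setIdx_mem, h, h18, hI]
    have hiff : (∀ k < m + 1, ∀ x, 0 ≤ (f (k + 1)).eval x)
        ↔ (∀ x, 0 ≤ (f (m + 1)).eval x) ∧ ∀ k < m, ∀ x, 0 ≤ (f (k + 1)).eval x := by
      constructor
      · intro h; exact ⟨h m (by omega), fun k hk => h k (by omega)⟩
      · rintro ⟨h1, h2⟩ k hk
        rcases Nat.lt_succ_iff_lt_or_eq.1 hk with h | h
        · exact h2 k h
        · rw [h]; exact h1
    by_cases h1 : ∀ x, 0 ≤ (f (m + 1)).eval x
    · rw [if_pos h1]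
      exact if_congr (by rw [hiff]; exact ⟨fun h => ⟨h1, h⟩, fun h => h.2⟩) rfl rfl
    · rw [if_neg h1, if_neg fun h => h1 (hiff.1 h).1]
  · simp only [IExp.cost]
    calc _ ≤ (d + 1) * (4600 * (N + 1) ^ 2) := Nat.mul_le_mul_left _ (by omega)
      _ = _ := by ring

end RealRAM

end

/-! ### Elimination on the machine. -/

section

open Finset Polynomial

namespace RealRAM

open Classical in
/-- The number `x` if `p` holds, and zero otherwise. -/
noncomputable def keepIf (p : Prop) (x : ℝ) : ℝ := if p then x else 0

theorem keepIf_pos {p : Prop} (h : p) (x : ℝ) : keepIf p x = x := if_pos h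

theorem keepIf_neg {p : Prop} (h : ¬ p) (x : ℝ) : keepIf p x = 0 := if_neg h

theorem keepIf_congr {p q : Prop} (h : p ↔ q) (x : ℝ) : keepIf p x = keepIf q x := by rw [propext h]

/-- A loop each pass of which clears the cell `(18, 0, 0)` unless a condition is met. -/
theorem Reach.forUp_flag {r : ℕ} {m : IExp} {body : Program} {s : State} {M Bb B : ℕ}
    (p : ℕ → Prop) (hr : r ∉ body.wIdx)
    (hm : ∀ s', Frame (RealRAM.forUp r m body) s s' → m.eval s' = M)
    (hb : ∀ i < M, ∀ s', Frame (RealRAM.forUp r m body) s s' → s'.idx r = i →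
      Reach body s' Bb fun s'' => s''.mem 18 0 0 = keepIf (p i) (s'.mem 18 0 0))
    (hB : (M + 1) * (Bb + m.cost + 10) ≤ B) :
    Reach (RealRAM.forUp r m body) s B fun s' =>
      s'.mem 18 0 0 = keepIf (∀ i < M, p i) (s.mem 18 0 0) := by
  refine (Reach.forUp (M := M) (Bb := Bb)
    (fun k s' => s'.mem 18 0 0 = keepIf (∀ i < k, p i) (s.mem 18 0 0))
    hr hm (by simp [keepIf]) ?_ hB).mono le_rfl fun s' _ h => h.2
  intro k hk s' hF hk' hI
  refine (hb k hk s' hF hk').mono le_rfl fun s'' _ h => ?_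
  rw [State.setIdx_mem, h, hI]
  by_cases h1 : p k
  · rw [keepIf_pos h1]
    refine keepIf_congr ⟨fun h i hi => ?_, fun h i hi => h i (by omega)⟩ _
    rcases Nat.lt_succ_iff_lt_or_eq.1 hi with h' | h'
    · exact h i h'
    · rw [h']; exact h1
  · rw [keepIf_neg h1, keepIf_neg fun h => h1 (h k (by omega))]

/-- Subtract multiples of row `k` of the array `7` from the rows below it, where `k` is the content
of register `4`. -/
def eliminate : Program :=
  forUp 5 (.sub (.reg 1) (.add (.reg 4) (.const 1)))
    (.seq (.divMem 13 (.const 0) (.const 2)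
        (.load 7 (.add (.add (.reg 4) (.const 1)) (.reg 5)) (.reg 4)) (.load 7 (.reg 4) (.reg 4)))
      (fill 7 (.add (.add (.reg 4) (.const 1)) (.reg 5)) (.add (.add (.reg 4) (.const 1)) (.reg 6)) 6
        (.sub (.reg 1) (.add (.reg 4) (.const 1)))
        (.sub (.load 7 (.add (.add (.reg 4) (.const 1)) (.reg 5))
            (.add (.add (.reg 4) (.const 1)) (.reg 6)))
          (.mul (.load 13 (.const 0) (.const 2))
            (.load 7 (.reg 4) (.add (.add (.reg 4) (.const 1)) (.reg 6)))))))

/-- Only the block below and to the right of the pivot is updated. The pivot column keeps its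
entries, which supply the multipliers, since later steps look at the remaining block only. -/
theorem reach_eliminate {d k : ℕ} {s : State} (hd : s.idx 1 = d) (hk : s.idx 4 = k) (hkd : k < d)
    (hp : s.mem 7 k k ≠ 0) :
    Reach eliminate s (100 * (d + 1) ^ 2) fun s' =>
      ∀ i j, k < i → i < d → k < j → j < d →
        s'.mem 7 i j = s.mem 7 i j - s.mem 7 i k / s.mem 7 k k * s.mem 7 k j := by
  refine (Reach.forUp (M := d - (k + 1)) (Bb := 80 * (d + 1))
    (fun m s' => (∀ i j, k < i → i < k + 1 + m → k < j → j < d →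
        s'.mem 7 i j = s.mem 7 i j - s.mem 7 i k / s.mem 7 k k * s.mem 7 k j) ∧
      ∀ i j, (i ≤ k ∨ k + 1 + m ≤ i ∨ j ≤ k) → s'.mem 7 i j = s.mem 7 i j)
    (by decide) ?_ ?_ ?_ ?_).mono le_rfl ?_
  · intro s' hF
    simp [IExp.eval, hF.idx 1 (by decide), hF.idx 4 (by decide), hd, hk]
  · exact ⟨fun i j h1 h2 => by omega, fun _ _ _ => rfl⟩
  · rintro m hm s' hF hm5 ⟨h1, h2⟩
    have hd' : s'.idx 1 = d := (hF.idx 1 (by decide)).trans hd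
    have hk' : s'.idx 4 = k := (hF.idx 4 (by decide)).trans hk
    have hkk := h2 k k (by omega)
    have hik := h2 (k + 1 + m) k (by omega)
    refine Reach.seq (B₁ := 20)
      (R := fun s'' => s'' = s'.setMem 13 0 2 (s.mem 7 (k + 1 + m) k / s.mem 7 k k))
      (B₂ := 60 * (d + 1)) (Reach.divMem ?_ (by decide) ?_) ?_ (by omega)
    · simpa only [RExp.eval, IExp.eval, hk', hkk] using hp
    · simp only [RExp.eval, IExp.eval, hk', hkk, hm5, hik]
    rintro s₁ - hs₁
    refine (reach_fill (d - (k + 1)) (k + 1 + m) (k + 1) (fun j => s.mem 7 (k + 1 + m) (k + 1 + j)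
      - s.mem 7 (k + 1 + m) k / s.mem 7 k k * s.mem 7 k (k + 1 + j)) ?_ ?_ ?_).mono le_rfl ?_
    · intro s'' h''; simp [IExp.eval, h'', hs₁, hd', hk']
    · intro j hj
      refine ⟨by simp [IExp.eval, hs₁, hm5, hk'], by simp [IExp.eval, hs₁, hk'], ?_⟩
      have e1 := h2 (k + 1 + m) (k + 1 + j) (by omega)
      have e2 := h2 k (k + 1 + j) (by omega)
      simp only [RExp.eval, IExp.eval, State.fillRow_mem, hs₁, State.setIdx_mem, State.setIdx_idx,
        State.setMem_mem, State.fillRow_idx, State.setMem_idx, hm5, hk']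
      simp [e1, e2, show k ≠ k + 1 + m by omega]
    · simp only [IExp.cost, RExp.cost]
      exact le_trans (Nat.mul_le_mul (show d - (k + 1) + 1 ≤ d + 1 by omega)
        (show _ ≤ 60 by norm_num)) (by omega)
    · rintro s₂ - hs₂
      have hmem : ∀ i j, s₂.mem 7 i j = if i = k + 1 + m ∧ k + 1 ≤ j ∧ j < d then
          s.mem 7 i j - s.mem 7 i k / s.mem 7 k k * s.mem 7 k j else s'.mem 7 i j := by
        intro i j
        simp only [hs₂, State.setIdx_mem, State.fillRow_mem, hs₁, State.setMem_mem]
        by_cases hc : i = k + 1 + m ∧ k + 1 ≤ j ∧ j < d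
        · rw [if_pos (by simp; omega), if_pos hc, hc.1, Nat.add_sub_cancel' hc.2.1]
        · rw [if_neg (by simp; omega), if_neg hc, if_neg (by simp)]
      refine ⟨fun i j g1 g2 g3 g4 => ?_, fun i j hij => ?_⟩
      · rw [State.setIdx_mem, hmem]
        split_ifs with hc
        · rfl
        · exact h1 i j g1 (by omega) g3 g4
      · rw [State.setIdx_mem, hmem, if_neg (by omega)]
        exact h2 i j (by omega)
  · simp only [IExp.cost]
    calc _ ≤ (d + 1) * (100 * (d + 1)) := Nat.mul_le_mul (by omega) (by omega)
      _ = _ := by ring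
  · rintro s' - ⟨-, h1, -⟩ i j g1 g2 g3 g4
    exact h1 i j g1 (by omega) g3 g4

/-- Clear the cell `(18, 0, 0)` unless the array `7` is zero from row and column `k` on,
where `k` is the content of register `4`. -/
def zeroTest : Program :=
  forUp 5 (.sub (.reg 1) (.reg 4))
    (forUp 6 (.sub (.reg 1) (.reg 4))
      (.cond (isZero (.load 7 (.add (.reg 4) (.reg 5)) (.add (.reg 4) (.reg 6)))) .skip
        (.setMem 18 (.const 0) (.const 0) (.const 0))))

theorem reach_zeroTest {d k : ℕ} {s : State} (hd : s.idx 1 = d) (hk : s.idx 4 = k) :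
    Reach zeroTest s (100 * (d + 1) ^ 2) fun s' =>
      s'.mem 18 0 0 = keepIf (∀ i j, k ≤ i → i < d → k ≤ j → j < d → s.mem 7 i j = 0)
        (s.mem 18 0 0) := by
  refine (Reach.forUp_flag (M := d - k) (Bb := 80 * (d + 1))
    (fun i => ∀ j < d - k, s.mem 7 (k + i) (k + j) = 0) (by decide) ?_ ?_ ?_).mono le_rfl ?_
  · intro s' hF
    simp [IExp.eval, hF.idx 1 (by decide), hF.idx 4 (by decide), hd, hk]
  · intro i hi s' hF hi5
    have h7 := hF.mem 7 (by decide)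
    have hd' : s'.idx 1 = d := (hF.idx 1 (by decide)).trans hd
    have hk' : s'.idx 4 = k := (hF.idx 4 (by decide)).trans hk
    have h8 := Reach.forUp_flag (r := 6) (m := .sub (.reg 1) (.reg 4))
      (body := .cond (isZero (.load 7 (.add (.reg 4) (.reg 5)) (.add (.reg 4) (.reg 6)))) .skip
        (.setMem 18 (.const 0) (.const 0) (.const 0))) (s := s') (M := d - k) (Bb := 40)
      (B := 80 * (d + 1)) (fun j => s.mem 7 (k + i) (k + j) = 0) (by decide) ?_ ?_ ?_
    · exact h8
    · intro s'' hF
      simp [IExp.eval, hF.idx 1 (by decide), hF.idx 4 (by decide), hd', hk']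
    · intro j hj s'' hF hj6
      have h7' := (hF.mem 7 (by decide)).trans h7
      have hk'' : s''.idx 4 = k := (hF.idx 4 (by decide)).trans hk'
      have hi5' : s''.idx 5 = i := (hF.idx 5 (by decide)).trans hi5
      refine Reach.cond (B' := 10) (fun hz => Reach.skip (by norm_num) ?_)
        (fun hz => Reach.setMem (by decide) ?_) (by decide)
      · simp only [isZero_holds, RExp.eval, IExp.eval, h7', hk'', hi5', hj6] at hz
        rw [keepIf_pos hz]
      · simp only [isZero_holds, RExp.eval, IExp.eval, h7', hk'', hi5', hj6] at hz
        rw [keepIf_neg hz]; simp [RExp.eval, IExp.eval]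
    · simp only [IExp.cost]
      calc _ ≤ (d + 1) * 80 := Nat.mul_le_mul (by omega) (by omega)
        _ = _ := by ring
  · simp only [IExp.cost]
    calc _ ≤ (d + 1) * (100 * (d + 1)) := Nat.mul_le_mul (by omega) (by omega)
      _ = _ := by ring
  · intro s' _ h
    rw [h]
    refine keepIf_congr ⟨fun h i j h1 h2 h3 h4 => ?_, fun h i hi j hj => ?_⟩ _
    · have := h (i - k) (by omega) (j - k) (by omega)
      rwa [Nat.add_sub_cancel' h1, Nat.add_sub_cancel' h3] at this
    · exact h _ _ (by omega) (by omega) (by omega) (by omega)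

/-- Eliminate in the matrix in the array `7`, writing the leading minors to the column of
the array `8` given by register `3`, and clear the cell `(18, 0, 0)` if the pivots are not regular. -/
def pivotLoop : Program :=
  .seq (.setMem 8 (.const 0) (.reg 3) (.const 1))
    (forUp 4 (.reg 1)
      (.seq (.setMem 8 (.add (.reg 4) (.const 1)) (.reg 3)
          (.mul (.load 8 (.reg 4) (.reg 3)) (.load 7 (.reg 4) (.reg 4))))
        (.cond (isPos (.load 7 (.reg 4) (.reg 4))) eliminate zeroTest)))

/-- The running product of the pivots gives the leading minors. The contents of the arrays matter
only while the pivots are regular; after a failure the flag is cleared for good, and any values may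
be left behind. -/
theorem reach_pivotLoop {d g : ℕ} {M : ℕ → ℕ → ℝ} {s : State} (hd : s.idx 1 = d)
    (hg : s.idx 3 = g) (hM : ∀ i < d, ∀ j < d, s.mem 7 i j = M i j) :
    Reach pivotLoop s (200 * (d + 1) ^ 3) fun s' =>
      s'.mem 18 0 0 = keepIf (RegularPivots M d) (s.mem 18 0 0) ∧
      (RegularPivots M d → ∀ k ≤ d, s'.mem 8 k g = leadingMinor M k) ∧
      ∀ k h, h ≠ g → s'.mem 8 k h = s.mem 8 k h := by
  set Q : ℕ → Prop := fun k => 0 < schur M k k k ∨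
    ∀ i j, k ≤ i → i < d → k ≤ j → j < d → schur M k i j = 0 with hQ
  have hcost : 1 ≤ (d + 1) ^ 2 := Nat.one_le_pow _ _ (by omega)
  refine Reach.seq (B₁ := 5) (R := fun s' => s' = s.setMem 8 0 g 1) (B₂ := 160 * (d + 1) ^ 3)
    (Reach.setMem (by decide) (by simp [RExp.eval, IExp.eval, hg])) ?_
    (by have := Nat.one_le_pow 3 (d + 1) (by omega); omega)
  intro s₁ hF₁ hs₁
  have hd₁ : s₁.idx 1 = d := (hF₁.idx 1 (by decide)).trans hd
  have hg₁ : s₁.idx 3 = g := (hF₁.idx 3 (by decide)).trans hg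
  refine (Reach.forUp (M := d) (Bb := 140 * (d + 1) ^ 2)
    (fun k s' => s'.mem 18 0 0 = keepIf (∀ l < k, Q l) (s.mem 18 0 0) ∧
      ((∀ l < k, Q l) → (∀ i j, k ≤ i → i < d → k ≤ j → j < d → s'.mem 7 i j = schur M k i j) ∧
        ∀ m ≤ k, s'.mem 8 m g = ∏ l ∈ range m, schur M l l l) ∧
      ∀ m h, h ≠ g → s'.mem 8 m h = s.mem 8 m h)
    (by decide) ?_ ?_ ?_ ?_).mono le_rfl ?_
  · intro s' hF
    exact (hF.idx 1 (by decide)).trans hd₁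
  · refine ⟨?_, fun _ => ⟨fun i j _ hi _ hj => ?_, fun m hm => ?_⟩, fun m h hh => ?_⟩
    · simp [hs₁, State.setMem_mem, keepIf]
    · simp [hs₁, State.setMem_mem, hM i hi j hj, schur]
    · obtain rfl : m = 0 := by omega
      simp [hs₁]
    · simp [hs₁, State.setMem_mem, hh]
  · rintro k hk s' hF hk4 ⟨hflag, hreg, hcol⟩
    have hd' : s'.idx 1 = d := (hF.idx 1 (by decide)).trans hd₁
    have hg' : s'.idx 3 = g := (hF.idx 3 (by decide)).trans hg₁
    refine Reach.seq (B₁ := 15)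
      (R := fun s'' => s'' = s'.setMem 8 (k + 1) g (s'.mem 8 k g * s'.mem 7 k k))
      (B₂ := 120 * (d + 1) ^ 2) (Reach.setMem (by decide)
        (by simp [RExp.eval, IExp.eval, hg', hk4])) ?_ (by omega)
    intro s₂ hF₂ hs₂
    have hd₂ : s₂.idx 1 = d := (hF₂.idx 1 (by decide)).trans hd'
    have hk₂ : s₂.idx 4 = k := (hF₂.idx 4 (by decide)).trans hk4
    have h7 : s₂.mem 7 = s'.mem 7 := hF₂.mem 7 (by decide)
    have h18 : s₂.mem 18 = s'.mem 18 := hF₂.mem 18 (by decide)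
    have hcol₂ : ∀ m h, h ≠ g → s₂.mem 8 m h = s.mem 8 m h := by
      intro m h hh
      rw [hs₂, State.setMem_mem, if_neg (by tauto), hcol m h hh]
    have hprod₂ : (∀ l < k, Q l) → ∀ m ≤ k + 1, s₂.mem 8 m g = ∏ l ∈ range m, schur M l l l := by
      intro hq m hm
      obtain ⟨e1, e2⟩ := hreg hq
      rw [hs₂, State.setMem_mem]
      rcases Nat.lt_or_ge m (k + 1) with h | h
      · rw [if_neg (by omega), e2 m (by omega)]
      · obtain rfl : m = k + 1 := by omega
        rw [if_pos ⟨rfl, rfl, rfl⟩, e2 k le_rfl, e1 k k le_rfl hk le_rfl hk, prod_range_succ]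
    have hsucc : (∀ l < k + 1, Q l) ↔ (∀ l < k, Q l) ∧ Q k := by
      refine ⟨fun h => ⟨fun l hl => h l (by omega), h k (by omega)⟩, fun h l hl => ?_⟩
      rcases Nat.lt_succ_iff_lt_or_eq.1 hl with h' | h'
      · exact h.1 l h'
      · rw [h']; exact h.2
    refine Reach.cond (B' := 100 * (d + 1) ^ 2) (fun hz => ?_) (fun hz => ?_)
      (by simp only [isPos, Test.cost, RExp.cost, IExp.cost]; omega)
    · simp only [isPos_holds, RExp.eval, IExp.eval, hk₂] at hz
      refine (reach_eliminate hd₂ hk₂ hk hz.ne').mono le_rfl ?_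
      intro s₃ hF₃ hel
      rw [State.setIdx_mem, hF₃.mem 18 (by decide), hF₃.mem 8 (by decide), h18]
      have hQk : (∀ l < k, Q l) → Q k := by
        intro hq
        left
        rw [← (hreg hq).1 k k le_rfl hk le_rfl hk, ← h7]; exact hz
      refine ⟨?_, fun hq => ⟨fun i j g1 g2 g3 g4 => ?_, hprod₂ fun l hl => hq l (by omega)⟩, hcol₂⟩
      · rw [hflag]
        exact keepIf_congr (by rw [hsucc]; exact ⟨fun h => ⟨h, hQk h⟩, fun h => h.1⟩) _
      · have e1 := (hreg fun l hl => hq l (by omega)).1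
        rw [hel i j (by omega) g2 (by omega) g4, h7, e1 i j (by omega) g2 (by omega) g4,
          e1 i k (by omega) g2 le_rfl hk, e1 k k le_rfl hk le_rfl hk, e1 k j le_rfl hk (by omega) g4,
          schur]
    · simp only [isPos_holds, RExp.eval, IExp.eval, hk₂] at hz
      refine (reach_zeroTest hd₂ hk₂).mono le_rfl ?_
      intro s₃ hF₃ hel
      rw [State.setIdx_mem, hF₃.mem 8 (by decide), hF₃.mem 7 (by decide), hel, h18, h7]
      have hQk : (∀ l < k, Q l) →
          (Q k ↔ ∀ i j, k ≤ i → i < d → k ≤ j → j < d → s'.mem 7 i j = 0) := by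
        intro hq
        have e1 := (hreg hq).1
        constructor
        · rintro (h | h)
          · rw [← e1 k k le_rfl hk le_rfl hk, ← h7] at h; exact absurd h hz
          · intro i j g1 g2 g3 g4
            rw [e1 i j g1 g2 g3 g4, h i j g1 g2 g3 g4]
        · intro h
          right
          intro i j g1 g2 g3 g4
          rw [← e1 i j g1 g2 g3 g4, h i j g1 g2 g3 g4]
      refine ⟨?_, fun hq => ⟨fun i j g1 g2 g3 g4 => ?_, hprod₂ fun l hl => hq l (by omega)⟩, hcol₂⟩
      · rw [hflag]
        by_cases h1 : ∀ l < k, Q l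
        · rw [keepIf_pos h1]
          exact keepIf_congr (by rw [hsucc, hQk h1]; exact ⟨fun h => ⟨h1, h⟩, fun h => h.2⟩) _
        · rw [keepIf_neg h1, keepIf_neg fun h => h1 (hsucc.1 h).1, keepIf, ite_self]
      -- Once the remaining block is zero, its next Schur complement is zero too, so the unchanged
      -- array is correct.
      · have hq' : ∀ l < k, Q l := fun l hl => hq l (by omega)
        have e1 := (hreg hq').1
        have e0 := (hQk hq').1 (hq k (by omega))
        have hz' : ∀ i j, k ≤ i → i < d → k ≤ j → j < d → schur M k i j = 0 := by
          intro i j g1 g2 g3 g4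
          rw [← e1 i j g1 g2 g3 g4, e0 i j g1 g2 g3 g4]
        rw [e0 i j (by omega) g2 (by omega) g4, schur, hz' i j (by omega) g2 (by omega) g4,
          hz' k j le_rfl hk (by omega) g4]
        ring
  · simp only [IExp.cost]
    calc _ ≤ (d + 1) * (160 * (d + 1) ^ 2) := Nat.mul_le_mul_left _ (by omega)
      _ = _ := by ring
  · rintro s' - ⟨-, hflag, hreg, hcol⟩
    refine ⟨hflag, fun hr k hk => ?_, hcol⟩
    rw [(hreg hr).2 k hk, (hr.nonsingularPivots.mono hk).leadingMinor_eq_prod]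

end RealRAM

end

/-! ### The treatment of a sample point: Horner's scheme, power sums, Hankel matrix. -/

section

open Finset Polynomial

/-- The polynomial `p (γ + t, t)` by Horner's scheme in the first variable, after `m` steps. -/
noncomputable def hornerPoly (P : ℕ → ℕ → ℝ) (n : ℕ) (γ : ℝ) : ℕ → ℝ[X]
  | 0 => 0
  | m + 1 => (X + C γ) * hornerPoly P n γ m + ∑ j ∈ range (n + 1), C (P (n - m) j) * X ^ j

/-- The invariant: the current polynomial times the outstanding power of `X + C γ`, plus the rows
not yet read, is the full sum. -/
theorem hornerPoly_eq_diagPoly (P : ℕ → ℕ → ℝ) (n : ℕ) (γ : ℝ) :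
    hornerPoly P n γ (n + 1) = diagPoly P n γ := by
  have h : ∀ m ≤ n + 1, hornerPoly P n γ m * (X + C γ) ^ (n + 1 - m)
      + ∑ i ∈ range (n + 1 - m), (∑ j ∈ range (n + 1), C (P i j) * X ^ j) * (X + C γ) ^ i
      = diagPoly P n γ := by
    intro m
    induction m with
    | zero =>
      intro _
      rw [hornerPoly, zero_mul, zero_add, diagPoly]
      refine sum_congr rfl fun i _ => ?_
      rw [sum_mul]
      refine sum_congr rfl fun j _ => ?_
      rw [Algebra.algebraMap_self, RingHom.id_apply]; ring
    | succ m ih =>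
      intro hm
      rw [← ih (by omega), show n + 1 - m = (n + 1 - (m + 1)) + 1 by omega, sum_range_succ,
        hornerPoly, show n + 1 - (m + 1) = n - m by omega]
      ring
  have := h (n + 1) le_rfl
  simpa using this

theorem coeff_hornerPoly_succ {P : ℕ → ℕ → ℝ} {n : ℕ} (hP : ∀ i j, n < i ∨ n < j → P i j = 0)
    (γ : ℝ) (m l : ℕ) : (hornerPoly P n γ (m + 1)).coeff l
      = γ * (hornerPoly P n γ m).coeff l + (X * hornerPoly P n γ m).coeff l + P (n - m) l := by
  rw [hornerPoly, coeff_add, add_mul, coeff_add, coeff_C_mul, finsetSum_coeff]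
  have : ∑ j ∈ range (n + 1), (C (P (n - m) j) * X ^ j : ℝ[X]).coeff l = P (n - m) l := by
    simp only [coeff_C_mul, coeff_X_pow, mul_ite, mul_one, mul_zero]
    rw [sum_ite_eq]
    split_ifs with h
    · rfl
    · rw [mem_range] at h
      exact (hP _ _ (Or.inr (by omega))).symm
  rw [this]; ring

namespace RealRAM

/-- Horner's scheme for the sample point whose number is in register `3`. -/
def horner : Program :=
  forUp 5 (.add (.reg 0) (.const 1))
    (fill 4 (.add (.reg 5) (.const 1)) (.add (.reg 6) (.const 1)) 6 (.add (.reg 1) (.const 1))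
      (.add (.add (.mul (.load 1 (.const 0) (.reg 3))
            (.load 4 (.reg 5) (.add (.reg 6) (.const 1))))
          (.load 4 (.reg 5) (.reg 6)))
        (.load 0 (.sub (.reg 0) (.reg 5)) (.reg 6))))

/-- Each coefficient depends on those of the same and the preceding order in the previous row, so
the truncation after order `d` is harmless. Column `0` again stands for the order `-1`. -/
theorem reach_horner {P : ℕ → ℕ → ℝ} {n d D g : ℕ} {s : State} (hn : s.idx 0 = n)
    (hd : s.idx 1 = d) (hg : s.idx 3 = g) (hnum : s.mem 1 0 g = g)
    (hP : ∀ i j, n < i ∨ n < j → P i j = 0) (h0 : ∀ i j, s.mem 0 i j = P i j)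
    (hrow : ∀ j, s.mem 4 0 j = 0) (hcol : ∀ i, s.mem 4 i 0 = 0) (hnD : n ≤ D) (hdD : d ≤ D) :
    Reach horner s (260 * (D + 1) ^ 2) fun s' =>
      (∀ l ≤ d, s'.mem 4 (n + 1) (l + 1) = (diagPoly P n (g : ℝ)).coeff l) ∧
      (∀ j, s'.mem 4 0 j = 0) ∧ ∀ i, s'.mem 4 i 0 = 0 := by
  refine (Reach.forUp (M := n + 1) (Bb := 100 * (D + 1))
    (fun m s' => (∀ l ≤ d, s'.mem 4 m (l + 1) = (hornerPoly P n g m).coeff l) ∧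
      (∀ j, s'.mem 4 0 j = 0) ∧ ∀ i, s'.mem 4 i 0 = 0)
    (by decide) ?_ ?_ ?_ ?_).mono le_rfl ?_
  · intro s' hF
    simp [IExp.eval, hF.idx 0 (by decide), hn]
  · exact ⟨fun l _ => by simp [hrow, hornerPoly], by simpa using hrow, by simpa using hcol⟩
  · rintro m hm s' hF hm5 ⟨h1, h2, h3⟩
    have hn' : s'.idx 0 = n := (hF.idx 0 (by decide)).trans hn
    have hd' : s'.idx 1 = d := (hF.idx 1 (by decide)).trans hd
    have hg' : s'.idx 3 = g := (hF.idx 3 (by decide)).trans hg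
    have hm0 := hF.mem 0 (by decide)
    have hm1 := hF.mem 1 (by decide)
    refine (reach_fill (d + 1) (m + 1) 1 (fun l => (hornerPoly P n g (m + 1)).coeff l)
      ?_ ?_ ?_).mono le_rfl ?_
    · intro s'' h''; simp [IExp.eval, h'', hd']
    · intro l hl
      refine ⟨by simp [IExp.eval, hm5], by simp [IExp.eval]; omega, ?_⟩
      have e1 : s'.mem 4 m l = (X * hornerPoly P n g m).coeff l := by
        rcases l with _ | l
        · simp [h3]
        · rw [h1 l (by omega), coeff_X_mul]
      rw [coeff_hornerPoly_succ hP]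
      simp [RExp.eval, IExp.eval, State.fillRow_mem, hm5, hg', hn', hm0, hm1, hnum, h0, e1,
        h1 l (by omega)]
    · simp only [IExp.cost, RExp.cost]; omega
    · rintro s₁ - rfl
      refine ⟨fun l hl => ?_, fun j => ?_, fun i => ?_⟩
      · simp only [State.setIdx_mem, State.fillRow_mem]
        rw [if_pos (by simp; omega), Nat.add_sub_cancel]
      · simp [State.fillRow_mem, h2]
      · simp [State.fillRow_mem, h3]
  · simp only [IExp.cost]
    calc _ ≤ (2 * (D + 1)) * (120 * (D + 1)) := Nat.mul_le_mul (by omega) (by omega)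
      _ = 240 * (D + 1) ^ 2 := by ring
      _ ≤ _ := Nat.mul_le_mul_right _ (by norm_num)
  · rintro s' - ⟨-, h1, h2⟩
    rw [hornerPoly_eq_diagPoly] at h1
    exact ⟨h1, h2⟩

/-- Newton's identities: from the coefficients in the array `5` to the power sums in the
array `6`. -/
def powerSums : Program :=
  .seq (.setMem 6 (.const 0) (.const 0) (.load 1 (.const 0) (.reg 1)))
    (forUp 5 (.add (.reg 1) (.reg 1))
      (.seq (accum 13 (.const 0) (.const 0) 6 (.reg 5)
          (.mul (.load 5 (.const 0) (.add (.reg 6) (.const 1)))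
            (.load 6 (.const 0) (.sub (.reg 5) (.reg 6)))))
        (.setMem 6 (.const 0) (.add (.reg 5) (.const 1))
          (.sub (.sub (.const 0) (.load 13 (.const 0) (.const 0)))
            (.mul (.load 1 (.const 0) (.add (.reg 5) (.const 1)))
              (.load 5 (.const 0) (.add (.reg 5) (.const 1))))))))

/-- Newton's identities up to order `2 * d` read coefficients beyond `d`; the zeros in these cells
of array `5` are part of the data. -/
theorem reach_powerSums {a : ℕ → ℝ} {d : ℕ} {s : State} (hd : s.idx 1 = d)
    (hnum : ∀ l ≤ 2 * d, s.mem 1 0 l = l) (ha : ∀ k, s.mem 5 0 k = a k) :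
    Reach powerSums s (400 * (d + 1) ^ 2) fun s' =>
      ∀ k ≤ 2 * d, s'.mem 6 0 k = newtonSum d a k := by
  have hcost : 1 ≤ (d + 1) ^ 2 := Nat.one_le_pow _ _ (by omega)
  refine Reach.seq (B₁ := 6) (R := fun s' => s' = s.setMem 6 0 0 d) (B₂ := 350 * (d + 1) ^ 2)
    (Reach.setMem (by decide) ?_) ?_ (by omega)
  · simp [RExp.eval, IExp.eval, hd, hnum d (by omega)]
  intro s₁ hF₁ hs₁
  have hd₁ : s₁.idx 1 = d := (hF₁.idx 1 (by decide)).trans hd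
  refine (Reach.forUp (M := 2 * d) (Bb := 120 * (d + 1))
    (fun m s' => ∀ k ≤ m, s'.mem 6 0 k = newtonSum d a k) (by decide) ?_ ?_ ?_ ?_).mono le_rfl
    fun s' _ h => h.2
  · intro s' hF
    simp [IExp.eval, hF.idx 1 (by decide), hd₁]; omega
  · intro k hk
    obtain rfl : k = 0 := by omega
    simp [hs₁, newtonSum_zero]
  · intro m hm s' hF hm5 hI
    have h1 : s'.mem 1 = s.mem 1 := (hF.mem 1 (by decide)).trans (hF₁.mem 1 (by decide))
    have h5 : s'.mem 5 = s.mem 5 := (hF.mem 5 (by decide)).trans (hF₁.mem 5 (by decide))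
    refine Reach.seq (B₁ := 80 * (d + 1)) (reach_accum m 0 0
      (fun i => a (i + 1) * newtonSum d a (m - i)) ?_ ⟨rfl, rfl⟩ ?_ ?_) (B₂ := 30) ?_ (by omega)
    · intro s'' hs''
      exact ⟨rfl, rfl, by simp [IExp.eval, hs'', hm5]⟩
    · intro k hk x
      simp [RExp.eval, IExp.eval, State.setMem_mem, hm5, h5, ha, hI (m - k) (by omega)]
    · simp only [IExp.cost, RExp.cost]; omega
    · rintro s₂ - hs₂
      refine Reach.setMem (by decide) ?_
      intro k hk
      simp only [State.setIdx_mem, State.setMem_mem]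
      rcases Nat.lt_or_ge k (m + 1) with h | h
      · rw [if_neg (by simp [IExp.eval, hs₂, hm5]; omega), hs₂]
        simpa [State.setMem_mem] using hI k (by omega)
      · obtain rfl : k = m + 1 := by omega
        rw [if_pos (by simp [IExp.eval, hs₂, hm5]), newtonSum_succ]
        simp [RExp.eval, IExp.eval, hs₂, hm5, State.setMem_mem, h1, h5, ha, hnum (m + 1) (by omega)]
        ring
  · simp only [IExp.cost]
    calc _ ≤ (2 * (d + 1)) * (140 * (d + 1)) := Nat.mul_le_mul (by omega) (by omega)
      _ = 280 * (d + 1) ^ 2 := by ring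
      _ ≤ _ := Nat.mul_le_mul_right _ (by norm_num)

/-- The Hankel matrix of the power sums. -/
def hankel : Program :=
  forUp 5 (.reg 1) (fill 7 (.reg 5) (.reg 6) 6 (.reg 1) (.load 6 (.const 0) (.add (.reg 5) (.reg 6))))

theorem reach_hankel {v : ℕ → ℝ} {d : ℕ} {s : State} (hd : s.idx 1 = d)
    (hv : ∀ k ≤ 2 * d, s.mem 6 0 k = v k) :
    Reach hankel s (60 * (d + 1) ^ 2) fun s' => ∀ i < d, ∀ j < d, s'.mem 7 i j = v (i + j) := by
  refine (Reach.forUp (M := d) (Bb := 30 * (d + 1))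
    (fun m s' => ∀ i < m, ∀ j < d, s'.mem 7 i j = v (i + j)) (by decide) ?_ ?_ ?_ ?_).mono le_rfl
    fun s' _ h => h.2
  · intro s' hF
    exact (hF.idx 1 (by decide)).trans hd
  · intro i hi; omega
  · intro m hm s' hF hm5 hI
    have hd' : s'.idx 1 = d := (hF.idx 1 (by decide)).trans hd
    have h6 := hF.mem 6 (by decide)
    refine (reach_fill d m 0 (fun j => v (m + j)) ?_ ?_ ?_).mono le_rfl ?_
    · intro s'' h''; simp [IExp.eval, h'', hd']
    · intro j hj
      refine ⟨by simp [IExp.eval, hm5], by simp [IExp.eval], ?_⟩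
      simp [RExp.eval, IExp.eval, State.fillRow_mem, hm5, h6, hv (m + j) (by omega)]
    · simp only [IExp.cost, RExp.cost]; omega
    · rintro s₁ - rfl i hi j hj
      simp only [State.setIdx_mem, State.fillRow_mem]
      rcases Nat.lt_or_ge i m with h | h
      · rw [if_neg (by simp; omega), hI i h j hj]
      · obtain rfl : i = m := by omega
        rw [if_pos (by simp; omega), Nat.sub_zero]
  · simp only [IExp.cost]
    calc _ ≤ (d + 1) * (60 * (d + 1)) := Nat.mul_le_mul (by omega) (by omega)
      _ = _ := by ring

/-- The data on which the treatment of a sample point relies. -/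
structure SampleData (P : ℕ → ℕ → ℝ) (n d N : ℕ) (s : State) : Prop where
  deg : s.idx 0 = n
  totalDeg : s.idx 1 = d
  tables : Tables N s
  coeff : ∀ i j, s.mem 0 i j = P i j
  inv : s.mem 20 0 1 = (∑ i ∈ range (d + 1), P i (d - i))⁻¹
  row : ∀ j, s.mem 4 0 j = 0
  col : ∀ i, s.mem 4 i 0 = 0
  tail : ∀ k, d < k → s.mem 5 0 k = 0

/-- The matrix of power sums at the sample point `γ`. -/
noncomputable def hermiteMatrix (P : ℕ → ℕ → ℝ) (n d : ℕ) (γ : ℝ) (i j : ℕ) : ℝ :=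
  newtonSum d (fun l => (diagCoeff P n d l).eval γ) (i + j)

/-- The treatment of a sample point. -/
def samplePass : Program :=
  .seq horner
    (.seq (fill 5 (.const 0) (.reg 5) 5 (.add (.reg 1) (.const 1))
        (.mul (.load 4 (.add (.reg 0) (.const 1)) (.add (.sub (.reg 1) (.reg 5)) (.const 1)))
          (.load 20 (.const 0) (.const 1))))
      (.seq powerSums (.seq hankel pivotLoop)))

/-- The elimination dominates the cost, the other stages being quadratic. `SampleData` is restored
so that the pass can be repeated for the next sample. -/
theorem reach_samplePass {P : ℕ → ℕ → ℝ} {n d N D g : ℕ} {s : State}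
    (hP : ∀ i j, n < i ∨ n < j → P i j = 0) (hs : SampleData P n d N s) (hnD : n ≤ D) (hdD : d ≤ D)
    (hdN : 2 * d < N + 2) (hg : s.idx 3 = g) (hgN : g < N) :
    Reach samplePass s (1000 * (D + 1) ^ 3) fun s' => SampleData P n d N s' ∧
      s'.mem 18 0 0 = keepIf (RegularPivots (hermiteMatrix P n d g) d) (s.mem 18 0 0) ∧
      (RegularPivots (hermiteMatrix P n d g) d →
        ∀ k ≤ d, s'.mem 8 k g = leadingMinor (hermiteMatrix P n d g) k) ∧
      ∀ k h, h ≠ g → s'.mem 8 k h = s.mem 8 k h := by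
  have hc1 : (D + 1) ^ 2 ≤ (D + 1) ^ 3 := Nat.pow_le_pow_right (by omega) (by norm_num)
  have hc2 : D + 1 ≤ (D + 1) ^ 3 := Nat.le_self_pow (by norm_num) _
  have hc3 : (d + 1) ^ 2 ≤ (D + 1) ^ 2 := Nat.pow_le_pow_left (by omega) _
  have hc4 : (d + 1) ^ 3 ≤ (D + 1) ^ 3 := Nat.pow_le_pow_left (by omega) _
  obtain ⟨deg, totalDeg, tables, coeff, inv, row, col, tail⟩ := hs
  refine Reach.seq (B₁ := 260 * (D + 1) ^ 2) (B₂ := 735 * (D + 1) ^ 3)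
    (reach_horner deg totalDeg hg (tables.num g (by omega)) hP coeff row col hnD hdD) ?_ (by omega)
  rintro s₁ hF₁ ⟨hW, hrow, hcol⟩
  refine Reach.seq (B₁ := 60 * (D + 1)) (B₂ := 660 * (D + 1) ^ 3)
    (reach_fill (d + 1) 0 0 (fun k => (diagCoeff P n d k).eval (g : ℝ)) ?_ ?_ ?_) ?_ (by omega)
  · intro s' hs'; simp [IExp.eval, hs', hF₁.idx 1 (by decide), totalDeg]
  · intro k hk
    refine ⟨rfl, by simp [IExp.eval], ?_⟩
    rw [eval_diagCoeff, if_pos (by omega), div_eq_mul_inv, ← inv, ← hW (d - k) (by omega)]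
    simp [RExp.eval, IExp.eval, State.fillRow_mem, hF₁.idx 0 (by decide), hF₁.idx 1 (by decide),
      hF₁.mem 20 (by decide), deg, totalDeg]
  · simp only [IExp.cost, RExp.cost]; omega
  intro s₂ hF₂ hs₂
  have ha : ∀ k, s₂.mem 5 0 k = (diagCoeff P n d k).eval (g : ℝ) := by
    intro k
    simp only [hs₂, State.setIdx_mem, State.fillRow_mem]
    by_cases hk : k ≤ d
    · rw [if_pos (by simp; omega), Nat.sub_zero]
    · rw [if_neg (by simp; omega), hF₁.mem 5 (by decide), tail k (by omega), eval_diagCoeff,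
        if_neg hk]
  have hT₂ : Tables N s₂ := (tables.of_frame hF₁ (by decide) (by decide) (by decide)).of_frame hF₂
    (by decide) (by decide) (by decide)
  have hd₂ : s₂.idx 1 = d := by rw [hF₂.idx 1 (by decide), hF₁.idx 1 (by decide), totalDeg]
  refine Reach.seq (B₁ := 400 * (d + 1) ^ 2) (B₂ := 260 * (D + 1) ^ 3)
    (reach_powerSums hd₂ (fun l hl => hT₂.num l (by omega)) ha) ?_ (by omega)
  intro s₃ hF₃ hs₃
  have hd₃ : s₃.idx 1 = d := by rw [hF₃.idx 1 (by decide), hd₂]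
  refine Reach.seq (B₁ := 60 * (d + 1) ^ 2) (B₂ := 200 * (D + 1) ^ 3)
    (reach_hankel hd₃ hs₃) ?_ (by omega)
  intro s₄ hF₄ hs₄
  have hd₄ : s₄.idx 1 = d := by rw [hF₄.idx 1 (by decide), hd₃]
  have hg₄ : s₄.idx 3 = g := by
    rw [hF₄.idx 3 (by decide), hF₃.idx 3 (by decide), hF₂.idx 3 (by decide), hF₁.idx 3 (by decide),
      hg]
  have h18 : s₄.mem 18 = s.mem 18 := by
    rw [hF₄.mem 18 (by decide), hF₃.mem 18 (by decide), hF₂.mem 18 (by decide),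
      hF₁.mem 18 (by decide)]
  have h8 : s₄.mem 8 = s.mem 8 := by
    rw [hF₄.mem 8 (by decide), hF₃.mem 8 (by decide), hF₂.mem 8 (by decide),
      hF₁.mem 8 (by decide)]
  refine (reach_pivotLoop (M := hermiteMatrix P n d g) hd₄ hg₄ hs₄).mono (by omega) ?_
  rintro s₅ hF₅ ⟨hflag, hV, hV'⟩
  rw [h18] at hflag
  rw [h8] at hV'
  refine ⟨⟨?_, ?_, ?_, ?_, ?_, ?_, ?_, ?_⟩, hflag, hV, hV'⟩
  · rw [hF₅.idx 0 (by decide), hF₄.idx 0 (by decide), hF₃.idx 0 (by decide), hF₂.idx 0 (by decide),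
      hF₁.idx 0 (by decide), deg]
  · rw [hF₅.idx 1 (by decide), hd₄]
  · exact ((hT₂.of_frame hF₃ (by decide) (by decide) (by decide)).of_frame hF₄ (by decide)
      (by decide) (by decide)).of_frame hF₅ (by decide) (by decide) (by decide)
  · rw [hF₅.mem 0 (by decide), hF₄.mem 0 (by decide), hF₃.mem 0 (by decide), hF₂.mem 0 (by decide),
      hF₁.mem 0 (by decide)]
    exact coeff
  · rw [hF₅.mem 20 (by decide), hF₄.mem 20 (by decide), hF₃.mem 20 (by decide),
      hF₂.mem 20 (by decide), hF₁.mem 20 (by decide), inv]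
  · rw [hF₅.mem 4 (by decide), hF₄.mem 4 (by decide), hF₃.mem 4 (by decide), hF₂.mem 4 (by decide)]
    exact hrow
  · rw [hF₅.mem 4 (by decide), hF₄.mem 4 (by decide), hF₃.mem 4 (by decide), hF₂.mem 4 (by decide)]
    exact hcol
  · intro k hk
    rw [hF₅.mem 5 (by decide), hF₄.mem 5 (by decide), hF₃.mem 5 (by decide), ha, eval_diagCoeff,
      if_neg (by omega)]

/-- The treatment of all sample points. -/
def sampleLoop : Program := forUp 3 (.reg 2) samplePass

/-- A cubic elimination at each of `O(n ^ 2)` samples is the other contribution of order `n ^ 5`. -/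
theorem reach_sampleLoop {P : ℕ → ℕ → ℝ} {n d N D : ℕ} {s : State}
    (hP : ∀ i j, n < i ∨ n < j → P i j = 0) (hs : SampleData P n d N s) (hnD : n ≤ D) (hdD : d ≤ D)
    (hdN : 2 * d < N + 2) :
    Reach sampleLoop s (1100 * ((N + 1) * (D + 1) ^ 3)) fun s' =>
      s'.mem 18 0 0 = keepIf (∀ g < N, RegularPivots (hermiteMatrix P n d g) d) (s.mem 18 0 0) ∧
      ((∀ g < N, RegularPivots (hermiteMatrix P n d g) d) →
        ∀ k ≤ d, ∀ g < N, s'.mem 8 k g = leadingMinor (hermiteMatrix P n d g) k) := by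
  have hcost : 1 ≤ (D + 1) ^ 3 := Nat.one_le_pow _ _ (by omega)
  refine (Reach.forUp (M := N) (Bb := 1000 * (D + 1) ^ 3)
    (fun m s' => SampleData P n d N s' ∧
      s'.mem 18 0 0 = keepIf (∀ g < m, RegularPivots (hermiteMatrix P n d g) d) (s.mem 18 0 0) ∧
      ((∀ g < m, RegularPivots (hermiteMatrix P n d g) d) →
        ∀ k ≤ d, ∀ g < m, s'.mem 8 k g = leadingMinor (hermiteMatrix P n d g) k))
    (by decide) ?_ ?_ ?_ ?_).mono le_rfl ?_
  · intro s' hF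
    exact (hF.idx 2 (by decide)).trans hs.tables.size
  · refine ⟨?_, by simp [keepIf], fun _ k _ g hg => by omega⟩
    obtain ⟨h1, h2, ⟨h3, h4, h5⟩, h6, h7, h8, h9, h10⟩ := hs
    exact ⟨by simpa using h1, by simpa using h2, ⟨by simpa using h3, h4, h5⟩, h6, h7, h8, h9, h10⟩
  · rintro m hm s' hF hm3 ⟨hs', hflag, hV⟩
    refine (reach_samplePass hP hs' hnD hdD hdN hm3 hm).mono le_rfl ?_
    rintro s'' - ⟨⟨h1, h2, ⟨h3, h4, h5⟩, h6, h7, h8, h9, h10⟩, hflag', hV', hV''⟩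
    have hsucc : (∀ g < m + 1, RegularPivots (hermiteMatrix P n d g) d) ↔
        (∀ g < m, RegularPivots (hermiteMatrix P n d g) d) ∧
          RegularPivots (hermiteMatrix P n d m) d := by
      refine ⟨fun h => ⟨fun l hl => h l (by omega), h m (by omega)⟩, fun h l hl => ?_⟩
      rcases Nat.lt_succ_iff_lt_or_eq.1 hl with h' | h'
      · exact h.1 l h'
      · rw [h']; exact h.2
    refine ⟨⟨by simpa using h1, by simpa using h2, ⟨by simpa using h3, h4, h5⟩, h6, h7, h8, h9, h10⟩,
      ?_, fun hreg k hk g hg => ?_⟩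
    · rw [State.setIdx_mem, hflag', hflag, keepIf_congr hsucc]
      simp only [keepIf]
      split_ifs <;> tauto
    · rw [State.setIdx_mem]
      rcases Nat.lt_succ_iff_lt_or_eq.1 hg with h' | h'
      · rw [hV'' k g (by omega), hV (hsucc.1 hreg).1 k hk g h']
      · rw [h', hV' (hsucc.1 hreg).2 k hk]
  · simp only [IExp.cost]
    calc _ ≤ (N + 1) * (1100 * (D + 1) ^ 3) := Nat.mul_le_mul_left _ (by omega)
      _ = _ := by ring
  · rintro s' - ⟨-, -, h⟩
    exact h

end RealRAM

end

/-! ### Total degree, tables, and the complete decision procedure. -/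

section

open Finset Polynomial

namespace RealRAM

/-- Find the total degree of the polynomial in the array `0`, whose degree in each variable is
at most the content of register `0`; the cell `(21, 0, 0)` tells whether it is nonzero. -/
def findTotalDegree : Program :=
  forUp 5 (.add (.reg 0) (.const 1))
    (forUp 6 (.add (.reg 0) (.const 1))
      (.cond (isZero (.load 0 (.reg 5) (.reg 6))) .skip
        (.seq (.setMem 21 (.const 0) (.const 0) (.const 1))
          (.cond (.ile (.add (.reg 5) (.reg 6)) (.reg 1)) .skip
            (.setIdx 1 (.add (.reg 5) (.reg 6)))))))

/-- Register `1` and the cell `(21, 0, 0)` are correct for the part `S` of the coefficients. -/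
structure DegreeInv (P : ℕ → ℕ → ℝ) (S : ℕ → ℕ → Prop) (s : State) : Prop where
  le : ∀ i j, S i j → P i j ≠ 0 → i + j ≤ s.idx 1 ∧ s.mem 21 0 0 = 1
  attained : s.mem 21 0 0 = 0 ∧ s.idx 1 = 0 ∨ s.mem 21 0 0 = 1 ∧ ∃ i j, P i j ≠ 0 ∧ i + j = s.idx 1

theorem DegreeInv.congr {P : ℕ → ℕ → ℝ} {S S' : ℕ → ℕ → Prop} {s s' : State}
    (h : DegreeInv P S s) (hS : ∀ i j, S' i j → P i j ≠ 0 → S i j) (h1 : s'.idx 1 = s.idx 1)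
    (h21 : s'.mem 21 0 0 = s.mem 21 0 0) : DegreeInv P S' s' := by
  refine ⟨fun i j hij hP => ?_, ?_⟩
  · rw [h1, h21]; exact h.le i j (hS i j hij hP) hP
  · rw [h1, h21]; exact h.attained

theorem reach_findTotalDegree {P : ℕ → ℕ → ℝ} {n : ℕ} {s : State} (hn : s.idx 0 = n)
    (h1 : s.idx 1 = 0) (h21 : s.mem 21 0 0 = 0) (h0 : ∀ i j, s.mem 0 i j = P i j)
    (hP : ∀ i j, n < i ∨ n < j → P i j = 0) :
    Reach findTotalDegree s (400 * (n + 1) ^ 2) fun s' => DegreeInv P (fun _ _ => True) s' := by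
  refine (Reach.forUp (M := n + 1) (Bb := 150 * (n + 1))
    (fun m s' => DegreeInv P (fun i _ => i < m) s') (by decide) ?_ ?_ ?_ ?_).mono le_rfl ?_
  · intro s' hF
    simp [IExp.eval, hF.idx 0 (by decide), hn]
  · exact ⟨fun i j hi => absurd hi (by omega), Or.inl (by simp [h21, h1])⟩
  · intro m hm s' hF hm5 hI
    have hn' : s'.idx 0 = n := (hF.idx 0 (by decide)).trans hn
    have hm0 := hF.mem 0 (by decide)
    refine (Reach.forUp (M := n + 1) (Bb := 60)
      (fun k s' => DegreeInv P (fun i j => i < m ∨ i = m ∧ j < k) s') (by decide) ?_ ?_ ?_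
      ?_).mono le_rfl ?_
    · intro s'' hF
      simp [IExp.eval, hF.idx 0 (by decide), hn']
    · exact hI.congr (fun i j h _ => by omega) (by simp) (by simp)
    · intro k hk s'' hF' hk6 hI'
      have hmem : s''.mem 0 m k = P m k := by rw [hF'.mem 0 (by decide), hm0, h0]
      have hm5' : s''.idx 5 = m := (hF'.idx 5 (by decide)).trans hm5
      refine Reach.cond (B' := 30) (fun hz => Reach.skip (by norm_num) ?_) (fun hz => ?_)
        (by decide)
      · simp only [isZero_holds, RExp.eval, IExp.eval, hm5', hk6, hmem] at hz
        refine hI'.congr (fun i j h hne => ?_) (by simp) (by simp)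
        rcases h with h | ⟨rfl, h⟩
        · exact Or.inl h
        · refine Or.inr ⟨rfl, lt_of_le_of_ne (by omega) ?_⟩
          rintro rfl; exact hne hz
      · simp only [isZero_holds, RExp.eval, IExp.eval, hm5', hk6, hmem] at hz
        refine Reach.seq (B₁ := 5) (R := fun t => t = s''.setMem 21 0 0 1) (B₂ := 20)
          (Reach.setMem (by decide) (by simp [RExp.eval, IExp.eval])) ?_ (by norm_num)
        rintro s₁ - hs₁
        refine Reach.cond (B' := 10) (fun hle => Reach.skip (by norm_num) ?_)
          (fun hle => Reach.setIdx (by decide) ?_) (by decide)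
        · simp only [Test.Holds, IExp.eval, hs₁, State.setMem_idx, hm5', hk6] at hle
          constructor
          · intro i j hij hne
            simp only [State.setIdx_idx, State.setIdx_mem, hs₁, State.setMem_mem_self,
              State.setMem_idx, and_true]
            rw [if_neg (by norm_num)]
            by_cases hnew : i = m ∧ j = k
            · rw [hnew.1, hnew.2]; exact hle
            · exact (hI'.le i j (by omega) hne).1
          · right
            simp only [State.setIdx_idx, State.setIdx_mem, hs₁, State.setMem_mem_self,
              State.setMem_idx, true_and]
            rw [if_neg (by norm_num)]
            rcases hI'.attained with h | h
            · refine ⟨m, k, hz, le_antisymm hle ?_⟩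
              rw [h.2]; exact Nat.zero_le _
            · exact h.2
        · simp only [Test.Holds, IExp.eval, hs₁, State.setMem_idx, hm5', hk6, not_le] at hle
          constructor
          · intro i j hij hne
            simp only [State.setIdx_idx, State.setIdx_mem, hs₁, State.setMem_mem_self,
              State.setMem_idx, and_true, IExp.eval, hm5', hk6]
            rw [if_neg (by norm_num), if_pos trivial]
            by_cases hnew : i = m ∧ j = k
            · rw [hnew.1, hnew.2]
            · exact (hI'.le i j (by omega) hne).1.trans hle.le
          · right
            simp only [State.setIdx_idx, State.setIdx_mem, hs₁, State.setMem_mem_self,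
              State.setMem_idx, true_and, IExp.eval, hm5', hk6]
            rw [if_neg (by norm_num), if_pos trivial]
            exact ⟨m, k, hz, rfl⟩
    · simp only [IExp.cost]; omega
    · rintro s'' - ⟨-, h⟩
      refine h.congr (fun i j hi hne => ?_) (by simp) (by simp)
      have : j ≤ n := by
        by_contra hj
        exact hne (hP i j (Or.inr (by omega)))
      omega
  · simp only [IExp.cost]
    calc _ ≤ (2 * (n + 1)) * (170 * (n + 1)) := Nat.mul_le_mul (by omega) (by omega)
      _ = 340 * (n + 1) ^ 2 := by ring
      _ ≤ _ := Nat.mul_le_mul_right _ (by norm_num)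
  · rintro s' - ⟨-, h⟩
    refine h.congr (fun i j _ hne => ?_) rfl rfl
    by_contra hi
    exact hne (hP i j (Or.inl (by omega)))

/-- Compare the signs of the top coefficients with the sign of their sum in the cell
`(20, 0, 0)`. -/
def topTest : Program :=
  .seq (.setMem 18 (.const 0) (.const 0) (.const 1))
    (forUp 5 (.add (.reg 1) (.const 1))
      (.cond (.rle (.const 0) (.mul (.load 0 (.reg 5) (.sub (.reg 1) (.reg 5)))
          (.load 20 (.const 0) (.const 0)))) .skip
        (.setMem 18 (.const 0) (.const 0) (.const 0))))

theorem reach_topTest {P : ℕ → ℕ → ℝ} {d : ℕ} {c : ℝ} {s : State} (hd : s.idx 1 = d)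
    (h0 : ∀ i j, s.mem 0 i j = P i j) (hc : s.mem 20 0 0 = c) :
    Reach topTest s (200 * (d + 1)) fun s' =>
      s'.mem 18 0 0 = keepIf (∀ i < d + 1, 0 ≤ P i (d - i) * c) 1 := by
  refine Reach.seq (B₁ := 5) (R := fun s' => s'.mem 18 0 0 = 1) (B₂ := 150 * (d + 1))
    (Reach.setMem (by decide) (by simp [RExp.eval, IExp.eval])) ?_ (by omega)
  intro s₁ hF₁ hs₁
  rw [← hs₁]
  have hd₁ : s₁.idx 1 = d := (hF₁.idx 1 (by decide)).trans hd
  refine Reach.forUp_flag (M := d + 1) (Bb := 40) (fun i => 0 ≤ P i (d - i) * c) (by decide) ?_ ?_ ?_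
  · intro s' hF
    simp [IExp.eval, hF.idx 1 (by decide), hd₁]
  · intro i hi s' hF hi5
    have e1 : s'.idx 1 = d := (hF.idx 1 (by decide)).trans hd₁
    have e2 : s'.mem 0 = s.mem 0 := (hF.mem 0 (by decide)).trans (hF₁.mem 0 (by decide))
    have e3 : s'.mem 20 = s.mem 20 := (hF.mem 20 (by decide)).trans (hF₁.mem 20 (by decide))
    refine Reach.cond (B' := 10) (fun hz => Reach.skip (by norm_num) ?_)
      (fun hz => Reach.setMem (by decide) ?_) (by decide)
    · simp only [Test.Holds, RExp.eval, IExp.eval, e1, e2, e3, hi5, h0, hc, Int.cast_zero] at hz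
      rw [keepIf_pos hz]
    · simp only [Test.Holds, RExp.eval, IExp.eval, e1, e2, e3, hi5, h0, hc, Int.cast_zero] at hz
      rw [keepIf_neg hz]; simp [RExp.eval, IExp.eval]
  · simp only [IExp.cost]; omega

/-- Compute the number `3 d ^ 2 + 1` of sample points, and the tables `l` and `(-1) ^ l`. -/
def makeTables : Program :=
  .seq (.setIdx 2 (.const 1))
    (.seq (forUp 5 (.reg 1) (.setIdx 2 (.add (.reg 2) (.add (.reg 1) (.add (.reg 1) (.reg 1))))))
      (.seq (fill 1 (.const 0) (.add (.reg 5) (.const 1)) 5 (.add (.reg 2) (.const 1))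
          (.add (.load 1 (.const 0) (.reg 5)) (.const 1)))
        (.seq (.setMem 2 (.const 0) (.const 0) (.const 1))
          (fill 2 (.const 0) (.add (.reg 5) (.const 1)) 5 (.add (.reg 2) (.const 1))
            (.sub (.const 0) (.load 2 (.const 0) (.reg 5)))))))

/-- Index registers cannot be multiplied, so `3 * d ^ 2 + 1` arises by adding `3 * d` for `d` times.
The tables are filled by recurrence, each entry from the one before. -/
theorem reach_makeTables {d : ℕ} {s : State} (hd : s.idx 1 = d) (h1 : s.mem 1 0 0 = 0) :
    Reach makeTables s (200 * (3 * d ^ 2 + 2)) (Tables (3 * d ^ 2 + 1)) := by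
  have hdd : d ≤ d ^ 2 := Nat.le_self_pow (by norm_num) _
  refine Reach.seq (B₁ := 2) (R := fun s' => s' = s.setIdx 2 1) (B₂ := 190 * (3 * d ^ 2 + 2))
    (Reach.setIdx (by decide) (by simp [IExp.eval])) ?_ (by omega)
  intro s₁ hF₁ hs₁
  have hd₁ : s₁.idx 1 = d := (hF₁.idx 1 (by decide)).trans hd
  refine Reach.seq (B₁ := 20 * (d + 1)) (B₂ := 150 * (3 * d ^ 2 + 2))
    (Reach.forUp (M := d) (Bb := 8) (fun k s' => s'.idx 2 = 3 * (k * d) + 1) (by decide) ?_ ?_ ?_ ?_)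
    ?_ (by omega)
  · intro s' hF
    exact (hF.idx 1 (by decide)).trans hd₁
  · simp [hs₁]
  · intro k hk s' hF hk5 hI
    refine Reach.setIdx (by decide) ?_
    simp [IExp.eval, hI, (hF.idx 1 (by decide)).trans hd₁]
    ring
  · simp only [IExp.cost]; omega
  rintro s₂ hF₂ ⟨-, hN⟩
  rw [← sq] at hN
  set N := 3 * d ^ 2 + 1 with hNdef
  have h1₂ : s₂.mem 1 0 0 = 0 := by rw [hF₂.mem 1 (by decide), hF₁.mem 1 (by decide), h1]
  refine Reach.seq (B₁ := 50 * (N + 1)) (B₂ := 90 * (N + 1))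
    (reach_fill (N + 1) 0 1 (fun k => ((k + 1 : ℕ) : ℝ)) ?_ ?_ ?_) ?_ (by omega)
  · intro s' hs'; simp [IExp.eval, hs', hN]
  · intro k hk
    refine ⟨rfl, by simp [IExp.eval]; omega, ?_⟩
    simp only [RExp.eval, IExp.eval, State.setIdx_idx, State.setIdx_mem, State.fillRow_mem, if_true]
    rcases k with _ | k
    · simp [h1₂]
    · rw [if_pos (by simp)]; simp
  · simp only [IExp.cost, RExp.cost]; omega
  intro s₃ hF₃ hs₃
  refine Reach.seq (B₁ := 5) (R := fun s' => s' = s₃.setMem 2 0 0 1) (B₂ := 70 * (N + 1))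
    (Reach.setMem (by decide) (by simp [RExp.eval, IExp.eval])) ?_ (by omega)
  intro s₄ hF₄ hs₄
  refine (reach_fill (N + 1) 0 1 (fun k => (-1 : ℝ) ^ (k + 1)) ?_ ?_ ?_).mono le_rfl ?_
  · intro s' hs'; simp [IExp.eval, hs', hN, hs₄, hs₃]
  · intro k hk
    refine ⟨rfl, by simp [IExp.eval]; omega, ?_⟩
    simp only [RExp.eval, IExp.eval, State.setIdx_idx, State.setIdx_mem, State.fillRow_mem, if_true]
    rcases k with _ | k
    · simp [hs₄]
    · rw [if_pos (by simp)]; simp [pow_succ]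
  · simp only [IExp.cost, RExp.cost]; omega
  · rintro s₅ hF₅ rfl
    refine ⟨?_, fun l hl => ?_, fun l hl => ?_⟩
    · simp [hs₄, hs₃, hN]
    · have e : ((s₄.fillRow 2 0 1 (N + 1) fun k => (-1 : ℝ) ^ (k + 1)).setIdx 5 (N + 1)).mem 1
          = s₃.mem 1 := (hF₅.mem 1 (by decide)).trans (hF₄.mem 1 (by decide))
      rw [e, hs₃, State.setIdx_mem, State.fillRow_mem]
      rcases l with _ | l
      · simp [h1₂]
      · rw [if_pos (by simp; omega), Nat.add_sub_cancel]
    · simp only [State.setIdx_mem, State.fillRow_mem]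
      rcases l with _ | l
      · simp [hs₄]
      · rw [if_pos (by simp; omega), Nat.add_sub_cancel]

/-- The tests for a nonzero polynomial whose top coefficients have the nonzero sum in the cell
`(20, 0, 0)`. -/
def mainTest : Program :=
  .seq topTest
    (.seq (.divMem 20 (.const 0) (.const 1) (.const 1) (.load 20 (.const 0) (.const 0)))
      (.seq makeTables
        (.seq newtonTable
          (.seq sampleLoop
            (.seq (.cond (isPos (.load 18 (.const 0) (.const 0))) nonnegLoop .skip)
              (.cond (isPos (.load 18 (.const 0) (.const 0))) (.setIdx 0 (.const 1))
                (.setIdx 0 (.const 0))))))))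

/-- The number `3 * d ^ 2 + 1` exceeds `d * d`, as the sampling criterion requires, and three times
the degree of any minor, as the nonnegativity test requires. -/
theorem reach_mainTest {P : ℕ → ℕ → ℝ} {n d : ℕ} {s : State} (hn : s.idx 0 = n)
    (hd : s.idx 1 = d) (h0 : ∀ i j, s.mem 0 i j = P i j)
    (hz : ∀ a, a ∉ [0, 20, 21] → ∀ i j, s.mem a i j = 0)
    (hc : ∑ i ∈ range (d + 1), P i (d - i) ≠ 0)
    (hc20 : s.mem 20 0 0 = ∑ i ∈ range (d + 1), P i (d - i))
    (hP : ∀ i j, n < i ∨ n < j → P i j = 0) (hPd : ∀ i j, d < i + j → P i j = 0)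
    (hdn : d ≤ 2 * n) :
    Reach mainTest s (1600000 * (n + 1) ^ 5) fun s' =>
      ((∀ z w : ℂ, 0 < z.im → 0 < w.im → biEval P n z w ≠ 0) → s'.idx 0 = 1) ∧
      ((¬ ∀ z w : ℂ, 0 < z.im → 0 < w.im → biEval P n z w ≠ 0) → s'.idx 0 = 0) := by
  set N := 3 * d ^ 2 + 1 with hN
  set K := (n + 1) ^ 5 with hK
  have hdd : d ≤ d ^ 2 := Nat.le_self_pow (by norm_num) _
  have hK1 : n + 1 ≤ K := Nat.le_self_pow (by norm_num) _
  have hK2 : (n + 1) ^ 2 ≤ K := Nat.pow_le_pow_right (by omega) (by norm_num)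
  have hK4 : (n + 1) ^ 4 ≤ K := Nat.pow_le_pow_right (by omega) (by norm_num)
  -- From `d + 1 ≤ 2 * (n + 1)`; this bound turns all costs into multiples of `K`.
  have hN2 : N + 1 ≤ 12 * (n + 1) ^ 2 := by
    have := Nat.pow_le_pow_left (show d + 1 ≤ 2 * (n + 1) by omega) 2
    nlinarith
  have hN4 : (N + 1) ^ 2 ≤ 144 * (n + 1) ^ 4 :=
    (Nat.pow_le_pow_left hN2 2).trans (le_of_eq (by ring))
  have hcs : (N + 1) * (2 * n + 1) ^ 3 ≤ 96 * K :=
    (Nat.mul_le_mul hN2 (Nat.pow_le_pow_left (show 2 * n + 1 ≤ 2 * (n + 1) by omega) 3)).trans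
      (le_of_eq (by rw [hK]; ring))
  have hcn : (d + 1) * (N + 1) ^ 2 ≤ 288 * K :=
    (Nat.mul_le_mul (show d + 1 ≤ 2 * (n + 1) by omega) hN4).trans (le_of_eq (by rw [hK]; ring))
  have htop : ∃ i ≤ d, P i (d - i) ≠ 0 := by
    by_contra! h
    exact hc (sum_eq_zero fun i hi => h i (by rw [mem_range] at hi; omega))
  rw [stable_iff hP hPd htop (show d * d < N by rw [hN, sq]; omega)]
  refine Reach.seq (B₁ := 200 * (d + 1)) (B₂ := 1599000 * K) (reach_topTest hd h0 hc20) ?_ (by omega)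
  intro s₁ hF₁ hflag₁
  have h20₁ : s₁.mem 20 = s.mem 20 := hF₁.mem 20 (by decide)
  refine Reach.seq (B₁ := 10) (R := fun s' => s'.mem 20 0 1 = (∑ i ∈ range (d + 1), P i (d - i))⁻¹)
    (B₂ := 1598000 * K) (Reach.divMem ?_ (by decide) ?_) ?_ (by omega)
  · simp only [RExp.eval, IExp.eval, h20₁, hc20]; exact hc
  · simp [RExp.eval, IExp.eval, h20₁, hc20]
  intro s₂ hF₂ hinv₂
  have hd₂ : s₂.idx 1 = d := by rw [hF₂.idx 1 (by decide), hF₁.idx 1 (by decide), hd]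
  have h1₂ : s₂.mem 1 0 0 = 0 := by
    rw [hF₂.mem 1 (by decide), hF₁.mem 1 (by decide), hz 1 (by decide)]
  refine Reach.seq (B₁ := 200 * (N + 1)) (B₂ := 1590000 * K) (reach_makeTables hd₂ h1₂) ?_ (by omega)
  intro s₃ hF₃ hT₃
  have h3₃ : ∀ i j, s₃.mem 3 i j = 0 := by
    rw [hF₃.mem 3 (by decide), hF₂.mem 3 (by decide), hF₁.mem 3 (by decide)]
    exact hz 3 (by decide)
  refine Reach.seq (B₁ := 200 * (N + 1) ^ 2) (B₂ := 1500000 * K) (reach_newtonTable hT₃ h3₃) ?_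
    (by omega)
  intro s₄ hF₄ hB₄
  have hT₄ : Tables N s₄ := hT₃.of_frame hF₄ (by decide) (by decide) (by decide)
  have hS₄ : SampleData P n d N s₄ := by
    refine ⟨?_, ?_, hT₄, ?_, ?_, ?_, ?_, ?_⟩
    · rw [hF₄.idx 0 (by decide), hF₃.idx 0 (by decide), hF₂.idx 0 (by decide),
        hF₁.idx 0 (by decide), hn]
    · rw [hF₄.idx 1 (by decide), hF₃.idx 1 (by decide), hd₂]
    · rw [hF₄.mem 0 (by decide), hF₃.mem 0 (by decide), hF₂.mem 0 (by decide),
        hF₁.mem 0 (by decide)]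
      exact h0
    · rw [hF₄.mem 20 (by decide), hF₃.mem 20 (by decide), hinv₂]
    · rw [hF₄.mem 4 (by decide), hF₃.mem 4 (by decide), hF₂.mem 4 (by decide),
        hF₁.mem 4 (by decide)]
      exact hz 4 (by decide) 0
    · rw [hF₄.mem 4 (by decide), hF₃.mem 4 (by decide), hF₂.mem 4 (by decide),
        hF₁.mem 4 (by decide)]
      exact fun i => hz 4 (by decide) i 0
    · rw [hF₄.mem 5 (by decide), hF₃.mem 5 (by decide), hF₂.mem 5 (by decide),
        hF₁.mem 5 (by decide)]
      exact fun k _ => hz 5 (by decide) 0 k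
  have hflag₄ : s₄.mem 18 0 0
      = keepIf (∀ i < d + 1, 0 ≤ P i (d - i) * ∑ i ∈ range (d + 1), P i (d - i)) 1 := by
    rw [hF₄.mem 18 (by decide), hF₃.mem 18 (by decide), hF₂.mem 18 (by decide), hflag₁]
  refine Reach.seq (B₁ := 1100 * ((N + 1) * (2 * n + 1) ^ 3)) (B₂ := 1350000 * K)
    (reach_sampleLoop (D := 2 * n) hP hS₄ (by omega) hdn (by omega)) ?_ (by omega)
  rintro s₅ hF₅ ⟨hflag₅, hV₅⟩
  rw [hflag₄] at hflag₅
  set T := ∀ i < d + 1, 0 ≤ P i (d - i) * ∑ i ∈ range (d + 1), P i (d - i) with hT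
  set G := ∀ g < N, RegularPivots (hermiteMatrix P n d g) d with hG
  set H := ∀ k < d, ∀ x, 0 ≤ (hermiteMinor d (diagCoeff P n d) (k + 1)).eval x with hH
  have hT₅ : Tables N s₅ := hT₄.of_frame hF₅ (by decide) (by decide) (by decide)
  have hd₅ : s₅.idx 1 = d := by rw [hF₅.idx 1 (by decide), hS₄.totalDeg]
  have hB₅ : HoldsNewton N s₅ := by
    have h3 : s₅.mem 3 = s₄.mem 3 := hF₅.mem 3 (by decide)
    exact ⟨by rw [h3]; exact hB₄.zero, by rw [h3]; exact hB₄.coeff⟩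
  -- The machine tests the minors of orders `1, …, d`; the order `0` is trivial, and the
  -- nonvanishing of the sum was tested earlier.
  have hiff : (TopSameSign P d ∧ G ∧
      ∀ k ≤ d, ∀ γ, 0 ≤ (hermiteMinor d (diagCoeff P n d) k).eval γ) ↔ T ∧ G ∧ H := by
    refine ⟨fun h => ⟨fun i hi => h.1.2 i (by omega), h.2.1, fun k hk => h.2.2 (k + 1) (by omega)⟩,
      fun h => ⟨⟨hc, fun i hi => h.1 i (by omega)⟩, h.2.1, fun k hk γ => ?_⟩⟩
    rcases k with _ | k
    · rw [eval_hermiteMinor]; simp [leadingMinor]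
    · exact h.2.2 k (by omega) γ
  have hfin : ∀ s' : State, s'.mem 18 0 0 = keepIf (T ∧ G ∧ H) 1 →
      Reach (.cond (isPos (.load 18 (.const 0) (.const 0))) (.setIdx 0 (.const 1))
        (.setIdx 0 (.const 0))) s' 20 fun s' =>
        ((TopSameSign P d ∧ G ∧
          ∀ k ≤ d, ∀ γ, 0 ≤ (hermiteMinor d (diagCoeff P n d) k).eval γ) → s'.idx 0 = 1) ∧
        ((¬ (TopSameSign P d ∧ G ∧
          ∀ k ≤ d, ∀ γ, 0 ≤ (hermiteMinor d (diagCoeff P n d) k).eval γ)) → s'.idx 0 = 0) := by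
    intro s' hs'
    rw [hiff]
    refine Reach.cond (B' := 5) (fun hp => Reach.setIdx (by decide) ?_)
      (fun hp => Reach.setIdx (by decide) ?_) (by decide)
    · simp only [isPos_holds, RExp.eval, IExp.eval, hs'] at hp
      have : T ∧ G ∧ H := by
        by_contra hn
        rw [keepIf_neg hn] at hp; exact lt_irrefl _ hp
      exact ⟨fun _ => by simp [IExp.eval], fun hn => absurd this hn⟩
    · simp only [isPos_holds, RExp.eval, IExp.eval, hs'] at hp
      have : ¬ (T ∧ G ∧ H) := by
        intro hy
        rw [keepIf_pos hy] at hp; exact hp one_pos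
      exact ⟨fun hy => absurd hy this, fun _ => by simp [IExp.eval]⟩
  -- The minors in array `8` are guaranteed only if all samples passed, so the nonnegativity tests
  -- are run under a set flag only.
  refine Reach.seq (B₁ := 1340000 * K) (R := fun s' => s'.mem 18 0 0 = keepIf (T ∧ G ∧ H) 1)
    (B₂ := 20) (Reach.cond (B' := 1330000 * K) (fun hp => ?_)
      (fun hp => Reach.skip (by omega) ?_) ?_) (fun s' _ => hfin s') (by omega)
  · simp only [isPos_holds, RExp.eval, IExp.eval, hflag₅] at hp
    have hg : G := by
      by_contra hn
      rw [keepIf_neg hn] at hp; exact lt_irrefl _ hp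
    rw [keepIf_pos hg] at hp hflag₅
    have ht : T := by
      by_contra hn
      rw [keepIf_neg hn] at hp; exact lt_irrefl _ hp
    rw [keepIf_pos ht] at hflag₅
    refine (reach_nonnegLoop (f := hermiteMinor d (diagCoeff P n d)) hT₅ hd₅ hB₅ ?_ ?_).mono
      (by omega) ?_
    · intro k hk
      have := natDegree_hermiteMinor_le (natDegree_diagCoeff_le (n := n) hPd) hk
      rw [hN, sq]; omega
    · intro k hk i hi
      rw [hV₅ hg k hk i hi, eval_hermiteMinor]; rfl
    · intro s₆ _ h
      rw [h, hflag₅]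
      by_cases hh : H
      · rw [keepIf_pos ⟨ht, hg, hh⟩]; exact if_pos hh
      · rw [keepIf_neg fun h => hh h.2.2]; exact if_neg hh
  · simp only [isPos_holds, RExp.eval, IExp.eval, hflag₅] at hp
    have : ¬ (T ∧ G ∧ H) := by
      rintro ⟨ht, hg, -⟩
      rw [keepIf_pos hg, keepIf_pos ht] at hp; exact hp one_pos
    rw [hflag₅, keepIf_neg this]
    by_cases hg : G
    · rw [keepIf_pos hg]
      by_cases ht : T
      · rw [keepIf_pos hg, keepIf_pos ht] at hp; exact absurd one_pos hp
      · rw [keepIf_neg ht]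
    · rw [keepIf_neg hg]
  · simp only [isPos, Test.cost, RExp.cost, IExp.cost]; omega

/-- The decision procedure for real stability. -/
def stabilityTest : Program :=
  .seq findTotalDegree
    (.cond (isPos (.load 21 (.const 0) (.const 0)))
      (.seq (accum 20 (.const 0) (.const 0) 5 (.add (.reg 1) (.const 1))
          (.load 0 (.reg 5) (.sub (.reg 1) (.reg 5))))
        (.cond (isZero (.load 20 (.const 0) (.const 0))) (.setIdx 0 (.const 0)) mainTest))
      (.setIdx 0 (.const 1)))

/-- The zero polynomial is accepted at once. A vanishing sum of the top coefficients rules out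
stability and is sorted out before anything is divided by it. -/
theorem reach_stabilityTest {P : ℕ → ℕ → ℝ} {n : ℕ} {s : State} (hn : s.idx 0 = n)
    (h1 : s.idx 1 = 0) (h0 : ∀ i j, s.mem 0 i j = P i j) (hz : ∀ a ≠ 0, ∀ i j, s.mem a i j = 0)
    (hP : ∀ i j, n < i ∨ n < j → P i j = 0) :
    Reach stabilityTest s (2000000 * (n + 1) ^ 5) fun s' =>
      (((∀ i j, P i j = 0) ∨ ∀ z w : ℂ, 0 < z.im → 0 < w.im → biEval P n z w ≠ 0)
        → s'.idx 0 = 1) ∧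
      ((¬ ((∀ i j, P i j = 0) ∨ ∀ z w : ℂ, 0 < z.im → 0 < w.im → biEval P n z w ≠ 0))
        → s'.idx 0 = 0) := by
  have hK1 : n + 1 ≤ (n + 1) ^ 5 := Nat.le_self_pow (by norm_num) _
  have hK2 : (n + 1) ^ 2 ≤ (n + 1) ^ 5 := Nat.pow_le_pow_right (by omega) (by norm_num)
  refine Reach.seq (B₁ := 400 * (n + 1) ^ 2) (B₂ := 1800000 * (n + 1) ^ 5)
    (reach_findTotalDegree hn h1 (hz 21 (by norm_num) 0 0) h0 hP) ?_ (by omega)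
  intro s₁ hF₁ hI
  have hn₁ : s₁.idx 0 = n := (hF₁.idx 0 (by decide)).trans hn
  have h0₁ : ∀ i j, s₁.mem 0 i j = P i j := by rw [hF₁.mem 0 (by decide)]; exact h0
  obtain ⟨hle, hatt⟩ := hI
  refine Reach.cond (B' := 1700000 * (n + 1) ^ 5) (fun hp => ?_) (fun hp => Reach.setIdx ?_ ?_)
    (by simp only [isPos, Test.cost, RExp.cost, IExp.cost]; omega)
  · simp only [isPos_holds, RExp.eval, IExp.eval] at hp
    set d := s₁.idx 1 with hd
    have hne : ∃ i j, P i j ≠ 0 ∧ i + j = d := by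
      rcases hatt with h | h
      · rw [h.1] at hp; exact absurd hp (lt_irrefl _)
      · exact h.2
    have hPd : ∀ i j, d < i + j → P i j = 0 := by
      intro i j hij
      by_contra h
      exact absurd (hle i j trivial h).1 (by omega)
    have hnot : ¬ ∀ i j, P i j = 0 := by
      obtain ⟨i, j, h, -⟩ := hne
      exact fun h' => h (h' i j)
    have htop : ∃ i ≤ d, P i (d - i) ≠ 0 := by
      obtain ⟨i, j, h, hij⟩ := hne
      exact ⟨i, by omega, by rwa [show d - i = j by omega]⟩
    have hdn : d ≤ 2 * n := by
      obtain ⟨i, j, h, hij⟩ := hne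
      by_contra hlt
      exact h (hP i j (by omega))
    simp only [hnot, false_or]
    refine Reach.seq (B₁ := 60 * (n + 1)) (B₂ := 1650000 * (n + 1) ^ 5)
      (reach_accum (d + 1) 0 0 (fun i => P i (d - i)) ?_ ⟨rfl, rfl⟩ ?_ ?_) ?_ (by omega)
    · intro s' hs'
      exact ⟨rfl, rfl, by simp [IExp.eval, hs', hd]⟩
    · intro k hk x
      simp [RExp.eval, IExp.eval, State.setMem_mem, h0₁, ← hd]
    · simp only [IExp.cost, RExp.cost]; omega
    intro s₂ hF₂ hs₂
    have hc₂ : s₂.mem 20 0 0 = ∑ i ∈ range (d + 1), P i (d - i) := by simp [hs₂]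
    refine Reach.cond (B' := 1600000 * (n + 1) ^ 5) (fun hp => Reach.setIdx ?_ ?_) (fun hp => ?_)
      (by simp only [isZero, Test.cost, RExp.cost, IExp.cost]; omega)
    · simp only [IExp.cost]; omega
    · simp only [isZero_holds, RExp.eval, IExp.eval, hc₂] at hp
      refine ⟨fun h => ?_, fun _ => by simp [IExp.eval]⟩
      -- Only the condition on the top form is used, so any admissible number of samples will do.
      exact absurd hp ((stable_iff hP hPd htop (Nat.lt_succ_self _)).1 h).1.1
    · simp only [isZero_holds, RExp.eval, IExp.eval, hc₂] at hp
      refine reach_mainTest ((hF₂.idx 0 (by decide)).trans hn₁) (hF₂.idx 1 (by decide)) ?_ ?_ hp hc₂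
        hP hPd hdn
      · rw [hF₂.mem 0 (by decide)]; exact h0₁
      · intro a ha i j
        simp only [List.mem_cons, List.not_mem_nil, or_false, not_or] at ha
        have e : s₁.mem a = s.mem a := hF₁.mem a (by
          rw [show findTotalDegree.wMem = [21] from rfl]; simpa using ha.2.2)
        rw [hs₂, State.setIdx_mem, State.setMem_mem, if_neg (fun h => ha.2.1 h.1), e]
        exact hz a ha.1 i j
  · simp only [IExp.cost]; omega
  · simp only [isPos_holds, RExp.eval, IExp.eval] at hp
    have h21 : s₁.mem 21 0 0 = 0 := by
      rcases hatt with h | h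
      · exact h.1
      · rw [h.1] at hp; exact absurd one_pos hp
    have hall : ∀ i j, P i j = 0 := by
      intro i j
      by_contra h
      rw [(hle i j trivial h).2] at h21
      exact one_ne_zero h21
    exact ⟨fun _ => by simp [IExp.eval], fun h => absurd (Or.inl hall) h⟩

end RealRAM

theorem finsupp_fin_two_eq (m : Fin 2 →₀ ℕ) :
    Finsupp.single 0 (m 0) + Finsupp.single 1 (m 1) = m := by
  ext i
  fin_cases i <;> simp

open MvPolynomial in
theorem aeval_eq_biEval {n : ℕ} {p : MvPolynomial (Fin 2) ℝ} (hp : p ∈ restrictDegree (Fin 2) ℝ n)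
    (z : Fin 2 → ℂ) :
    aeval z p = biEval (fun i j => if i ≤ n ∧ j ≤ n then
      p.coeff (Finsupp.single 0 i + Finsupp.single 1 j) else 0) n (z 0) (z 1) := by
  rw [mem_restrictDegree] at hp
  rw [MvPolynomial.aeval_def, MvPolynomial.eval₂_eq', biEval, ← sum_product']
  refine sum_of_injOn (fun m => (m 0, m 1)) ?_ ?_ ?_ ?_
  · intro m _ m' _ h
    rw [← finsupp_fin_two_eq m, ← finsupp_fin_two_eq m', (Prod.mk.inj h).1, (Prod.mk.inj h).2]
  · intro m hm
    have h := hp m hm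
    simp [h 0, h 1]
  · rintro ⟨i, j⟩ _ hij
    have h0 : p.coeff (Finsupp.single 0 i + Finsupp.single 1 j) = 0 := by
      by_contra hne
      exact hij ⟨_, mem_support_iff.2 hne, by simp⟩
    simp [h0]
  · intro m hm
    have h := hp m hm
    simp only
    rw [if_pos ⟨h 0, h 1⟩, finsupp_fin_two_eq, Fin.prod_univ_two, mul_assoc]
    rfl

theorem realStable_iff {n : ℕ} {p : MvPolynomial (Fin 2) ℝ}
    (hp : p ∈ MvPolynomial.restrictDegree (Fin 2) ℝ n) {P : ℕ → ℕ → ℝ}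
    (hP : P = fun i j => if i ≤ n ∧ j ≤ n then
      p.coeff (Finsupp.single 0 i + Finsupp.single 1 j) else 0) :
    RealStable p ↔ (∀ i j, P i j = 0) ∨
      ∀ z w : ℂ, 0 < z.im → 0 < w.im → biEval P n z w ≠ 0 := by
  subst hP
  refine or_congr ⟨fun h i j => by simp [h], fun h => ?_⟩ ⟨fun h z w hz hw => ?_, fun h z hz => ?_⟩
  · ext m
    by_contra hne
    have hm := (MvPolynomial.mem_restrictDegree _ _ _).1 hp m (MvPolynomial.mem_support_iff.2 hne)
    have := h (m 0) (m 1)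
    beta_reduce at this
    rw [if_pos ⟨hm 0, hm 1⟩, finsupp_fin_two_eq] at this
    exact hne this
  · have := h ![z, w] (fun i => by fin_cases i <;> simp [hz, hw])
    rwa [aeval_eq_biEval hp] at this
  · rw [aeval_eq_biEval hp]
    exact h _ _ (hz 0) (hz 1)

end

theorem theorem1 :
    ∃ (P : RealRAM.Program) (C : ℕ),
      ∀ (n : ℕ) (p : MvPolynomial (Fin 2) ℝ), p ∈ MvPolynomial.restrictDegree (Fin 2) ℝ n →
        ∃ (t : ℕ) (s : RealRAM.State),
          RealRAM.Exec P (RealRAM.input n p) t s ∧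
          t ≤ C * (n + 1) ^ 5 ∧
          (RealStable p → s.answer = 1) ∧
          (¬ RealStable p → s.answer = 0) := by
  refine ⟨RealRAM.stabilityTest, 2000000, fun n p hp => ?_⟩
  rw [realStable_iff hp rfl]
  refine RealRAM.reach_stabilityTest (s := RealRAM.input n p) rfl rfl (fun i j => ?_)
    (fun a ha i j => ?_) (fun i j hij => if_neg (by omega))
  · simp [RealRAM.input]
  · simp [RealRAM.input, ha]
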